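/- Conventions. A monoid is a commutative cancellative semigroup with identity; for a domain $D$, $D^\bullet$ is its multiplicative monoid of non-zero elements. A monoid homomorphism $\theta\colon H\to B$ is a transfer homomorphism if $B=\theta(H)B^\times$, $\theta^{-1}(B^\times)=H^\times$, and whenever $\theta(a)=bc$ with $a\in H$ and $b,c\in B$, there are $v,w\in H$ with $a=vw$, $\theta(v)\in bB^\times$ and $\theta(w)\in cB^\times$. A monoid is Krull if it is completely integrally closed and satisfies the ascending chain condition on $v$-ideals (divisorial ideals); a monoid $H$ is transfer Krull if there is a transfer homomorphism from $H$ to a Krull monoid, and a domain $D$ is transfer Krull if $D^\bullet$ is. For an abelian group $G$, $\mathcal B(G)$ is the monoid of zero-sum sequences over $G$, i.e. of all elements of the free abelian monoid over $G$ with sum $0$. An order in a Dedekind domain $R$ is a subring $\mathcal O\subseteq R$ with the same quotient field as $R$ such that $R$ is a finitely generated $\mathcal O$-module; its conductor is $\mathfrak f=\{x\in R : xR\subseteq\mathcal O\}$. If precisely one prime ideal $P$ of $R$ lies over a prime ideal $\mathfrak p\neq 0$ of $\mathcal O$, then $\mathsf v_{\mathfrak p}$ denotes the $P$-adic valuation,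 restricted to the localization $\mathcal O_{\mathfrak p}$. A statement about $\mathsf v_{\mathfrak p}(u)$ includes the assertion that precisely one prime ideal of $R$ lies over $\mathfrak p$. Theorem. Let $R$ be a Dedekind domain with torsion class group $\mathrm{Cl}(R)$, and let $\mathcal O\subseteq R$ be an order with conductor $\mathfrak f$ such that $R/\mathfrak f$ is finite. (1) Suppose that $|\mathrm{Cl}(R)|\neq 2$ and that every class of $\mathrm{Cl}(R)$ contains a prime ideal coprime to $\mathfrak f$. Then $\mathcal O$ is transfer Krull if and only if the following two conditions hold: (a) $\mathcal O\cdot R^\times=R$; (b) $\mathsf v_{\mathfrak p}(u)=1$ for every prime ideal $\mathfrak p$ of $\mathcal O$ and every atom $u$ of $\mathcal O_{\mathfrak p}$. Moreover, if $\mathcal O$ is transfer Krull, then the inclusion $\mathcal O^\bullet\hookrightarrow R^\bullet$ is a transfer homomorphism, and there is a transfer homomorphism $\mathcal O^\bullet\to\mathcal B(\mathrm{Cl}(R))$. (2) Suppose that $|\mathrm{Cl}(R)|=2$ and that every class of the Picard group $\mathrm{Pic}(\mathcal O)$ contains a prime ideal of $\mathcal O$ coprime to $\mathfrak f$. Then $\mathcal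 O$ is transfer Krull if and only if the following two conditions hold: (a) $\mathcal O\cdot R^\times=R$; (b) for every prime ideal $\mathfrak p$ of $\mathcal O$, $\mathsf v_{\mathfrak p}(u)\in\{1,2\}$ for all atoms $u$ of $\mathcal O_{\mathfrak p}$, and if the prime ideal of $R$ lying over $\mathfrak p$ is principal, then $\mathsf v_{\mathfrak p}(u)=1$ for all atoms $u$ of $\mathcal O_{\mathfrak p}$. -/

import Mathlib

open scoped nonZeroDivisors

universe u

/-! ### Monoids, Krull monoids and transfer homomorphisms -/

section Monoids

/-- The divisorial inverse `X⁻¹ = {x ∈ q(H) | xX ⊆ H}` of a subset `X` of the quotient group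
`q(H)` of a commutative monoid `H`. -/
def vInv (H : Type u) [CommMonoid H] (X : Set (Algebra.GrothendieckGroup H)) :
    Set (Algebra.GrothendieckGroup H) :=
  {x | ∀ y ∈ X, x * y ∈ Set.range (Algebra.GrothendieckGroup.of (M := H))}

/-- A subset `I` of `H` is a `v`-ideal (divisorial ideal) if `I = (I⁻¹)⁻¹`. -/
def IsVIdeal (H : Type u) [CommMonoid H] (I : Set H) : Prop :=
  vInv H (vInv H (Algebra.GrothendieckGroup.of '' I)) = Algebra.GrothendieckGroup.of '' I

/-- `H` is completely integrally closed: every `x ∈ q(H)`, for which there is some `c ∈ H` with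
`c xⁿ ∈ H` for all positive integers `n`, lies in `H`. -/
def IsComplIntClosed (H : Type u) [CommMonoid H] : Prop :=
  ∀ x : Algebra.GrothendieckGroup H,
    (∃ c : H, ∀ n : ℕ, 0 < n →
      Algebra.GrothendieckGroup.of c * x ^ n ∈
        Set.range (Algebra.GrothendieckGroup.of (M := H))) →
    x ∈ Set.range (Algebra.GrothendieckGroup.of (M := H))

/-- A (commutative, cancellative) monoid is Krull if it is completely integrally closed and
satisfies the ascending chain condition on `v`-ideals. -/
structure IsKrullMonoid (H : Type u) [CancelCommMonoid H] : Prop where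
  complIntClosed : IsComplIntClosed H
  acc : WellFoundedGT {I : Set H // IsVIdeal H I}

/-- A transfer homomorphism. -/
structure IsTransferHom {H B : Type*} [CommMonoid H] [CommMonoid B] (θ : H →* B) : Prop where
  /-- (T1), first half: `B = θ(H) · B^×`. -/
  surj : ∀ b : B, ∃ h : H, ∃ e : Bˣ, b = θ h * e
  /-- (T1), second half: `θ⁻¹(B^×) = H^×`. -/
  isUnit_iff : ∀ h : H, IsUnit (θ h) ↔ IsUnit h
  /-- (T2), the transfer property. -/
  transfer : ∀ (a : H) (b c : B), θ a = b * c →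
    ∃ v w : H, a = v * w ∧ Associated (θ v) b ∧ Associated (θ w) c

/-- A monoid is transfer Krull if it has a transfer homomorphism to a Krull monoid. -/
def IsTransferKrull (H : Type u) [CommMonoid H] : Prop :=
  ∃ (B : Type u) (_ : CancelCommMonoid B) (θ : H →* B), IsKrullMonoid B ∧ IsTransferHom θ

/-- The monoid `𝓑(G)` of zero-sum sequences over an additive abelian group `G`, as a submonoid of
the (multiplicatively written) free abelian monoid over `G`. -/
def zeroSumMonoid (G : Type*) [AddCommGroup G] : Submonoid (Multiplicative (Multiset G)) where
  carrier := {s | s.toAdd.sum = 0}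
  one_mem' := by simp
  mul_mem' := by
    intro a b ha hb
    change _ = _ at ha hb ⊢
    rw [toAdd_mul, Multiset.sum_add, ha, hb, add_zero]

end Monoids

/-! ### Orders in Dedekind domains -/

section Orders

variable {R : Type u} [CommRing R]

/-- The subring `O` of `R` is an order in the domain `R`: it has the same quotient field as `R`,
and `R` is a finitely generated `O`-module. -/
structure IsOrder [IsDomain R] (O : Subring R) : Prop where
  finite : Module.Finite O R
  isFractionRing : IsFractionRing O (FractionRing R)

/-- The conductor `{x ∈ R | xR ⊆ O}` of `O`, as an ideal of `R`. -/
def orderConductor (O : Subring R) : Ideal R where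
  carrier := {x | ∀ y : R, x * y ∈ O}
  add_mem' := by
    intro a b ha hb y
    rw [add_mul]
    exact O.add_mem (ha y) (hb y)
  zero_mem' := by
    intro y
    rw [zero_mul]
    exact O.zero_mem
  smul_mem' := by
    intro c x hx y
    have h := hx (c * y)
    rwa [smul_eq_mul, mul_comm c x, mul_assoc]

/-- The inclusion `O^• ↪ R^•` of the multiplicative monoids of non-zero elements. -/
def orderInclusion [IsDomain R] (O : Subring R) : O⁰ →* R⁰ where
  toFun a := ⟨((a : O) : R), mem_nonZeroDivisors_of_ne_zero fun h =>
    nonZeroDivisors.coe_ne_zero a (Subtype.ext h)⟩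
  map_one' := rfl
  map_mul' _ _ := rfl

/-- The embedding of the localization `O_𝔭` into the quotient field of `R`. -/
noncomputable def locToFrac [IsDomain R] (O : Subring R) (p : Ideal O) [p.IsPrime] :
    Localization.AtPrime p →+* FractionRing R :=
  IsLocalization.lift (M := p.primeCompl)
    (g := (algebraMap R (FractionRing R)).comp O.subtype) fun s => by
      rw [isUnit_iff_ne_zero]
      intro h
      have h1 : O.subtype (s : O) = 0 :=
        (IsFractionRing.injective R (FractionRing R)) (by simpa using h)
      have h2 : (s : O) = 0 := Subtype.ext h1
      exact s.2 (h2 ▸ p.zero_mem)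

/-- The prime ideal `P ≠ 0` of `R` lies over the prime ideal `p` of `O`, that is `P ∩ O = p`. -/
def PrimeOver [IsDedekindDomain R] (O : Subring R)
    (P : IsDedekindDomain.HeightOneSpectrum R) (p : Ideal O) : Prop :=
  P.asIdeal.comap O.subtype = p

/-- `v_𝔭(x) = n`: there is precisely one prime ideal `P` of `R` lying over `p`
(so that `v_𝔭` is defined), and the `P`-adic exponent of `x ∈ O_𝔭` is `n`. -/
def HasLocalValue [IsDedekindDomain R] (O : Subring R) (p : Ideal O) [p.IsPrime]
    (x : Localization.AtPrime p) (n : ℕ) : Prop :=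
  ∃ P : IsDedekindDomain.HeightOneSpectrum R,
    (∀ Q : IsDedekindDomain.HeightOneSpectrum R, PrimeOver O Q p ↔ Q = P) ∧
    P.valuation (FractionRing R) (locToFrac O p x) = WithZero.exp (-(n : ℤ))

/-- Every class of `Cl(R)` contains a prime ideal coprime to the conductor of `O`. -/
def ClassesContainPrimes [IsDedekindDomain R] (O : Subring R) : Prop :=
  ∀ c : ClassGroup R, ∃ P : IsDedekindDomain.HeightOneSpectrum R,
    IsCoprime P.asIdeal (orderConductor O) ∧
    ClassGroup.mk0 ⟨P.asIdeal, mem_nonZeroDivisors_of_ne_zero P.ne_bot⟩ = c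

/-- Every class of `Pic(O)` (the invertible fractional ideals of `O` modulo the principal ones)
contains a prime ideal of `O` coprime to the conductor (viewed as an ideal of `O`). -/
def PicClassesContainPrimes [IsDomain R] (O : Subring R) : Prop :=
  ∀ c : ClassGroup O, ∃ (q : Ideal O) (I : (FractionalIdeal O⁰ (FractionRing O))ˣ),
    q.IsPrime ∧ IsCoprime q ((orderConductor O).comap O.subtype) ∧
    (I : FractionalIdeal O⁰ (FractionRing O)) = (q : FractionalIdeal O⁰ (FractionRing O)) ∧
    ClassGroup.mk (K := FractionRing O) I = c

/-- `O · R^× = R`. -/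
def MulUnitsEqAll (O : Subring R) : Prop :=
  ∀ r : R, ∃ a : O, ∃ e : Rˣ, r = (a : R) * (e : R)

end Orders

/-!
Write `f` for the conductor of `O` and call an ideal of `R` coprime to `f` regular. Since `f`
multiplies `R` into `O`, a transfer homomorphism from `O⁰` to a Krull monoid extends to a
homomorphism `θ` on `R⁰`. Hence if `a ∈ O` is a product of non-units of `R` that have powers in
`O`, then `a` is also a product of the same number of non-units of `O`
(`exists_list_not_isUnit`). If moreover `a` is a product of two elements of `R` with at most three
prime ideal factors, none of them principal, then `a` is a product of two atoms of `O`
(`exists_eq_mul_irreducible`), because `θ` maps such elements to atoms.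

Necessity of the conditions is obtained by exhibiting factorizations in `R` that cannot be moved
into `O`.
* Every regular principal ideal is generated by an element of `O`. If there are at least three
  classes, this reduces to products of two or three prime ideals
  (`generatedIn_of_idealClass_eq_one`). If there are two classes, the invertible ideals
  `r R ∩ O` and prime ideals in their inverse Picard classes reduce it to prime ideals
  (`generatedIn_of_picClassesContainPrimes`).
* There is only one prime ideal of `R` over each non-zero prime ideal of `O` (`eq_of_comap_eq`).
  Otherwise `O` contains atoms in arbitrarily high powers of each of these prime ideals. As `θ`
  maps atoms of `O` to atoms, it maps generators of powers of these prime ideals to units, though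
  a power of their product is a non-unit of `O`.
* By the Chinese remainder theorem, elements of `O` can now be prescribed, up to local units, at
  the prime ideals above `f` (`exists_unit_mul_mem`). In particular, an atom of a localization of
  `O` of exponent `n` at `P` can be chosen to generate `P ^ n * J` for any regular `J` that makes
  this ideal principal. Choosing suitable `J` restricts `n` (`ordAt_eq_one_or_eq_two`,
  `ordAt_eq_one`).
* An element of exponent `1` at each prime ideal above `f` then exists in `O`, and its powers show
  that `O` meets every class of associated elements of `R` (`mulUnitsEqAll`).

Conversely, a factorization in `R` of an element of `O` can be moved into `O` by a unit if this
is possible locally (`exists_unit_mul_mem_and_mul_mem`). If all exponents are `1`, it is always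
possible, so the inclusion is a transfer homomorphism, and it can be composed with the block
homomorphism of `R`. If there are two classes, count non-principal prime ideals with weight `1/2`;
then every non-unit of `O` is divisible by an element of weight `1`, and the weight defines a
transfer homomorphism to the powers of a prime element of a discrete valuation domain
(`isTransferKrull_of_two_classes`).
-/

open IsDedekindDomain UniqueFactorizationMonoid

/-! ### Non-zero elements of a Dedekind domain form a Krull monoid -/

section Krull

variable (R : Type u) [CommRing R] [IsDomain R]

/-- The cancellative monoid `R⁰` of non-zero elements of a domain. -/
@[reducible]
def nonZeroDivisorsCancelCommMonoid : CancelCommMonoid R⁰ :=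
  { (inferInstance : CommMonoid R⁰) with
    mul_left_cancel := fun a _ _ h => Subtype.ext
      (mul_left_cancel₀ (nonZeroDivisors.coe_ne_zero a) (congrArg Subtype.val h)) }

/-- The embedding of the quotient group of `R⁰` into the multiplicative group of the quotient
field. -/
noncomputable def quotientGroupToUnits :
    Algebra.GrothendieckGroup R⁰ →* (FractionRing R)ˣ :=
  Algebra.GrothendieckGroup.lift
    { toFun := fun r => Units.mk0 (algebraMap R (FractionRing R) r) (by simp)
      map_one' := by ext; simp
      map_mul' := fun a b => by ext; simp }

variable {R}

lemma quotientGroupToUnits_of (r : R⁰) :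
    (quotientGroupToUnits R (Algebra.GrothendieckGroup.of r) : FractionRing R) =
      algebraMap R (FractionRing R) r := by
  have := Equiv.symm_apply_apply (Algebra.GrothendieckGroup.lift (M := R⁰)
    (G := (FractionRing R)ˣ))
    { toFun := fun r => Units.mk0 (algebraMap R (FractionRing R) r) (by simp)
      map_one' := by ext; simp
      map_mul' := fun a b => by ext; simp }
  have h := DFunLike.congr_fun this r
  exact congrArg Units.val h

lemma exists_mul_of_eq_of (x : Algebra.GrothendieckGroup R⁰) :
    ∃ a b : R⁰, x * Algebra.GrothendieckGroup.of b = Algebra.GrothendieckGroup.of a := by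
  obtain ⟨⟨a, b⟩, h⟩ := (Localization.monoidOf (⊤ : Submonoid R⁰)).surj x
  exact ⟨a, b, h⟩

lemma eq_of_iff (x : Algebra.GrothendieckGroup R⁰) (r : R⁰) :
    x = Algebra.GrothendieckGroup.of r ↔
      (quotientGroupToUnits R x : FractionRing R) = algebraMap R (FractionRing R) r := by
  refine ⟨fun h => h ▸ quotientGroupToUnits_of r, fun h => ?_⟩
  obtain ⟨a, b, hab⟩ := exists_mul_of_eq_of x
  have h1 := congrArg (fun y => (quotientGroupToUnits R y : FractionRing R)) hab
  simp only [map_mul, Units.val_mul, quotientGroupToUnits_of, h] at h1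
  have h2 : r * b = a := by
    apply Subtype.ext
    apply IsFractionRing.injective R (FractionRing R)
    simpa using h1
  rw [← h2, map_mul] at hab
  exact mul_right_cancel hab

lemma mem_range_of_iff (x : Algebra.GrothendieckGroup R⁰) :
    x ∈ Set.range (Algebra.GrothendieckGroup.of (M := R⁰)) ↔
      (quotientGroupToUnits R x : FractionRing R) ∈ (algebraMap R (FractionRing R)).range := by
  constructor
  · rintro ⟨r, rfl⟩
    exact ⟨r, (quotientGroupToUnits_of r).symm⟩
  · rintro ⟨r, hr⟩
    have h0 : r ≠ 0 := by
      rintro rfl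
      exact (quotientGroupToUnits R x).ne_zero (by simpa using hr.symm)
    exact ⟨⟨r, mem_nonZeroDivisors_of_ne_zero h0⟩, ((eq_of_iff x _).2 hr.symm).symm⟩

lemma isComplIntClosed_nonZeroDivisors [IsNoetherianRing R] [IsIntegrallyClosed R] :
    IsComplIntClosed R⁰ := by
  rintro x ⟨c, hc⟩
  rw [mem_range_of_iff]
  have h : IsAlmostIntegral R (quotientGroupToUnits R x : FractionRing R) := by
    refine ⟨c, c.2, fun n => ?_⟩
    rcases Nat.eq_zero_or_pos n with rfl | hn
    · exact ⟨c, by simp [Algebra.smul_def]⟩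
    · have := (mem_range_of_iff _).1 (hc n hn)
      rw [map_mul, map_pow, Units.val_mul, quotientGroupToUnits_of, Units.val_pow_eq_pow_val] at this
      rwa [Algebra.smul_def]
  obtain ⟨y, hy⟩ := IsIntegrallyClosed.isIntegral_iff.1 h.isIntegral
  exact ⟨y, hy⟩

/-- A `v`-ideal of `R⁰`, together with zero, is an ideal of the ring `R`. -/
def IsVIdeal.toIdeal {I : Set R⁰} (hI : IsVIdeal R⁰ I) : Ideal R where
  carrier := {r | r = 0 ∨ ∃ h : r ∈ R⁰, (⟨r, h⟩ : R⁰) ∈ I}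
  zero_mem' := Or.inl rfl
  add_mem' := by
    have key : ∀ r : R⁰, r ∈ I ↔ Algebra.GrothendieckGroup.of r ∈
        vInv R⁰ (vInv R⁰ (Algebra.GrothendieckGroup.of '' I)) := by
      intro r
      rw [hI]
      refine ⟨fun h => ⟨r, h, rfl⟩, ?_⟩
      rintro ⟨s, hs, hsr⟩
      rw [eq_of_iff, quotientGroupToUnits_of] at hsr
      rwa [← Subtype.ext (IsFractionRing.injective R (FractionRing R) hsr)]
    rintro a b (rfl | ⟨ha, haI⟩) (rfl | ⟨hb, hbI⟩)
    · exact Or.inl (by simp)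
    · exact Or.inr ⟨by simpa using hb, by simpa using hbI⟩
    · exact Or.inr ⟨by simpa using ha, by simpa using haI⟩
    · by_cases h0 : a + b = 0
      · exact Or.inl h0
      refine Or.inr ⟨mem_nonZeroDivisors_of_ne_zero h0, (key _).2 fun y hy => ?_⟩
      have h1 := (mem_range_of_iff _).1 ((key _).1 haI y hy)
      have h2 := (mem_range_of_iff _).1 ((key _).1 hbI y hy)
      rw [mem_range_of_iff]
      rw [map_mul, Units.val_mul, quotientGroupToUnits_of] at h1 h2 ⊢
      have h3 := add_mem h1 h2
      rwa [← add_mul, ← map_add] at h3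
  smul_mem' := by
    rintro c r (rfl | ⟨hr, hrI⟩)
    · exact Or.inl (by simp)
    by_cases hc : c = 0
    · exact Or.inl (by simp [hc])
    have hc' := mem_nonZeroDivisors_of_ne_zero hc
    refine Or.inr ⟨mul_mem hc' hr, ?_⟩
    have h : Algebra.GrothendieckGroup.of ((⟨c, hc'⟩ : R⁰) * ⟨r, hr⟩) ∈
        Algebra.GrothendieckGroup.of '' I := by
      rw [← hI]
      intro y hy
      have h1 : Algebra.GrothendieckGroup.of (⟨r, hr⟩ : R⁰) ∈
          vInv R⁰ (vInv R⁰ (Algebra.GrothendieckGroup.of '' I)) := by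
        rw [hI]; exact ⟨_, hrI, rfl⟩
      obtain ⟨z, hz⟩ := h1 y hy
      exact ⟨⟨c, hc'⟩ * z, by rw [map_mul, map_mul, hz, mul_assoc]⟩
    obtain ⟨s, hs, hsr⟩ := h
    rw [eq_of_iff, quotientGroupToUnits_of] at hsr
    rwa [Subtype.ext (IsFractionRing.injective R (FractionRing R) hsr)] at hs

lemma IsVIdeal.mem_toIdeal {I : Set R⁰} (hI : IsVIdeal R⁰ I) (r : R⁰) :
    (r : R) ∈ hI.toIdeal ↔ r ∈ I := by
  refine ⟨?_, fun h => Or.inr ⟨r.2, h⟩⟩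
  rintro (h | ⟨h, hI⟩)
  · exact absurd h (nonZeroDivisors.coe_ne_zero r)
  · exact hI

end Krull

lemma isKrullMonoid_nonZeroDivisors (R : Type u) [CommRing R] [IsDedekindDomain R] :
    @IsKrullMonoid R⁰ (nonZeroDivisorsCancelCommMonoid R) := by
  refine @IsKrullMonoid.mk R⁰ (nonZeroDivisorsCancelCommMonoid R)
    isComplIntClosed_nonZeroDivisors ?_
  have hmono : StrictMono fun I : {I : Set R⁰ // IsVIdeal R⁰ I} => I.2.toIdeal := by
    intro I J hIJ
    refine lt_of_le_of_ne ?_ fun h => ?_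
    · rintro r (rfl | ⟨hr, hrI⟩)
      · exact zero_mem _
      · exact Or.inr ⟨hr, hIJ.le hrI⟩
    · refine hIJ.ne (Subtype.ext (Set.ext fun r => ?_))
      have h' : I.2.toIdeal = J.2.toIdeal := h
      rw [← I.2.mem_toIdeal, ← J.2.mem_toIdeal, h']
  exact hmono.wellFoundedGT

/-! ### Transfer homomorphisms -/

section Transfer

variable {H B C : Type*} [CommMonoid H] [CommMonoid B] [CommMonoid C]

lemma IsTransferHom.comp {β : B →* C} {θ : H →* B} (hβ : IsTransferHom β)
    (hθ : IsTransferHom θ) : IsTransferHom (β.comp θ) where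
  surj c := by
    obtain ⟨b, e, rfl⟩ := hβ.surj c
    obtain ⟨h, e', rfl⟩ := hθ.surj b
    exact ⟨h, Units.map β e' * e, by simp [mul_assoc]⟩
  isUnit_iff h := (hβ.isUnit_iff _).trans (hθ.isUnit_iff h)
  transfer a b c h := by
    obtain ⟨b', c', hbc, hb, hc⟩ := hβ.transfer (θ a) b c h
    obtain ⟨v, w, hvw, hv, hw⟩ := hθ.transfer a b' c' hbc
    exact ⟨v, w, hvw, (hv.map β).trans hb, (hw.map β).trans hc⟩

lemma IsTransferHom.exists_list {θ : H →* B} (hθ : IsTransferHom θ) (l : List B) :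
    ∀ a : H, Associated (θ a) l.prod →
      ∃ l' : List H, Associated l'.prod a ∧
        List.Forall₂ (fun v b => Associated (θ v) b) l' l := by
  induction l with
  | nil =>
    intro a ha
    refine ⟨[], ?_, List.Forall₂.nil⟩
    have h1 : IsUnit a := (hθ.isUnit_iff a).1 (by simpa using ha)
    exact (associated_one_iff_isUnit.2 h1).symm
  | cons b l ih =>
    rintro a ⟨e, he⟩
    have h1 : θ a = b * (l.prod * ↑e⁻¹) := by
      rw [← mul_assoc, ← List.prod_cons, ← he, mul_assoc, Units.mul_inv, mul_one]
    obtain ⟨v, w, rfl, hv, hw⟩ := hθ.transfer a _ _ h1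
    obtain ⟨l', hl', hall⟩ := ih w (hw.trans ⟨e, by rw [mul_assoc, Units.inv_mul, mul_one]⟩)
    exact ⟨v :: l', by rw [List.prod_cons]; exact (Associated.refl v).mul_mul hl',
      List.Forall₂.cons hv hall⟩

/-- A homomorphism from `H` to a completely integrally closed monoid extends to every overmonoid
`D` that is mapped into `H` by the multiplication with an element of `H`. -/
theorem exists_extension_of_isComplIntClosed {H D B : Type*} [CommMonoid H] [CommMonoid D]
    [CancelCommMonoid B] (hB : IsComplIntClosed B) (ι : H →* D) (hι : Function.Injective ι)
    (f : H) (hf : ∀ d : D, ∃ h : H, ι h = ι f * d) (θ : H →* B) :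
    ∃ θ' : D →* B, ∀ h : H, θ' (ι h) = θ h := by
  choose g hg using hf
  have hinj : Function.Injective (Algebra.GrothendieckGroup.of (M := B)) :=
    Algebra.GrothendieckGroup.of_injective
  have hex : ∀ d : D, ∃ b : B, θ (g d) = θ f * b := by
    intro d
    set x : Algebra.GrothendieckGroup B :=
      Algebra.GrothendieckGroup.of (θ (g d)) / Algebra.GrothendieckGroup.of (θ f) with hx
    obtain ⟨b, hb⟩ := hB x ⟨θ f, fun n _ => ⟨θ (g (d ^ n)), by
      have h1 : g (d ^ n) * f ^ n = f * g d ^ n := by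
        apply hι
        simp only [map_mul, map_pow, hg, mul_pow]
        ac_rfl
      have h2 := congrArg (fun y => Algebra.GrothendieckGroup.of (θ y)) h1
      simp only [map_mul, map_pow] at h2
      rw [hx, div_pow, mul_div_assoc', ← h2, mul_div_cancel_right]⟩⟩
    exact ⟨b, hinj (by rw [map_mul, hb, hx, mul_div_cancel])⟩
  choose b hb using hex
  refine ⟨{ toFun := b, map_one' := ?_, map_mul' := fun d d' => ?_ }, fun h => ?_⟩
  · have h1 : g 1 = f := hι (by rw [hg, mul_one])
    have h2 := hb 1
    rw [h1] at h2
    exact (mul_left_cancel (h2.symm.trans (mul_one _).symm))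
  · have h1 : f * g (d * d') = g d * g d' := by
      apply hι
      simp only [map_mul, hg]
      ac_rfl
    have h2 := congrArg θ h1
    simp only [map_mul, hb] at h2
    refine mul_left_cancel (a := θ f) (mul_left_cancel (a := θ f) ?_)
    rw [h2]
    ac_rfl
  · have h1 : g (ι h) = f * h := hι (by rw [hg, map_mul])
    have h2 := hb (ι h)
    rw [h1, map_mul] at h2
    exact (mul_left_cancel h2).symm

end Transfer

/-! ### Exponents of prime ideals and ideal classes -/

section Dedekind

variable {R : Type u} [CommRing R] [IsDedekindDomain R]

/-- The exponent of the prime ideal `P` in the factorization of the ideal `I`. -/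
noncomputable def ordAt (P : HeightOneSpectrum R) (I : Ideal R) : ℕ :=
  (normalizedFactors I).count P.asIdeal

/-- The number of prime ideals, counted with multiplicity, in the factorization of `I`. -/
noncomputable def numPrimes (I : Ideal R) : ℕ := (normalizedFactors I).card

lemma span_singleton_ne_bot {x : R} (hx : x ≠ 0) : Ideal.span {x} ≠ ⊥ := by
  simpa using hx

lemma span_singleton_mul_eq (x y : R) :
    Ideal.span {x * y} = Ideal.span {x} * Ideal.span {y} :=
  (Ideal.span_singleton_mul_span_singleton x y).symm

lemma ordAt_mul (P : HeightOneSpectrum R) {I J : Ideal R} (hI : I ≠ ⊥) (hJ : J ≠ ⊥) :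
    ordAt P (I * J) = ordAt P I + ordAt P J := by
  rw [ordAt, normalizedFactors_mul hI hJ, Multiset.count_add, ordAt, ordAt]

lemma ordAt_pow (P : HeightOneSpectrum R) (I : Ideal R) (n : ℕ) :
    ordAt P (I ^ n) = n * ordAt P I := by
  rw [ordAt, normalizedFactors_pow, Multiset.count_nsmul, ordAt]

lemma ordAt_top (P : HeightOneSpectrum R) : ordAt P (⊤ : Ideal R) = 0 := by
  rw [ordAt, ← Ideal.one_eq_top, normalizedFactors_one, Multiset.count_zero]

lemma le_ordAt_iff (P : HeightOneSpectrum R) {I : Ideal R} (hI : I ≠ ⊥) (n : ℕ) :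
    n ≤ ordAt P I ↔ I ≤ P.asIdeal ^ n := by
  have h := emultiplicity_eq_count_normalizedFactors P.irreducible hI
  rw [normalize_eq] at h
  rw [← Ideal.dvd_iff_le, pow_dvd_iff_le_emultiplicity, h, Nat.cast_le, ordAt]

lemma mem_pow_iff_le_ordAt (P : HeightOneSpectrum R) {x : R} (hx : x ≠ 0) (n : ℕ) :
    x ∈ P.asIdeal ^ n ↔ n ≤ ordAt P (Ideal.span {x}) := by
  rw [le_ordAt_iff P (span_singleton_ne_bot hx), Ideal.span_singleton_le_iff_mem]

lemma mem_iff_ordAt_pos (P : HeightOneSpectrum R) {x : R} (hx : x ≠ 0) :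
    x ∈ P.asIdeal ↔ 0 < ordAt P (Ideal.span {x}) := by
  have := mem_pow_iff_le_ordAt P hx 1
  rwa [pow_one] at this

lemma ordAt_pos_iff (P : HeightOneSpectrum R) {I : Ideal R} (hI : I ≠ ⊥) :
    0 < ordAt P I ↔ I ≤ P.asIdeal := by
  have := le_ordAt_iff P hI 1
  rwa [pow_one] at this

lemma ordAt_self (P : HeightOneSpectrum R) : ordAt P P.asIdeal = 1 := by
  rw [ordAt, normalizedFactors_irreducible P.irreducible, normalize_eq,
    Multiset.count_singleton_self]

lemma ordAt_of_ne {P Q : HeightOneSpectrum R} (h : P ≠ Q) : ordAt P Q.asIdeal = 0 := by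
  rw [ordAt, normalizedFactors_irreducible Q.irreducible, normalize_eq, Multiset.count_singleton,
    if_neg fun h' => h (HeightOneSpectrum.ext h')]

lemma ordAt_span_mul (P : HeightOneSpectrum R) {x y : R} (hx : x ≠ 0) (hy : y ≠ 0) :
    ordAt P (Ideal.span {x * y}) = ordAt P (Ideal.span {x}) + ordAt P (Ideal.span {y}) := by
  rw [span_singleton_mul_eq, ordAt_mul P (span_singleton_ne_bot hx) (span_singleton_ne_bot hy)]

lemma ordAt_mono (P : HeightOneSpectrum R) {I J : Ideal R} (hJ : J ≠ ⊥) (h : I ∣ J) :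
    ordAt P I ≤ ordAt P J := by
  obtain ⟨K, rfl⟩ := h
  rw [ordAt_mul P (left_ne_zero_of_mul hJ) (right_ne_zero_of_mul hJ)]
  exact Nat.le_add_right _ _

lemma intValuation_eq_exp_neg_ordAt (P : HeightOneSpectrum R) {x : R} (hx : x ≠ 0) :
    P.intValuation x = WithZero.exp (-(ordAt P (Ideal.span {x}) : ℤ)) := by
  rw [P.intValuation_eq_exp_neg_multiplicity hx, ordAt,
    HeightOneSpectrum.count_normalizedFactors_eq_multiplicity (span_singleton_ne_bot hx)]

lemma numPrimes_mul {I J : Ideal R} (hI : I ≠ ⊥) (hJ : J ≠ ⊥) :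
    numPrimes (I * J) = numPrimes I + numPrimes J := by
  rw [numPrimes, normalizedFactors_mul hI hJ, Multiset.card_add, numPrimes, numPrimes]

lemma numPrimes_pow (I : Ideal R) (n : ℕ) : numPrimes (I ^ n) = n * numPrimes I := by
  rw [numPrimes, normalizedFactors_pow, Multiset.card_nsmul, numPrimes]

lemma numPrimes_self (P : HeightOneSpectrum R) : numPrimes P.asIdeal = 1 := by
  rw [numPrimes, normalizedFactors_irreducible P.irreducible, Multiset.card_singleton]

lemma numPrimes_eq_zero_iff {I : Ideal R} (hI : I ≠ ⊥) : numPrimes I = 0 ↔ I = ⊤ := by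
  rw [numPrimes, Multiset.card_eq_zero, normalizedFactors_eq_zero_iff hI, Ideal.isUnit_iff]

lemma exists_mul_of_le {P : HeightOneSpectrum R} {I : Ideal R} (h : I ≤ P.asIdeal) :
    ∃ J, I = P.asIdeal * J :=
  Ideal.dvd_iff_le.2 h

lemma exists_eq_mul_of_ne_top {I : Ideal R} (hI : I ≠ ⊥) (h : I ≠ ⊤) :
    ∃ (P : HeightOneSpectrum R) (J : Ideal R), I = P.asIdeal * J := by
  obtain ⟨M, hM, hle⟩ := Ideal.exists_le_maximal I h
  have hb : M ≠ ⊥ := fun h' => hI (le_bot_iff.1 (h' ▸ hle))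
  exact ⟨⟨M, hM.isPrime, hb⟩, exists_mul_of_le (P := ⟨M, hM.isPrime, hb⟩) hle⟩

/-- If a prime ideal divides a product of two ideals, then it can be split off one of them. -/
lemma eq_mul_or_eq_mul_of_mul_eq {P : HeightOneSpectrum R} {V W Z : Ideal R}
    (h : V * W = P.asIdeal * Z) :
    (∃ V', V = P.asIdeal * V' ∧ V' * W = Z) ∨ ∃ W', W = P.asIdeal * W' ∧ V * W' = Z := by
  have hP : P.asIdeal ≠ 0 := P.ne_bot
  rcases (P.prime.dvd_mul).1 (Dvd.intro Z h.symm) with ⟨V', rfl⟩ | ⟨W', rfl⟩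
  · refine Or.inl ⟨V', rfl, mul_left_cancel₀ hP ?_⟩
    rw [← h, mul_assoc]
  · refine Or.inr ⟨W', rfl, mul_left_cancel₀ hP ?_⟩
    rw [← h, mul_left_comm]

/-- The ideal class of `I`, with the value `1` at the zero ideal. -/
noncomputable def idealClass (I : Ideal R) : ClassGroup R :=
  open Classical in
  if h : I = ⊥ then 1 else ClassGroup.mk0 ⟨I, mem_nonZeroDivisors_of_ne_zero h⟩

lemma idealClass_eq_mk0 {I : Ideal R} (h : I ≠ ⊥) :
    idealClass I = ClassGroup.mk0 ⟨I, mem_nonZeroDivisors_of_ne_zero h⟩ := by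
  rw [idealClass, dif_neg h]

lemma idealClass_mul {I J : Ideal R} (hI : I ≠ ⊥) (hJ : J ≠ ⊥) :
    idealClass (I * J) = idealClass I * idealClass J := by
  rw [idealClass_eq_mk0 hI, idealClass_eq_mk0 hJ, idealClass_eq_mk0 (mul_ne_zero hI hJ), ← map_mul]
  rfl

lemma idealClass_pow {I : Ideal R} (hI : I ≠ ⊥) (n : ℕ) :
    idealClass (I ^ n) = idealClass I ^ n := by
  rw [idealClass_eq_mk0 hI, idealClass_eq_mk0 (pow_ne_zero n hI), ← map_pow]
  rfl

lemma idealClass_eq_one_iff {I : Ideal R} (hI : I ≠ ⊥) :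
    idealClass I = 1 ↔ ∃ x : R, I = Ideal.span {x} := by
  rw [idealClass_eq_mk0 hI, ClassGroup.mk0_eq_one_iff]
  exact ⟨fun h => ⟨_, h.principal.choose_spec⟩, fun ⟨x, hx⟩ => ⟨⟨x, hx⟩⟩⟩

lemma idealClass_span {x : R} (hx : x ≠ 0) : idealClass (Ideal.span {x}) = 1 :=
  (idealClass_eq_one_iff (span_singleton_ne_bot hx)).2 ⟨x, rfl⟩

lemma idealClass_top : idealClass (⊤ : Ideal R) = 1 := by
  have := idealClass_span (R := R) one_ne_zero
  rwa [Ideal.span_singleton_one] at this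

/-- A local solution of `y * r = b`, modulo any power of `P`, for elements with the same
exponent at `P`. -/
lemma exists_mul_sub_mem_pow (P : HeightOneSpectrum R) {y b : R} (hy : y ≠ 0) (hb : b ≠ 0)
    (h : ordAt P (Ideal.span {y}) = ordAt P (Ideal.span {b})) (k : ℕ) :
    ∃ r : R, y * r - b ∈ P.asIdeal ^ (ordAt P (Ideal.span {b}) + k) := by
  have h1 := Ideal.irreducible_pow_sup (span_singleton_ne_bot hy) P.irreducible
    (ordAt P (Ideal.span {b}) + k)
  have h2 : b ∈ P.asIdeal ^ ordAt P (Ideal.span {b}) := (mem_pow_iff_le_ordAt P hb _).2 le_rfl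
  change _ = P.asIdeal ^ min (ordAt P (Ideal.span {y})) _ at h1
  rw [h, min_eq_left (Nat.le_add_right _ _)] at h1
  rw [← h1] at h2
  obtain ⟨u, hu, v, hv, huv⟩ := Submodule.mem_sup.1 h2
  obtain ⟨r, rfl⟩ := Ideal.mem_span_singleton'.1 hv
  refine ⟨r, ?_⟩
  have h3 : y * r - b = -u := by rw [← huv]; ring
  rw [h3]
  exact neg_mem hu

end Dedekind

/-! ### The conductor of an order -/

section Order

variable {R : Type u} [CommRing R] {O : Subring R}

lemma mem_of_mem_orderConductor {x : R} (hx : x ∈ orderConductor O) : x ∈ O := by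
  simpa using hx 1

lemma mem_of_sub_mem_orderConductor {x y : R} (hy : y ∈ O) (h : x - y ∈ orderConductor O) :
    x ∈ O := by
  simpa using O.add_mem (mem_of_mem_orderConductor h) hy

variable [IsDedekindDomain R]

lemma IsOrder.isUnit_coe_iff (hO : IsOrder O) (a : O) : IsUnit (a : R) ↔ IsUnit a := by
  have := hO.finite
  have hint : Algebra.IsIntegral O R := inferInstance
  have hl := (algebraMap_isIntegral_iff.2 hint).isLocalHom Subtype.val_injective
  exact ⟨fun h => hl.map_nonunit a h, fun h => h.map O.subtype⟩

lemma IsOrder.orderConductor_ne_bot (hO : IsOrder O) : orderConductor O ≠ ⊥ := by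
  classical
  have := hO.finite
  have := hO.isFractionRing
  obtain ⟨s, hs⟩ := Module.Finite.fg_top (R := O) (M := R)
  obtain ⟨b, hb⟩ := IsLocalization.exist_integer_multiples_of_finset O⁰
    (s.image (algebraMap R (FractionRing R)))
  have key : ∀ x : R, ((b : O) : R) * x ∈ O := by
    intro x
    have hx : x ∈ Submodule.span O (s : Set R) := hs ▸ Submodule.mem_top
    induction hx using Submodule.span_induction with
    | mem x hx =>
      obtain ⟨c, hc⟩ := hb _ (Finset.mem_image_of_mem _ hx)
      have : (c : R) = ((b : O) : R) * x := by
        apply IsFractionRing.injective R (FractionRing R)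
        rw [map_mul, ← Algebra.smul_def]
        rw [IsScalarTower.algebraMap_apply O R (FractionRing R)] at hc
        exact hc.trans (algebra_compatible_smul R _ _)
      exact this ▸ c.2
    | zero => simp
    | add x y _ _ hx hy => rw [mul_add]; exact O.add_mem hx hy
    | smul a x _ hx =>
      have : ((b : O) : R) * a • x = (a : R) * (((b : O) : R) * x) := by
        rw [Subring.smul_def, smul_eq_mul]; ring
      rw [this]
      exact O.mul_mem a.2 hx
  intro h
  have : ((b : O) : R) ∈ orderConductor O := key
  rw [h] at this
  exact nonZeroDivisors.coe_ne_zero b (Subtype.ext ((Submodule.mem_bot R).1 this))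

lemma isCoprime_orderConductor_iff (hO : IsOrder O) {I : Ideal R} :
    IsCoprime I (orderConductor O) ↔
      ∀ P : HeightOneSpectrum R, orderConductor O ≤ P.asIdeal → ¬ I ≤ P.asIdeal := by
  rw [Ideal.isCoprime_iff_sup_eq]
  constructor
  · intro h P h1 h2
    exact P.isPrime.ne_top (top_le_iff.1 (h ▸ sup_le h2 h1))
  · intro h
    by_contra hne
    obtain ⟨M, hM, hle⟩ := Ideal.exists_le_maximal _ hne
    have hb : M ≠ ⊥ := fun h' =>
      hO.orderConductor_ne_bot (le_bot_iff.1 (h' ▸ le_sup_right.trans hle))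
    exact h ⟨M, hM.isPrime, hb⟩ (le_sup_right.trans hle) (le_sup_left.trans hle)

lemma isCoprime_span_orderConductor_iff (hO : IsOrder O) {r : R} :
    IsCoprime (Ideal.span {r}) (orderConductor O) ↔
      ∀ P : HeightOneSpectrum R, orderConductor O ≤ P.asIdeal → r ∉ P.asIdeal := by
  simp only [isCoprime_orderConductor_iff hO, Ideal.span_singleton_le_iff_mem]

lemma exists_pow_sub_one_mem (hfin : Finite (R ⧸ orderConductor O)) {r : R}
    (hr : IsCoprime (Ideal.span {r}) (orderConductor O)) :
    ∃ k : ℕ, 0 < k ∧ r ^ k - 1 ∈ orderConductor O := by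
  rw [Ideal.isCoprime_iff_exists] at hr
  obtain ⟨x, hx, y, hy, hxy⟩ := hr
  obtain ⟨s, rfl⟩ := Ideal.mem_span_singleton'.1 hx
  have hu : IsUnit (Ideal.Quotient.mk (orderConductor O) r) := by
    refine IsUnit.of_mul_eq_one_right (Ideal.Quotient.mk (orderConductor O) s) ?_
    rw [← map_mul, ← map_one (Ideal.Quotient.mk (orderConductor O)), Ideal.Quotient.eq, ← hxy]
    simpa using neg_mem hy
  obtain ⟨u, hu⟩ := hu
  refine ⟨Nat.card (R ⧸ orderConductor O)ˣ, Nat.card_pos, ?_⟩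
  rw [← Ideal.Quotient.eq, map_pow, ← hu, ← Units.val_pow_eq_pow_val, pow_card_eq_one']
  simp

lemma exists_mul_sub_one_mem (hfin : Finite (R ⧸ orderConductor O)) {a : R} (ha : a ∈ O)
    (hr : IsCoprime (Ideal.span {a}) (orderConductor O)) :
    ∃ a' ∈ O, a * a' - 1 ∈ orderConductor O := by
  obtain ⟨k, hk, h⟩ := exists_pow_sub_one_mem hfin hr
  refine ⟨a ^ (k - 1), O.pow_mem ha _, ?_⟩
  rwa [← pow_succ', Nat.sub_add_cancel hk]

lemma mem_of_mul_mem (hfin : Finite (R ⧸ orderConductor O)) {a j : R} (ha : a ∈ O)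
    (hr : IsCoprime (Ideal.span {a}) (orderConductor O)) (h : a * j ∈ O) : j ∈ O := by
  obtain ⟨a', ha', h'⟩ := exists_mul_sub_one_mem hfin ha hr
  refine mem_of_sub_mem_orderConductor (O.mul_mem ha' h) ?_
  have := (orderConductor O).mul_mem_right (-j) h'
  convert this using 1
  ring

variable (O) in
/-- The ideal `I` of `R` is generated by an element of `O`. -/
def GeneratedIn (I : Ideal R) : Prop := ∃ a ∈ O, I = Ideal.span {a}

lemma GeneratedIn.mul {I J : Ideal R} (hI : GeneratedIn O I) (hJ : GeneratedIn O J) :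
    GeneratedIn O (I * J) := by
  obtain ⟨a, ha, rfl⟩ := hI
  obtain ⟨b, hb, rfl⟩ := hJ
  exact ⟨a * b, O.mul_mem ha hb, Ideal.span_singleton_mul_span_singleton a b⟩

lemma GeneratedIn.of_mul_left (hfin : Finite (R ⧸ orderConductor O)) {I J : Ideal R}
    (hr : IsCoprime I (orderConductor O)) (h0 : I ≠ ⊥) (hI : GeneratedIn O I)
    (h : GeneratedIn O (I * J)) : GeneratedIn O J := by
  obtain ⟨a, ha, hIa⟩ := hI
  obtain ⟨b, hb, hab⟩ := h
  have hb' : b ∈ I := by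
    have : b ∈ I * J := by
      rw [hab]
      exact Ideal.mem_span_singleton_self b
    exact (Ideal.mul_le_left : I * J ≤ I) this
  rw [hIa] at hb'
  obtain ⟨j, hj⟩ := Ideal.mem_span_singleton'.1 hb'
  have hjO : j ∈ O := by
    refine mem_of_mul_mem hfin ha (hIa ▸ hr) ?_
    rw [mul_comm, hj]
    exact hb
  refine ⟨j, hjO, ?_⟩
  have h1 : I * J = I * Ideal.span {j} := by
    rw [hab, hIa, ← span_singleton_mul_eq, mul_comm a j, hj]
  exact mul_left_cancel₀ (show I ≠ 0 from h0) h1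

/-- Every non-zero prime ideal of `R` contracts to a maximal ideal of the order. -/
lemma IsOrder.isMaximal_comap (hO : IsOrder O) (P : HeightOneSpectrum R) :
    (P.asIdeal.comap O.subtype).IsMaximal := by
  have := hO.finite
  have hint : Algebra.IsIntegral O R := inferInstance
  have := P.isMaximal
  exact Ideal.isMaximal_comap_of_isIntegral_of_isMaximal (R := O) P.asIdeal

lemma IsOrder.exists_primeOver (hO : IsOrder O) (p : Ideal O) [hp : p.IsPrime] (h : p ≠ ⊥) :
    ∃ P : HeightOneSpectrum R, PrimeOver O P p := by
  have := hO.finite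
  have hint : Algebra.IsIntegral O R := inferInstance
  obtain ⟨Q, -, hQ, hQp⟩ := Ideal.exists_ideal_over_prime_of_isIntegral p (⊥ : Ideal R) (by
    have h1 : (⊥ : Ideal R).comap (algebraMap O R) = ⊥ := by
      rw [← RingHom.ker_eq_comap_bot, (RingHom.injective_iff_ker_eq_bot _).1]
      exact Subtype.val_injective
    exact h1 ▸ bot_le)
  refine ⟨⟨Q, hQ, ?_⟩, hQp⟩
  rintro rfl
  apply h
  rw [← hQp, eq_bot_iff]
  intro x hx
  simpa using hx

/-- An ideal not contained in the only prime ideal `P` above `P ∩ O` meets `O` outside of `P`. -/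
lemma IsOrder.exists_mem_notMem (hO : IsOrder O) {P : HeightOneSpectrum R}
    (hP : ∀ Q : HeightOneSpectrum R,
      Q.asIdeal.comap O.subtype = P.asIdeal.comap O.subtype → Q = P)
    {I : Ideal R} (hI : ¬ I ≤ P.asIdeal) : ∃ τ ∈ O, τ ∈ I ∧ τ ∉ P.asIdeal := by
  by_contra! hcon
  have hpr := P.isPrime
  let S : Submonoid R := ((P.asIdeal.comap O.subtype).primeCompl).map O.subtype
  have hd : Disjoint (I : Set R) S := by
    rw [Set.disjoint_left]
    rintro x hx ⟨y, hy, rfl⟩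
    exact hy (hcon y y.2 hx)
  obtain ⟨Q, hQ, hIQ, hQd⟩ := Ideal.exists_le_prime_disjoint I S hd
  have hne : Q ≠ ⊥ := by
    rintro rfl
    exact hI (hIQ.trans bot_le)
  have hle : Q.comap O.subtype ≤ P.asIdeal.comap O.subtype := by
    intro y hy
    by_contra hy'
    exact Set.disjoint_left.1 hQd hy ⟨y, hy', rfl⟩
  have := hP ⟨Q, hQ, hne⟩
    ((hO.isMaximal_comap ⟨Q, hQ, hne⟩).eq_of_le (hO.isMaximal_comap P).ne_top hle)
  exact hI (hIQ.trans_eq (congrArg HeightOneSpectrum.asIdeal this))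

/-- Membership in `O` can be checked locally at the prime ideals containing the conductor. -/
lemma IsOrder.mem_of_forall_exists_mul_mem (hO : IsOrder O) {x : R}
    (h : ∀ P : HeightOneSpectrum R, orderConductor O ≤ P.asIdeal →
      ∃ s ∈ O, s ∉ P.asIdeal ∧ s * x ∈ O) : x ∈ O := by
  let D : Ideal O :=
    { carrier := {s | (s : R) * x ∈ O}
      zero_mem' := by simp
      add_mem' := fun {a b} ha hb => by
        change ((a + b : O) : R) * x ∈ O
        rw [Subring.coe_add, add_mul]
        exact O.add_mem ha hb
      smul_mem' := fun c a ha => by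
        change ((c * a : O) : R) * x ∈ O
        rw [Subring.coe_mul, mul_assoc]
        exact O.mul_mem c.2 ha }
  by_cases hD : D = ⊤
  · have h1 : (1 : O) ∈ D := hD ▸ Submodule.mem_top
    have h2 : ((1 : O) : R) * x ∈ O := h1
    simpa using h2
  obtain ⟨m, hm, hle⟩ := Ideal.exists_le_maximal D hD
  have hfm : ∀ y (hy : y ∈ orderConductor O), (⟨y, mem_of_mem_orderConductor hy⟩ : O) ∈ m :=
    fun y hy => hle (hy x)
  obtain ⟨y, hy, hy0⟩ := Submodule.exists_mem_ne_zero_of_ne_bot hO.orderConductor_ne_bot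
  have hb : m ≠ ⊥ := by
    rintro rfl
    exact hy0 (congrArg Subtype.val ((Submodule.mem_bot O).1 (hfm y hy)))
  have := hm.isPrime
  obtain ⟨P, hP⟩ := hO.exists_primeOver m hb
  obtain ⟨s, hs, hsP, hsx⟩ := h P fun y hy => by
    have := hfm y hy
    rw [← hP] at this
    exact this
  have h1 : (⟨s, hs⟩ : O) ∈ m := hle hsx
  rw [← hP] at h1
  exact absurd h1 hsP

end Order

/-! ### Extending a transfer homomorphism to the Dedekind domain -/

section Extension

variable {R : Type u} [CommRing R]

lemma isUnit_nonZeroDivisors_iff {S : Type*} [CommRing S] [IsDomain S] (x : S⁰) :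
    IsUnit x ↔ IsUnit (x : S) := by
  refine ⟨fun h => h.map S⁰.subtype, fun ⟨e, he⟩ => ?_⟩
  refine IsUnit.of_mul_eq_one ⟨↑e⁻¹, mem_nonZeroDivisors_of_ne_zero e⁻¹.ne_zero⟩ (Subtype.ext ?_)
  simp [← he]

variable [IsDedekindDomain R] {O : Subring R}

/-- Regarding a non-zero element of `R` as an element of `R⁰`. -/
def toNonZero (x : R) (hx : x ≠ 0) : R⁰ := ⟨x, mem_nonZeroDivisors_of_ne_zero hx⟩

lemma orderInclusion_injective : Function.Injective (orderInclusion O) :=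
  fun _ _ h => Subtype.ext (Subtype.ext (congrArg (fun y : R⁰ => (y : R)) h))

lemma coe_orderInclusion (a : O⁰) : ((orderInclusion O a : R⁰) : R) = ((a : O) : R) := rfl

/-- The conductor multiplies `R` into `O`, so a transfer homomorphism from `O⁰` to a Krull monoid
extends to a homomorphism on `R⁰`. -/
theorem exists_extension_of_isTransferKrull (hO : IsOrder O) (h : IsTransferKrull O⁰) :
    ∃ (B : Type u) (_ : CancelCommMonoid B) (θ : R⁰ →* B),
      IsTransferHom (θ.comp (orderInclusion O)) := by
  obtain ⟨B, hB, θ, hK, hθ⟩ := h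
  obtain ⟨f, hf, hf0⟩ := Submodule.exists_mem_ne_zero_of_ne_bot hO.orderConductor_ne_bot
  obtain ⟨θ', hθ'⟩ := exists_extension_of_isComplIntClosed hK.complIntClosed (orderInclusion O)
    orderInclusion_injective
    ⟨⟨f, mem_of_mem_orderConductor hf⟩,
      mem_nonZeroDivisors_of_ne_zero fun h => hf0 (congrArg Subtype.val h)⟩
    (fun d => ⟨⟨⟨f * d, hf d⟩, mem_nonZeroDivisors_of_ne_zero fun h =>
      mul_ne_zero hf0 (nonZeroDivisors.coe_ne_zero d) (congrArg Subtype.val h)⟩, rfl⟩) θ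
  refine ⟨B, hB, θ', ?_⟩
  have : θ'.comp (orderInclusion O) = θ := MonoidHom.ext hθ'
  rwa [this]

variable {B : Type u} [CancelCommMonoid B] {θ : R⁰ →* B}

lemma not_isUnit_map_of_pow_mem (hO : IsOrder O)
    (hθ : IsTransferHom (θ.comp (orderInclusion O))) {d : R} (hd : d ≠ 0)
    (hnu : ¬ IsUnit d) {k : ℕ} (hk : d ^ k ∈ O) (hk0 : 0 < k) : ¬ IsUnit (θ (toNonZero d hd)) := by
  intro h
  have h0 : (⟨d ^ k, hk⟩ : O) ≠ 0 := fun h => pow_ne_zero k hd (congrArg Subtype.val h)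
  have h1 := (hθ.isUnit_iff ⟨⟨d ^ k, hk⟩, mem_nonZeroDivisors_of_ne_zero h0⟩).1
    (by exact (map_pow θ (toNonZero d hd) k) ▸ h.pow k)
  rw [isUnit_nonZeroDivisors_iff, ← hO.isUnit_coe_iff] at h1
  exact hnu ((isUnit_pow_iff hk0.ne').1 h1)

lemma irreducible_of_irreducible_map (hθ : IsTransferHom (θ.comp (orderInclusion O))) {v : O⁰}
    (h : Irreducible (θ (orderInclusion O v))) : Irreducible (v : O) := by
  refine ⟨fun hu => h.not_isUnit ?_, fun a b hab => ?_⟩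
  · exact (hθ.isUnit_iff v).2 ((isUnit_nonZeroDivisors_iff v).2 hu)
  · have hv0 := nonZeroDivisors.coe_ne_zero v
    rw [hab] at hv0
    have ha := mem_nonZeroDivisors_of_ne_zero (left_ne_zero_of_mul hv0)
    have hb := mem_nonZeroDivisors_of_ne_zero (right_ne_zero_of_mul hv0)
    have hv : v = ⟨a, ha⟩ * ⟨b, hb⟩ := Subtype.ext hab
    rw [hv, map_mul, map_mul] at h
    rcases h.isUnit_or_isUnit rfl with h' | h'
    · exact Or.inl ((isUnit_nonZeroDivisors_iff _).1 ((hθ.isUnit_iff ⟨a, ha⟩).1 h'))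
    · exact Or.inr ((isUnit_nonZeroDivisors_iff _).1 ((hθ.isUnit_iff ⟨b, hb⟩).1 h'))

lemma two_le_numPrimes {x : R} (hx : x ≠ 0) (hnu : ¬ IsUnit x)
    (h : ∀ P : HeightOneSpectrum R, x ∈ P.asIdeal → idealClass P.asIdeal ≠ 1) :
    2 ≤ numPrimes (Ideal.span {x}) := by
  have hx' := span_singleton_ne_bot hx
  obtain ⟨P, J, hJ⟩ := exists_eq_mul_of_ne_top hx' (by rwa [ne_eq, Ideal.span_singleton_eq_top])
  have hJ0 : J ≠ ⊥ := by
    rintro rfl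
    exact hx' (by rw [hJ, Ideal.mul_bot])
  have hxP : x ∈ P.asIdeal := by
    rw [← Ideal.span_singleton_le_iff_mem, hJ]
    exact Ideal.mul_le_left
  rw [hJ, numPrimes_mul P.ne_bot hJ0, numPrimes_self]
  have : numPrimes J ≠ 0 := by
    rw [ne_eq, numPrimes_eq_zero_iff hJ0]
    rintro rfl
    rw [Ideal.mul_top] at hJ
    exact h P hxP (hJ ▸ idealClass_span hx)
  lia

lemma mul_length_le_numPrimes (c : ℕ) (l : List R)
    (h : ∀ x ∈ l, x ≠ 0 ∧ c ≤ numPrimes (Ideal.span {x})) :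
    l.prod ≠ 0 ∧ c * l.length ≤ numPrimes (Ideal.span {l.prod}) := by
  induction l with
  | nil => simp
  | cons x l ih =>
    obtain ⟨h1, h2⟩ := ih fun y hy => h y (List.mem_cons_of_mem _ hy)
    obtain ⟨h3, h4⟩ := h x List.mem_cons_self
    rw [List.prod_cons, List.length_cons]
    refine ⟨mul_ne_zero h3 h1, ?_⟩
    rw [span_singleton_mul_eq, numPrimes_mul (span_singleton_ne_bot h3)
      (span_singleton_ne_bot h1)]
    lia

/-- A factorization in `R`, of an element of `O`, into `n` non-units that have powers in `O`,
yields a factorization in `O` into `n` non-units. -/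
theorem exists_list_not_isUnit (hO : IsOrder O) (hθ : IsTransferHom (θ.comp (orderInclusion O)))
    {a : O} (ha : a ≠ 0) (l : List R)
    (hl : ∀ d ∈ l, ¬ IsUnit d ∧ ∃ k : ℕ, 0 < k ∧ d ^ k ∈ O)
    (hla : Associated (a : R) l.prod) :
    ∃ l' : List O, Associated l'.prod a ∧ l'.length = l.length ∧ ∀ v ∈ l', ¬ IsUnit v := by
  have ha' : (a : R) ≠ 0 := fun h => ha (Subtype.ext h)
  have hl0 : ∀ d ∈ l, d ≠ 0 := by
    rintro d hd rfl
    exact ha' (hla.eq_zero_iff.2 (List.prod_eq_zero hd))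
  let L : List R⁰ := l.attach.map fun d => toNonZero d.1 (hl0 d.1 d.2)
  have hL : (L.map θ).prod = θ L.prod := (map_list_prod θ L).symm
  have hLval : ((L.prod : R⁰) : R) = l.prod := by
    change R⁰.subtype L.prod = _
    rw [map_list_prod]
    simp only [L, List.map_map]
    conv_rhs => rw [← List.attach_map_subtype_val l]
    rfl
  have hass : Associated (θ (orderInclusion O ⟨a, mem_nonZeroDivisors_of_ne_zero ha⟩))
      (L.map θ).prod := by
    rw [hL]
    refine Associated.map θ ?_
    obtain ⟨e, he⟩ := hla
    have hu : IsUnit (toNonZero (e : R) e.ne_zero) := (isUnit_nonZeroDivisors_iff _).2 e.isUnit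
    refine ⟨hu.unit, Subtype.ext ?_⟩
    rw [hLval, ← he]
    rfl
  obtain ⟨l', hl', hall⟩ := hθ.exists_list _ _ hass
  refine ⟨l'.map O⁰.subtype, ?_, ?_, ?_⟩
  · rw [← map_list_prod]
    exact hl'.map O⁰.subtype
  · rw [List.length_map, hall.length_eq]
    simp [L]
  · intro v hv
    obtain ⟨v', hv', rfl⟩ := List.mem_map.1 hv
    obtain ⟨i, hi, rfl⟩ := List.mem_iff_getElem.1 hv'
    have h1 := hall.get (i := i) hi (hall.length_eq ▸ hi)
    intro hu
    have h2 : IsUnit (θ (orderInclusion O (l'[i]))) :=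
      (hθ.isUnit_iff _).2 ((isUnit_nonZeroDivisors_iff _).2 hu)
    have hi' : i < l.length := by
      have := hall.length_eq ▸ hi
      simpa [L] using this
    obtain ⟨hnu, k, hk, hkO⟩ := hl l[i] (List.getElem_mem hi')
    refine not_isUnit_map_of_pow_mem hO hθ (hl0 _ (List.getElem_mem hi')) hnu hkO hk ?_
    have h3 := h1.isUnit h2
    simpa [L] using h3

/-- The element `d` of `R` has a power in `O`, at most three prime factors, and none of them is
principal. -/
structure IsShort (O : Subring R) (d : R) : Prop where
  ne_zero : d ≠ 0
  not_isUnit : ¬ IsUnit d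
  exists_pow_mem : ∃ k : ℕ, 0 < k ∧ d ^ k ∈ O
  numPrimes_le : numPrimes (Ideal.span {d}) ≤ 3
  idealClass_ne : ∀ P : HeightOneSpectrum R, d ∈ P.asIdeal → idealClass P.asIdeal ≠ 1

/-- If the image of `d` were a product of two non-units, then some power `d ^ k` in `O` would
be a product of `2 * k` non-units, each of which has at least two prime factors. -/
lemma IsShort.irreducible_map (hO : IsOrder O)
    (hθ : IsTransferHom (θ.comp (orderInclusion O))) {d : R} (hd : IsShort O d) :
    Irreducible (θ (toNonZero d hd.ne_zero)) := by
  obtain ⟨k, hk, hkO⟩ := hd.exists_pow_mem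
  refine ⟨not_isUnit_map_of_pow_mem hO hθ hd.ne_zero hd.not_isUnit hkO hk, fun b c hbc => ?_⟩
  by_contra! hcon
  have hkz := pow_ne_zero k hd.ne_zero
  have ha0 : (⟨d ^ k, hkO⟩ : O) ≠ 0 := fun h => hkz (congrArg Subtype.val h)
  obtain ⟨l', hl', hall⟩ := hθ.exists_list (List.replicate k b ++ List.replicate k c)
    ⟨⟨d ^ k, hkO⟩, mem_nonZeroDivisors_of_ne_zero ha0⟩ (by
      rw [List.prod_append, List.prod_replicate, List.prod_replicate, ← mul_pow, ← hbc, ← map_pow]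
      exact Associated.refl _)
  have hnu : ∀ v ∈ l', ¬ IsUnit v := by
    intro v hv hu
    obtain ⟨i, hi, rfl⟩ := List.mem_iff_getElem.1 hv
    have h1 := hall.get (i := i) hi (hall.length_eq ▸ hi)
    have h2 := h1.isUnit ((hθ.isUnit_iff _).2 hu)
    have h3 : (List.replicate k b ++ List.replicate k c).get ⟨i, hall.length_eq ▸ hi⟩ ∈
      List.replicate k b ++ List.replicate k c := List.get_mem _ _
    rcases List.mem_append.1 h3 with h | h
    · rw [List.eq_of_mem_replicate h] at h2
      exact hcon.1 h2
    · rw [List.eq_of_mem_replicate h] at h2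
      exact hcon.2 h2
  have hprod : Associated ((l'.map fun v : O⁰ => ((v : O) : R)).prod) (d ^ k) := by
    have := hl'.map ((O.subtype : O →* R).comp O⁰.subtype)
    rw [map_list_prod] at this
    exact this
  have hcount := (mul_length_le_numPrimes 2 (l'.map fun v : O⁰ => ((v : O) : R)) (by
    intro x hx
    obtain ⟨v, hv, rfl⟩ := List.mem_map.1 hx
    have hv0 : ((v : O) : R) ≠ 0 := fun h => nonZeroDivisors.coe_ne_zero v (Subtype.ext h)
    refine ⟨hv0, two_le_numPrimes hv0 ?_ fun P hP => ?_⟩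
    · rw [hO.isUnit_coe_iff, ← isUnit_nonZeroDivisors_iff]
      exact hnu v hv
    · refine hd.idealClass_ne P (P.isPrime.mem_of_pow_mem k ?_)
      exact P.asIdeal.mem_of_dvd ((List.dvd_prod hx).trans hprod.dvd) hP)).2
  rw [Ideal.span_singleton_eq_span_singleton.2 hprod, List.length_map, hall.length_eq,
    ← Ideal.span_singleton_pow, numPrimes_pow, List.length_append, List.length_replicate,
    List.length_replicate] at hcount
  have := Nat.mul_le_mul_left k hd.numPrimes_le
  lia

theorem exists_eq_mul_irreducible (hO : IsOrder O)
    (hθ : IsTransferHom (θ.comp (orderInclusion O))) {a : O} {d₁ d₂ : R}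
    (h₁ : IsShort O d₁) (h₂ : IsShort O d₂) (h : Associated (a : R) (d₁ * d₂)) :
    ∃ v w : O, a = v * w ∧ Irreducible v ∧ Irreducible w := by
  have ha' : (a : R) ≠ 0 := fun h0 =>
    mul_ne_zero h₁.ne_zero h₂.ne_zero (h.eq_zero_iff.1 h0)
  have ha : a ≠ 0 := fun h0 => ha' (congrArg Subtype.val h0)
  obtain ⟨e, he⟩ := h.symm
  have hu : IsUnit (toNonZero (e : R) e.ne_zero) := (isUnit_nonZeroDivisors_iff _).2 e.isUnit
  have hfac : θ (orderInclusion O ⟨a, mem_nonZeroDivisors_of_ne_zero ha⟩) =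
      θ (toNonZero d₁ h₁.ne_zero) *
        (θ (toNonZero d₂ h₂.ne_zero) * θ (toNonZero (e : R) e.ne_zero)) := by
    rw [← map_mul, ← map_mul]
    refine congrArg θ (Subtype.ext ?_)
    change (a : R) = d₁ * (d₂ * e)
    rw [← he, mul_assoc]
  obtain ⟨v, w, hvw, hv, hw⟩ := hθ.transfer _ _ _ hfac
  refine ⟨v, w, congrArg Subtype.val hvw, ?_, ?_⟩
  · exact irreducible_of_irreducible_map hθ (hv.irreducible_iff.2 (h₁.irreducible_map hO hθ))
  · refine irreducible_of_irreducible_map hθ (hw.irreducible_iff.2 ?_)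
    exact (irreducible_mul_isUnit (hu.map θ)).2 (h₂.irreducible_map hO hθ)

end Extension

/-! ### Principal ideals coprime to the conductor -/

section Regular

variable {R : Type u} [CommRing R] [IsDedekindDomain R] {O : Subring R}

lemma heightOneSpectrum_eq_of_le {P Q : HeightOneSpectrum R} (h : Q.asIdeal ≤ P.asIdeal) :
    Q = P :=
  HeightOneSpectrum.ext (Q.isMaximal.eq_of_le P.isPrime.ne_top h)

lemma exists_pow_mem_of_isCoprime (hfin : Finite (R ⧸ orderConductor O)) {r : R}
    (hr : IsCoprime (Ideal.span {r}) (orderConductor O)) : ∃ k : ℕ, 0 < k ∧ r ^ k ∈ O := by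
  obtain ⟨k, hk, h⟩ := exists_pow_sub_one_mem hfin hr
  exact ⟨k, hk, mem_of_sub_mem_orderConductor O.one_mem h⟩

lemma GeneratedIn.pow {I : Ideal R} (hI : GeneratedIn O I) (n : ℕ) : GeneratedIn O (I ^ n) := by
  obtain ⟨a, ha, rfl⟩ := hI
  exact ⟨a ^ n, O.pow_mem ha n, Ideal.span_singleton_pow a n⟩

lemma generatedIn_top : GeneratedIn O (⊤ : Ideal R) :=
  ⟨1, O.one_mem, Ideal.span_singleton_one.symm⟩

lemma IsOrder.span_ne_top (hO : IsOrder O) {v : O} (hv : ¬ IsUnit v) :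
    Ideal.span {(v : R)} ≠ ⊤ := by
  rwa [ne_eq, Ideal.span_singleton_eq_top, hO.isUnit_coe_iff]

lemma coe_ne_zero_of_ne_zero {a : O} (ha : a ≠ 0) : (a : R) ≠ 0 :=
  fun h => ha (Subtype.ext h)

lemma span_coe_dvd {v a : O} (h : v ∣ a) : Ideal.span {(v : R)} ∣ Ideal.span {(a : R)} := by
  obtain ⟨w, rfl⟩ := h
  exact ⟨Ideal.span {(w : R)}, by rw [← span_singleton_mul_eq]; rfl⟩

variable {B : Type u} [CancelCommMonoid B] {θ : R⁰ →* B}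

/-- The smallest power of `Q` generated by an element `h` of `O` is already the smallest principal
power of `Q`: otherwise `h` is a proper power in `R`, hence a product of two non-units of `O`. -/
theorem generatedIn_pow_of_idealClass_pow_eq_one (hR : IsMulTorsion (ClassGroup R))
    (hO : IsOrder O) (hfin : Finite (R ⧸ orderConductor O))
    (hθ : IsTransferHom (θ.comp (orderInclusion O))) {Q : HeightOneSpectrum R}
    (hQ : IsCoprime Q.asIdeal (orderConductor O)) {m : ℕ} (hm : idealClass Q.asIdeal ^ m = 1) :
    GeneratedIn O (Q.asIdeal ^ m) := by
  classical
  have hm0 : 0 < orderOf (idealClass Q.asIdeal) := (hR _).orderOf_pos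
  set m₀ := orderOf (idealClass Q.asIdeal) with hm₀
  have hpow : ∀ n, Q.asIdeal ^ n ≠ ⊥ := fun n => pow_ne_zero n Q.ne_bot
  suffices h : GeneratedIn O (Q.asIdeal ^ m₀) by
    obtain ⟨t, rfl⟩ := orderOf_dvd_of_pow_eq_one hm
    rw [pow_mul]
    exact h.pow t
  obtain ⟨x, hx⟩ := (idealClass_eq_one_iff (hpow m₀)).1 (by
    rw [idealClass_pow Q.ne_bot, pow_orderOf_eq_one])
  have hxreg : IsCoprime (Ideal.span {x}) (orderConductor O) := hx ▸ hQ.pow_left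
  obtain ⟨k, hk, hkO⟩ := exists_pow_mem_of_isCoprime hfin hxreg
  have hex : ∃ j, 0 < j ∧ GeneratedIn O (Q.asIdeal ^ j) :=
    ⟨m₀ * k, Nat.mul_pos hm0 hk, x ^ k, hkO, by
      rw [pow_mul, hx, Ideal.span_singleton_pow]⟩
  obtain ⟨hj, h, hhO, hh⟩ := Nat.find_spec hex
  have hmin : ∀ i, 0 < i → GeneratedIn O (Q.asIdeal ^ i) → Nat.find hex ≤ i :=
    fun i hi hi' => Nat.find_min' hex ⟨hi, hi'⟩
  set j := Nat.find hex
  have hjcl : idealClass Q.asIdeal ^ j = 1 := by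
    rw [← idealClass_pow Q.ne_bot, idealClass_eq_one_iff (hpow j)]
    exact ⟨h, hh⟩
  obtain ⟨t, ht⟩ := orderOf_dvd_of_pow_eq_one hjcl
  rw [← hm₀] at ht
  have ht0 : 0 < t := Nat.pos_of_ne_zero (by rintro rfl; simp at ht; lia)
  have hh0 : h ≠ 0 := by
    rintro rfl
    exact hpow j (by rw [hh]; simp)
  have hxnu : ¬ IsUnit x := by
    rw [← Ideal.span_singleton_eq_top, ← hx]
    intro htop
    have := Ideal.pow_le_self (I := Q.asIdeal) hm0.ne'
    exact Q.isPrime.ne_top (top_le_iff.1 (htop ▸ this))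
  obtain ⟨l', hl', hlen, hnu⟩ := exists_list_not_isUnit hO hθ (a := ⟨h, hhO⟩)
    (fun h0 => hh0 (congrArg Subtype.val h0)) (List.replicate t x)
    (fun d hd => by rw [List.eq_of_mem_replicate hd]; exact ⟨hxnu, k, hk, hkO⟩)
    (by
      rw [List.prod_replicate, ← Ideal.span_singleton_eq_span_singleton,
        ← Ideal.span_singleton_pow, ← hx, ← pow_mul, ← ht, hh])
  rw [List.length_replicate] at hlen
  have hfac : ∀ v : O, ¬ IsUnit v → v ∣ ⟨h, hhO⟩ → Ideal.span {(v : R)} = Q.asIdeal ^ j := by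
    intro v hv hvh
    have h1 := span_coe_dvd hvh
    change _ ∣ Ideal.span {h} at h1
    rw [← hh, dvd_prime_pow Q.prime] at h1
    obtain ⟨i, hij, hi⟩ := h1
    rw [associated_iff_eq] at hi
    have hi0 : 0 < i := by
      refine Nat.pos_of_ne_zero ?_
      rintro rfl
      rw [pow_zero, Ideal.one_eq_top] at hi
      exact hO.span_ne_top hv hi
    rw [hi, le_antisymm hij (hmin i hi0 ⟨v, v.2, hi.symm⟩)]
  have ht1 : t = 1 := by
    match l', hlen, hnu, hl' with
    | [], hlen, _, _ => simp at hlen; lia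
    | [_], hlen, _, _ => simpa using hlen.symm
    | v :: w :: l, _, hnu, hl' =>
      exfalso
      have h1 : v * w ∣ ⟨h, hhO⟩ :=
        Dvd.dvd.trans ⟨l.prod, by simp [mul_assoc]⟩ hl'.dvd
      have h2 := span_coe_dvd h1
      rw [Subring.coe_mul, span_singleton_mul_eq,
        hfac v (hnu v (by simp)) ((dvd_mul_right v w).trans h1),
        hfac w (hnu w (by simp)) ((dvd_mul_left w v).trans h1)] at h2
      change _ ∣ Ideal.span {h} at h2
      rw [← hh, ← pow_add, pow_dvd_pow_iff Q.ne_bot Q.prime.not_isUnit] at h2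
      lia
  rw [ht1, mul_one] at ht
  exact ht ▸ ⟨h, hhO, hh⟩

lemma mem_iff_span_le {I : Ideal R} {x : R} : x ∈ I ↔ Ideal.span {x} ≤ I :=
  (Ideal.span_singleton_le_iff_mem I).symm

lemma eq_or_eq_of_mul_le {P Q Q' : HeightOneSpectrum R}
    (h : Q.asIdeal * Q'.asIdeal ≤ P.asIdeal) : P = Q ∨ P = Q' := by
  rcases (P.isPrime.mul_le).1 h with h | h
  · exact Or.inl (heightOneSpectrum_eq_of_le h).symm
  · exact Or.inr (heightOneSpectrum_eq_of_le h).symm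

/-- For classes of order `m ≥ 3`, the equation `Q ^ m * Q' ^ m = (Q * Q') ^ m` yields a factor in
`O` with only two prime factors, which has to be `Q * Q'`. -/
theorem generatedIn_mul_of_two_lt_orderOf (hR : IsMulTorsion (ClassGroup R))
    (hO : IsOrder O) (hfin : Finite (R ⧸ orderConductor O))
    (hθ : IsTransferHom (θ.comp (orderInclusion O))) {Q Q' : HeightOneSpectrum R}
    (hQ : IsCoprime Q.asIdeal (orderConductor O)) (hQ' : IsCoprime Q'.asIdeal (orderConductor O))
    (hcl : idealClass Q.asIdeal * idealClass Q'.asIdeal = 1)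
    (hsq : idealClass Q.asIdeal ^ 2 ≠ 1) : GeneratedIn O (Q.asIdeal * Q'.asIdeal) := by
  set m := orderOf (idealClass Q.asIdeal) with hm
  have hm0 : 0 < m := (hR _).orderOf_pos
  have hc1 : idealClass Q.asIdeal ≠ 1 := fun h => hsq (by rw [h, one_pow])
  have hc' : idealClass Q'.asIdeal = (idealClass Q.asIdeal)⁻¹ := eq_inv_of_mul_eq_one_right hcl
  have hc1' : idealClass Q'.asIdeal ≠ 1 := by rwa [hc', inv_ne_one]
  obtain ⟨a, ha, hQa⟩ := (generatedIn_pow_of_idealClass_pow_eq_one hR hO hfin hθ hQ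
    (pow_orderOf_eq_one _)).mul (generatedIn_pow_of_idealClass_pow_eq_one hR hO hfin hθ hQ'
    (m := m) (by rw [hc', inv_pow, pow_orderOf_eq_one, inv_one]))
  have hQQ : Q.asIdeal * Q'.asIdeal ≠ ⊥ := mul_ne_zero Q.ne_bot Q'.ne_bot
  obtain ⟨y, hy⟩ := (idealClass_eq_one_iff hQQ).1 (by rw [idealClass_mul Q.ne_bot Q'.ne_bot, hcl])
  have hy0 : y ≠ 0 := by
    rintro rfl
    exact hQQ (by rw [hy]; simp)
  have hyreg : IsCoprime (Ideal.span {y}) (orderConductor O) := hy ▸ hQ.mul_left hQ'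
  have hay : Ideal.span {a} = Ideal.span {y ^ m} := by
    rw [← hQa, ← mul_pow, hy, Ideal.span_singleton_pow]
  have ha0 : a ≠ 0 := by
    rintro rfl
    have := span_singleton_ne_bot (pow_ne_zero m hy0)
    rw [← hay] at this
    simp at this
  have hynu : ¬ IsUnit y := by
    rw [← Ideal.span_singleton_eq_top, ← hy]
    exact fun h => Q.isPrime.ne_top (top_le_iff.1 (h ▸ Ideal.mul_le_left))
  obtain ⟨l', hl', hlen, hnu⟩ := exists_list_not_isUnit hO hθ (a := ⟨a, ha⟩)
    (fun h0 => ha0 (congrArg Subtype.val h0)) (List.replicate m y)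
    (fun d hd => by
      rw [List.eq_of_mem_replicate hd]
      exact ⟨hynu, exists_pow_mem_of_isCoprime hfin hyreg⟩)
    (by rw [List.prod_replicate]; exact Ideal.span_singleton_eq_span_singleton.1 hay)
  rw [List.length_replicate] at hlen
  have hdvd : ∀ v ∈ l', v ∣ ⟨a, ha⟩ := fun v hv => (List.dvd_prod hv).trans hl'.dvd
  have hv0 : ∀ v ∈ l', (v : R) ≠ 0 := by
    intro v hv h0
    have h1 := hdvd v hv
    rw [show v = 0 from Subtype.ext h0, zero_dvd_iff] at h1
    exact ha0 (congrArg Subtype.val h1)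
  have hprime : ∀ v ∈ l', ∀ P : HeightOneSpectrum R, (v : R) ∈ P.asIdeal → P = Q ∨ P = Q' := by
    intro v hv P hP
    have h1 : (a : R) ∈ P.asIdeal := by
      obtain ⟨w, hw⟩ := hdvd v hv
      have := congrArg Subtype.val hw
      change a = (v : R) * w at this
      rw [this]
      exact P.asIdeal.mul_mem_right _ hP
    rw [mem_iff_span_le, hay, ← mem_iff_span_le] at h1
    have h2 := P.isPrime.mem_of_pow_mem m h1
    rw [mem_iff_span_le, ← hy] at h2
    exact eq_or_eq_of_mul_le h2
  have hne1 : ∀ v ∈ l', ∀ P : HeightOneSpectrum R, (v : R) ∈ P.asIdeal →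
      idealClass P.asIdeal ≠ 1 := by
    intro v hv P hP
    rcases hprime v hv P hP with rfl | rfl
    · exact hc1
    · exact hc1'
  obtain ⟨v, hv, hv2⟩ : ∃ v ∈ l', numPrimes (Ideal.span {(v : R)}) ≤ 2 := by
    by_contra! hcon
    have hcount := (mul_length_le_numPrimes 3 (l'.map O.subtype) (by
      intro x hx
      obtain ⟨v, hv, rfl⟩ := List.mem_map.1 hx
      exact ⟨hv0 v hv, hcon v hv⟩)).2
    rw [← map_list_prod, Ideal.span_singleton_eq_span_singleton.2 (hl'.map O.subtype),
      List.length_map, hlen] at hcount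
    change _ ≤ numPrimes (Ideal.span {a}) at hcount
    rw [hay, ← Ideal.span_singleton_pow, numPrimes_pow, ← hy, numPrimes_mul Q.ne_bot Q'.ne_bot,
      numPrimes_self, numPrimes_self] at hcount
    lia
  have hvt := span_singleton_ne_bot (hv0 v hv)
  have hv2' : numPrimes (Ideal.span {(v : R)}) = 2 := le_antisymm hv2
    (two_le_numPrimes (hv0 v hv) (by rw [hO.isUnit_coe_iff]; exact hnu v hv) (hne1 v hv))
  obtain ⟨P, J, hJ⟩ := exists_eq_mul_of_ne_top hvt (hO.span_ne_top (hnu v hv))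
  have hJ0 : J ≠ ⊥ := by
    rintro rfl
    exact hvt (by rw [hJ, Ideal.mul_bot])
  rw [hJ, numPrimes_mul P.ne_bot hJ0, numPrimes_self] at hv2'
  have hJt : J ≠ ⊤ := fun h => by
    have := (numPrimes_eq_zero_iff hJ0).2 h
    lia
  obtain ⟨P', J', hJ'⟩ := exists_eq_mul_of_ne_top hJ0 hJt
  have hJ0' : J' ≠ ⊥ := by
    rintro rfl
    exact hJ0 (by rw [hJ', Ideal.mul_bot])
  rw [hJ', numPrimes_mul P'.ne_bot hJ0', numPrimes_self] at hv2'
  have hJt' : J' = ⊤ := (numPrimes_eq_zero_iff hJ0').1 (by lia)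
  have hvPP : Ideal.span {(v : R)} = P.asIdeal * P'.asIdeal := by
    rw [hJ, hJ', hJt', Ideal.mul_top]
  have hP := hprime v hv P (by rw [mem_iff_span_le, hvPP]; exact Ideal.mul_le_left)
  have hP' := hprime v hv P' (by rw [mem_iff_span_le, hvPP]; exact Ideal.mul_le_right)
  have hcls : idealClass P.asIdeal * idealClass P'.asIdeal = 1 := by
    rw [← idealClass_mul P.ne_bot P'.ne_bot, ← hvPP, idealClass_span (hv0 v hv)]
  rcases hP with rfl | rfl <;> rcases hP' with rfl | rfl
  · exact absurd ((pow_two _).trans hcls) hsq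
  · exact ⟨v, v.2, hvPP.symm⟩
  · exact ⟨v, v.2, by rw [mul_comm, hvPP]⟩
  · rw [hc', ← mul_inv, inv_eq_one, ← pow_two] at hcls
    exact absurd hcls hsq

/-- If `v` and `w` are irreducible in `O` and `v * w` generates a product of three proper ideals
generated by elements of `O`, then `v` is not divisible by the first of them: it would generate
it, and `w` would generate the product of the other two. -/
lemma not_dvd_of_irreducible (hO : IsOrder O) (hfin : Finite (R ⧸ orderConductor O)) {v w : O}
    (hv : Irreducible v) (hw : Irreducible w) {E₁ E₂ E₃ : Ideal R}
    (h₁ : GeneratedIn O E₁) (h₂ : GeneratedIn O E₂) (h₃ : GeneratedIn O E₃)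
    (hr₁ : IsCoprime E₁ (orderConductor O)) (hr₂ : IsCoprime E₂ (orderConductor O))
    (ht₁ : E₁ ≠ ⊤) (ht₂ : E₂ ≠ ⊤) (ht₃ : E₃ ≠ ⊤)
    (h : Ideal.span {(v : R)} * Ideal.span {(w : R)} = E₁ * (E₂ * E₃)) :
    ¬ E₁ ∣ Ideal.span {(v : R)} := by
  intro hdvd
  have hv0 := span_singleton_ne_bot (coe_ne_zero_of_ne_zero hv.ne_zero)
  have hw0 := span_singleton_ne_bot (coe_ne_zero_of_ne_zero hw.ne_zero)
  have key : ∀ (x : O) (E : Ideal R), Irreducible x → GeneratedIn O E →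
      IsCoprime E (orderConductor O) → E ≠ ⊤ → E ∣ Ideal.span {(x : R)} →
      Ideal.span {(x : R)} = E := by
    intro x E hx ⟨e, he, hE⟩ hr ht hd
    rw [hE, Ideal.dvd_span_singleton, Ideal.mem_span_singleton'] at hd
    obtain ⟨j, hj⟩ := hd
    have hjO : j ∈ O := mem_of_mul_mem hfin he (hE ▸ hr) (by rw [mul_comm, hj]; exact x.2)
    have hxe : x = ⟨e, he⟩ * ⟨j, hjO⟩ := Subtype.ext (by rw [← hj, mul_comm]; rfl)
    have hej : IsUnit (⟨j, hjO⟩ : O) := by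
      refine (hx.isUnit_or_isUnit hxe).resolve_left fun hu => ht ?_
      rw [hE, Ideal.span_singleton_eq_top]
      exact (hO.isUnit_coe_iff _).2 hu
    rw [hE, ← hj, mul_comm]
    exact Ideal.span_singleton_mul_right_unit ((hO.isUnit_coe_iff _).2 hej) e
  have hvE := key v E₁ hv h₁ hr₁ ht₁ hdvd
  have hE0 : E₁ ≠ 0 := hvE ▸ hv0
  have hwE : Ideal.span {(w : R)} = E₂ * E₃ := by
    rw [hvE] at h
    exact mul_left_cancel₀ hE0 h
  have hwE' := key w E₂ hw h₂ hr₂ ht₂ ⟨E₃, hwE⟩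
  refine ht₃ ?_
  have h0 : E₂ ≠ 0 := hwE' ▸ hw0
  rw [← Ideal.one_eq_top]
  refine mul_left_cancel₀ h0 ?_
  rw [mul_one, ← hwE, hwE']

lemma eq_mul_and_eq_mul_of_not_dvd {Q Q' : HeightOneSpectrum R} {V W Z : Ideal R}
    (h : V * W = (Q.asIdeal * Q'.asIdeal) * Z) (hV : ¬ Q.asIdeal * Q'.asIdeal ∣ V)
    (hW : ¬ Q.asIdeal * Q'.asIdeal ∣ W) :
    ∃ V' W', V' * W' = Z ∧ ((V = Q.asIdeal * V' ∧ W = Q'.asIdeal * W') ∨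
      (V = Q'.asIdeal * V' ∧ W = Q.asIdeal * W')) := by
  rw [mul_assoc] at h
  rcases eq_mul_or_eq_mul_of_mul_eq h with ⟨V', rfl, h'⟩ | ⟨W', rfl, h'⟩ <;>
    rcases eq_mul_or_eq_mul_of_mul_eq h' with ⟨V'', rfl, h''⟩ | ⟨W'', rfl, h''⟩
  · exact absurd ⟨V'', (mul_assoc _ _ _).symm⟩ hV
  · exact ⟨V', W'', h'', Or.inl ⟨rfl, rfl⟩⟩
  · exact ⟨V'', W', h'', Or.inr ⟨rfl, rfl⟩⟩
  · exact absurd ⟨W'', (mul_assoc _ _ _).symm⟩ hW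

end Regular

section RegularPrincipal

variable {R : Type u} [CommRing R] [IsDedekindDomain R] {O : Subring R}
variable {B : Type u} [CancelCommMonoid B] {θ : R⁰ →* B}

lemma mul_ne_top_of_heightOneSpectrum (Q : HeightOneSpectrum R) (I : Ideal R) :
    Q.asIdeal * I ≠ ⊤ := fun h =>
  Q.isPrime.ne_top (top_le_iff.1 (h ▸ Ideal.mul_le_left))

lemma isShort_of_span_eq {y : R} (hpow : ∃ k : ℕ, 0 < k ∧ y ^ k ∈ O)
    {P Q S : HeightOneSpectrum R} (hP : idealClass P.asIdeal ≠ 1) (hQ : idealClass Q.asIdeal ≠ 1)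
    (hS : idealClass S.asIdeal ≠ 1)
    (hy : P.asIdeal * Q.asIdeal * S.asIdeal = Ideal.span {y}) : IsShort O y where
  ne_zero := by
    rintro rfl
    refine mul_ne_zero (mul_ne_zero P.ne_bot Q.ne_bot) S.ne_bot ?_
    rw [hy]
    simp
  not_isUnit := by
    rw [← Ideal.span_singleton_eq_top, ← hy, mul_assoc]
    exact mul_ne_top_of_heightOneSpectrum _ _
  exists_pow_mem := hpow
  numPrimes_le := by
    rw [← hy, numPrimes_mul (mul_ne_zero P.ne_bot Q.ne_bot) S.ne_bot,
      numPrimes_mul P.ne_bot Q.ne_bot, numPrimes_self, numPrimes_self, numPrimes_self]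
  idealClass_ne := by
    intro T hT
    rw [mem_iff_span_le, ← hy, T.isPrime.mul_le, T.isPrime.mul_le] at hT
    rcases hT with (hT | hT) | hT
    · rwa [← heightOneSpectrum_eq_of_le hT]
    · rwa [← heightOneSpectrum_eq_of_le hT]
    · rwa [← heightOneSpectrum_eq_of_le hT]

/-- Two prime ideals coprime to the conductor, with inverse non-trivial classes, whose product is
generated by an element of `O`. Ideals of order two are paired with themselves. -/
structure IsOppositePair (O : Subring R) (Q Q' : HeightOneSpectrum R) : Prop where
  left : IsCoprime Q.asIdeal (orderConductor O)
  right : IsCoprime Q'.asIdeal (orderConductor O)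
  class_ne : idealClass Q.asIdeal ≠ 1
  class_mul : idealClass Q.asIdeal * idealClass Q'.asIdeal = 1
  eq_of_sq : idealClass Q.asIdeal ^ 2 = 1 → Q' = Q
  generatedIn : GeneratedIn O (Q.asIdeal * Q'.asIdeal)

lemma IsOppositePair.class_eq {Q Q' : HeightOneSpectrum R} (h : IsOppositePair O Q Q') :
    idealClass Q'.asIdeal = (idealClass Q.asIdeal)⁻¹ :=
  eq_inv_of_mul_eq_one_right h.class_mul

lemma IsOppositePair.class_ne' {Q Q' : HeightOneSpectrum R} (h : IsOppositePair O Q Q') :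
    idealClass Q'.asIdeal ≠ 1 := by
  rw [h.class_eq, inv_ne_one]
  exact h.class_ne

lemma IsOppositePair.symm {Q Q' : HeightOneSpectrum R} (h : IsOppositePair O Q Q') :
    IsOppositePair O Q' Q where
  left := h.right
  right := h.left
  class_ne := h.class_ne'
  class_mul := by rw [mul_comm, h.class_mul]
  eq_of_sq h2 := (h.eq_of_sq (by rwa [h.class_eq, inv_pow, inv_eq_one] at h2)).symm
  generatedIn := by rw [mul_comm]; exact h.generatedIn

lemma IsOppositePair.eq_of_class_eq {Q Q' : HeightOneSpectrum R} (h : IsOppositePair O Q Q')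
    (he : idealClass Q'.asIdeal = idealClass Q.asIdeal) : Q' = Q := by
  refine h.eq_of_sq ?_
  have := h.class_mul
  rwa [he, ← pow_two] at this

/-- The product of three pairs is a product of two elements of `R`, hence a product of two
irreducible elements of `O`. Neither of these contains both ideals of one pair, so one of them
generates the product of the first ideals of all pairs. -/
theorem generatedIn_mul_mul (hO : IsOrder O) (hfin : Finite (R ⧸ orderConductor O))
    (hθ : IsTransferHom (θ.comp (orderInclusion O))) {Q₁ Q₂ Q₃ Q₁' Q₂' Q₃' : HeightOneSpectrum R}
    (h₁ : IsOppositePair O Q₁ Q₁') (h₂ : IsOppositePair O Q₂ Q₂') (h₃ : IsOppositePair O Q₃ Q₃')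
    (hcl : idealClass Q₁.asIdeal * idealClass Q₂.asIdeal * idealClass Q₃.asIdeal = 1) :
    GeneratedIn O (Q₁.asIdeal * Q₂.asIdeal * Q₃.asIdeal) := by
  have hne : ∀ P Q S : HeightOneSpectrum R, P.asIdeal * Q.asIdeal * S.asIdeal ≠ ⊥ :=
    fun P Q S => mul_ne_zero (mul_ne_zero P.ne_bot Q.ne_bot) S.ne_bot
  have hcl3 : ∀ P Q S : HeightOneSpectrum R, idealClass (P.asIdeal * Q.asIdeal * S.asIdeal) =
      idealClass P.asIdeal * idealClass Q.asIdeal * idealClass S.asIdeal := fun P Q S => by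
    rw [idealClass_mul (mul_ne_zero P.ne_bot Q.ne_bot) S.ne_bot,
      idealClass_mul P.ne_bot Q.ne_bot]
  have hcl' : idealClass Q₁'.asIdeal * idealClass Q₂'.asIdeal * idealClass Q₃'.asIdeal = 1 := by
    rw [h₁.class_eq, h₂.class_eq, h₃.class_eq, ← mul_inv, ← mul_inv, hcl, inv_one]
  obtain ⟨y, hy⟩ := (idealClass_eq_one_iff (hne Q₁ Q₂ Q₃)).1 ((hcl3 _ _ _).trans hcl)
  obtain ⟨y', hy'⟩ := (idealClass_eq_one_iff (hne Q₁' Q₂' Q₃')).1 ((hcl3 _ _ _).trans hcl')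
  have hs : IsShort O y := isShort_of_span_eq (exists_pow_mem_of_isCoprime hfin
    (hy ▸ (h₁.left.mul_left h₂.left).mul_left h₃.left)) h₁.class_ne h₂.class_ne h₃.class_ne hy
  have hs' : IsShort O y' := isShort_of_span_eq (exists_pow_mem_of_isCoprime hfin
    (hy' ▸ (h₁.right.mul_left h₂.right).mul_left h₃.right)) h₁.class_ne' h₂.class_ne'
    h₃.class_ne' hy'
  obtain ⟨a, ha, hEa⟩ := h₁.generatedIn.mul (h₂.generatedIn.mul h₃.generatedIn)
  have hayy : Associated a (y * y') := by
    rw [← Ideal.span_singleton_eq_span_singleton, ← hEa, span_singleton_mul_eq, ← hy, ← hy']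
    ring
  obtain ⟨v, w, hvw, hv, hw⟩ := exists_eq_mul_irreducible hO hθ (a := ⟨a, ha⟩) hs hs' hayy
  have hVW : Ideal.span {(v : R)} * Ideal.span {(w : R)} =
      Q₁.asIdeal * Q₁'.asIdeal * (Q₂.asIdeal * Q₂'.asIdeal * (Q₃.asIdeal * Q₃'.asIdeal)) := by
    rw [hEa, ← span_singleton_mul_eq]
    exact congrArg (fun x : R => Ideal.span {x}) (congrArg Subtype.val hvw).symm
  have hr : ∀ {Q Q' : HeightOneSpectrum R}, IsOppositePair O Q Q' →
      IsCoprime (Q.asIdeal * Q'.asIdeal) (orderConductor O) := fun h => h.left.mul_left h.right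
  have ht : ∀ {Q Q' : HeightOneSpectrum R}, Q.asIdeal * Q'.asIdeal ≠ ⊤ :=
    mul_ne_top_of_heightOneSpectrum _ _
  have hnd : ∀ v w : O, Irreducible v → Irreducible w → Ideal.span {(v : R)} *
      Ideal.span {(w : R)} = Q₁.asIdeal * Q₁'.asIdeal *
        (Q₂.asIdeal * Q₂'.asIdeal * (Q₃.asIdeal * Q₃'.asIdeal)) →
      ¬ Q₁.asIdeal * Q₁'.asIdeal ∣ Ideal.span {(v : R)} ∧
      ¬ Q₂.asIdeal * Q₂'.asIdeal ∣ Ideal.span {(v : R)} ∧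
      ¬ Q₃.asIdeal * Q₃'.asIdeal ∣ Ideal.span {(v : R)} := by
    intro v w hv hw h
    refine ⟨not_dvd_of_irreducible hO hfin hv hw h₁.generatedIn h₂.generatedIn h₃.generatedIn
        (hr h₁) (hr h₂) ht ht ht h,
      not_dvd_of_irreducible hO hfin hv hw h₂.generatedIn h₁.generatedIn h₃.generatedIn
        (hr h₂) (hr h₁) ht ht ht (h.trans ?_),
      not_dvd_of_irreducible hO hfin hv hw h₃.generatedIn h₁.generatedIn h₂.generatedIn
        (hr h₃) (hr h₁) ht ht ht (h.trans ?_)⟩ <;> ring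
  obtain ⟨hv1, hv2, hv3⟩ := hnd v w hv hw hVW
  obtain ⟨hw1, hw2, hw3⟩ := hnd w v hw hv ((mul_comm _ _).trans hVW)
  obtain ⟨V', W', hVW', hc₁⟩ := eq_mul_and_eq_mul_of_not_dvd hVW hv1 hw1
  have hdV : V' ∣ Ideal.span {(v : R)} := by
    rcases hc₁ with ⟨h, -⟩ | ⟨h, -⟩ <;> exact h ▸ dvd_mul_left _ _
  have hdW : W' ∣ Ideal.span {(w : R)} := by
    rcases hc₁ with ⟨-, h⟩ | ⟨-, h⟩ <;> exact h ▸ dvd_mul_left _ _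
  obtain ⟨V'', W'', hVW'', hc₂⟩ := eq_mul_and_eq_mul_of_not_dvd hVW'
    (fun h => hv2 (h.trans hdV)) (fun h => hw2 (h.trans hdW))
  have hdV' : V'' ∣ Ideal.span {(v : R)} := by
    refine Dvd.dvd.trans ?_ hdV
    rcases hc₂ with ⟨h, -⟩ | ⟨h, -⟩ <;> exact h ▸ dvd_mul_left _ _
  have hdW' : W'' ∣ Ideal.span {(w : R)} := by
    refine Dvd.dvd.trans ?_ hdW
    rcases hc₂ with ⟨-, h⟩ | ⟨-, h⟩ <;> exact h ▸ dvd_mul_left _ _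
  rw [← mul_one (Q₃.asIdeal * Q₃'.asIdeal)] at hVW''
  obtain ⟨V₀, W₀, hVW₀, hc₃⟩ := eq_mul_and_eq_mul_of_not_dvd hVW''
    (fun h => hv3 (h.trans hdV')) (fun h => hw3 (h.trans hdW'))
  have hV₀ : V₀ = 1 := (Ideal.isUnit_iff.1 (IsUnit.of_mul_eq_one _ hVW₀)).trans
    Ideal.one_eq_top.symm
  have hW₀ : W₀ = 1 := by rwa [hV₀, one_mul] at hVW₀
  subst hV₀ hW₀
  have hgen : ∀ (P₁ P₂ P₃ : HeightOneSpectrum R) (x : O), Irreducible x →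
      Ideal.span {(x : R)} = P₁.asIdeal * (P₂.asIdeal * (P₃.asIdeal * 1)) →
      GeneratedIn O (P₁.asIdeal * P₂.asIdeal * P₃.asIdeal) ∧
      idealClass P₁.asIdeal * idealClass P₂.asIdeal * idealClass P₃.asIdeal = 1 := by
    intro P₁ P₂ P₃ x hx h
    rw [mul_one, ← mul_assoc] at h
    refine ⟨⟨x, x.2, h.symm⟩, ?_⟩
    rw [← hcl3, ← h, idealClass_span (coe_ne_zero_of_ne_zero hx.ne_zero)]
  -- exchanging one ideal of a principal product with its opposite keeps the product principal
  -- only if the two ideals agree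
  have hflip : (∀ x : O, Irreducible x → Ideal.span {(x : R)} =
        Q₁'.asIdeal * (Q₂.asIdeal * (Q₃.asIdeal * 1)) → Q₁' = Q₁) ∧
      (∀ x : O, Irreducible x → Ideal.span {(x : R)} =
        Q₁.asIdeal * (Q₂'.asIdeal * (Q₃.asIdeal * 1)) → Q₂' = Q₂) ∧
      (∀ x : O, Irreducible x → Ideal.span {(x : R)} =
        Q₁.asIdeal * (Q₂.asIdeal * (Q₃'.asIdeal * 1)) → Q₃' = Q₃) := by
    refine ⟨fun x hx h => h₁.eq_of_class_eq ?_, fun x hx h => h₂.eq_of_class_eq ?_,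
      fun x hx h => h₃.eq_of_class_eq ?_⟩
    · exact mul_right_cancel (mul_right_cancel ((hgen _ _ _ x hx h).2.trans hcl.symm))
    · exact mul_left_cancel (mul_right_cancel ((hgen _ _ _ x hx h).2.trans hcl.symm))
    · exact mul_left_cancel ((hgen _ _ _ x hx h).2.trans hcl.symm)
  obtain ⟨hf₁, hf₂, hf₃⟩ := hflip
  rcases hc₃ with ⟨rfl, rfl⟩ | ⟨rfl, rfl⟩ <;> rcases hc₂ with ⟨rfl, rfl⟩ | ⟨rfl, rfl⟩ <;>
    rcases hc₁ with ⟨hv', hw'⟩ | ⟨hv', hw'⟩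
  · exact (hgen _ _ _ v hv hv').1
  · exact hf₁ v hv hv' ▸ (hgen _ _ _ v hv hv').1
  · exact hf₂ v hv hv' ▸ (hgen _ _ _ v hv hv').1
  · exact hf₃ w hw hw' ▸ (hgen _ _ _ w hw hw').1
  · exact hf₃ v hv hv' ▸ (hgen _ _ _ v hv hv').1
  · exact hf₂ w hw hw' ▸ (hgen _ _ _ w hw hw').1
  · exact hf₁ w hw hw' ▸ (hgen _ _ _ w hw hw').1
  · exact (hgen _ _ _ w hw hw').1

/-- Every non-trivial ideal class contains a prime ideal coprime to the conductor of `O`. -/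
def NontrivialClassesContainPrimes (O : Subring R) : Prop :=
  ∀ c : ClassGroup R, c ≠ 1 → ∃ P : HeightOneSpectrum R,
    IsCoprime P.asIdeal (orderConductor O) ∧ idealClass P.asIdeal = c

lemma exists_isOppositePair (hR : IsMulTorsion (ClassGroup R)) (hO : IsOrder O)
    (hfin : Finite (R ⧸ orderConductor O)) (hθ : IsTransferHom (θ.comp (orderInclusion O)))
    (hP : NontrivialClassesContainPrimes O) {Q : HeightOneSpectrum R}
    (hQ : IsCoprime Q.asIdeal (orderConductor O)) (hc : idealClass Q.asIdeal ≠ 1) :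
    ∃ Q', IsOppositePair O Q Q' := by
  by_cases hsq : idealClass Q.asIdeal ^ 2 = 1
  · refine ⟨Q, hQ, hQ, hc, by rw [← pow_two, hsq], fun _ => rfl, ?_⟩
    rw [← pow_two]
    exact generatedIn_pow_of_idealClass_pow_eq_one hR hO hfin hθ hQ hsq
  · obtain ⟨Q', hQ', hc'⟩ := hP (idealClass Q.asIdeal)⁻¹ (inv_ne_one.2 hc)
    have hmul : idealClass Q.asIdeal * idealClass Q'.asIdeal = 1 := by rw [hc', mul_inv_cancel]
    exact ⟨Q', hQ, hQ', hc, hmul, fun h => absurd h hsq,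
      generatedIn_mul_of_two_lt_orderOf hR hO hfin hθ hQ hQ' hmul hsq⟩

/-- For classes `g` of order two, a third class `h` yields two products of three prime ideals,
one from `g * h * (g * h)⁻¹` and one from the inverse classes. -/
lemma generatedIn_mul_of_class_mul_eq_one (hR : IsMulTorsion (ClassGroup R)) (hO : IsOrder O)
    (hfin : Finite (R ⧸ orderConductor O)) (hθ : IsTransferHom (θ.comp (orderInclusion O)))
    (hP : NontrivialClassesContainPrimes O)
    (hthird : ∀ g : ClassGroup R, g ≠ 1 → ∃ h, h ≠ 1 ∧ h ≠ g) {Q Q' : HeightOneSpectrum R}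
    (hQ : IsCoprime Q.asIdeal (orderConductor O)) (hQ' : IsCoprime Q'.asIdeal (orderConductor O))
    (hc : idealClass Q.asIdeal ≠ 1) (hcl : idealClass Q.asIdeal * idealClass Q'.asIdeal = 1) :
    GeneratedIn O (Q.asIdeal * Q'.asIdeal) := by
  by_cases hsq : idealClass Q.asIdeal ^ 2 = 1
  swap
  · exact generatedIn_mul_of_two_lt_orderOf hR hO hfin hθ hQ hQ' hcl hsq
  have hself : ∀ P : HeightOneSpectrum R, IsCoprime P.asIdeal (orderConductor O) →
      idealClass P.asIdeal = idealClass Q.asIdeal → IsOppositePair O P P := by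
    intro P hP hPc
    refine ⟨hP, hP, hPc ▸ hc, by rw [← pow_two, hPc, hsq], fun _ => rfl, ?_⟩
    rw [← pow_two]
    exact generatedIn_pow_of_idealClass_pow_eq_one hR hO hfin hθ hP (hPc ▸ hsq)
  have hg : idealClass Q'.asIdeal = idealClass Q.asIdeal :=
    mul_left_cancel (hcl.trans ((pow_two _).symm.trans hsq).symm)
  obtain ⟨h, h1, hne⟩ := hthird _ hc
  obtain ⟨Q₁, hQ₁, hc₁⟩ := hP h h1
  obtain ⟨Q₂, hQ₂, hc₂⟩ := hP (idealClass Q.asIdeal * h)⁻¹ (by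
    rw [inv_ne_one]
    intro h0
    refine hne (mul_left_cancel (a := idealClass Q.asIdeal) ?_)
    rw [h0, ← pow_two, hsq])
  obtain ⟨Q₁', hp₁⟩ := exists_isOppositePair hR hO hfin hθ hP hQ₁ (hc₁ ▸ h1)
  obtain ⟨Q₂', hp₂⟩ := exists_isOppositePair hR hO hfin hθ hP hQ₂ (by
    rw [hc₂, inv_ne_one]
    intro h0
    refine hne (mul_left_cancel (a := idealClass Q.asIdeal) ?_)
    rw [h0, ← pow_two, hsq])
  have hT := generatedIn_mul_mul hO hfin hθ (hself Q hQ rfl) hp₁ hp₂ (by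
    rw [hc₁, hc₂, mul_inv_cancel])
  have hT' := generatedIn_mul_mul hO hfin hθ (hself Q' hQ' hg) hp₁.symm hp₂.symm (by
    rw [hp₁.class_eq, hp₂.class_eq, hc₁, hc₂, hg, inv_inv, mul_assoc, mul_comm _ h,
      inv_mul_cancel_left, ← pow_two, hsq])
  refine GeneratedIn.of_mul_left hfin (I := (Q₁.asIdeal * Q₁'.asIdeal) *
    (Q₂.asIdeal * Q₂'.asIdeal)) ?_ ?_ (hp₁.generatedIn.mul hp₂.generatedIn) ?_
  · exact (hp₁.left.mul_left hp₁.right).mul_left (hp₂.left.mul_left hp₂.right)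
  · exact mul_ne_zero (mul_ne_zero Q₁.ne_bot Q₁'.ne_bot) (mul_ne_zero Q₂.ne_bot Q₂'.ne_bot)
  · have := hT.mul hT'
    convert this using 1
    ring

/-- Induction on the number of prime factors: two prime factors with product of class `c` can be
replaced by one prime ideal of class `c`. -/
theorem generatedIn_of_idealClass_eq_one (hR : IsMulTorsion (ClassGroup R)) (hO : IsOrder O)
    (hfin : Finite (R ⧸ orderConductor O)) (hθ : IsTransferHom (θ.comp (orderInclusion O)))
    (hP : NontrivialClassesContainPrimes O)
    (hthird : ∀ g : ClassGroup R, g ≠ 1 → ∃ h, h ≠ 1 ∧ h ≠ g) {I : Ideal R} (hI0 : I ≠ ⊥)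
    (hI : IsCoprime I (orderConductor O)) (hc : idealClass I = 1) : GeneratedIn O I := by
  induction hn : numPrimes I using Nat.strong_induction_on generalizing I with
  | _ n ih =>
  subst hn
  by_cases htop : I = ⊤
  · exact htop ▸ generatedIn_top
  obtain ⟨P, J, rfl⟩ := exists_eq_mul_of_ne_top hI0 htop
  have hJ0 : J ≠ ⊥ := right_ne_zero_of_mul hI0
  have hPr : IsCoprime P.asIdeal (orderConductor O) := hI.of_mul_left_left
  have hJr : IsCoprime J (orderConductor O) := hI.of_mul_left_right
  have hnum := numPrimes_mul P.ne_bot hJ0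
  rw [numPrimes_self] at hnum
  rw [idealClass_mul P.ne_bot hJ0] at hc
  have hprin : ∀ P : HeightOneSpectrum R, IsCoprime P.asIdeal (orderConductor O) →
      idealClass P.asIdeal = 1 → GeneratedIn O P.asIdeal := by
    intro P hPr hP1
    have := generatedIn_pow_of_idealClass_pow_eq_one hR hO hfin hθ hPr (m := 1)
      (by rw [pow_one, hP1])
    rwa [pow_one] at this
  by_cases hP1 : idealClass P.asIdeal = 1
  · rw [hP1, one_mul] at hc
    exact (hprin P hPr hP1).mul (ih _ (by lia) hJ0 hJr hc rfl)
  have hJt : J ≠ ⊤ := by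
    rintro rfl
    rw [idealClass_top, mul_one] at hc
    exact hP1 hc
  obtain ⟨S, K, rfl⟩ := exists_eq_mul_of_ne_top hJ0 hJt
  have hK0 : K ≠ ⊥ := right_ne_zero_of_mul hJ0
  have hSr : IsCoprime S.asIdeal (orderConductor O) := hJr.of_mul_left_left
  have hKr : IsCoprime K (orderConductor O) := hJr.of_mul_left_right
  rw [numPrimes_mul S.ne_bot hK0, numPrimes_self] at hnum
  rw [idealClass_mul S.ne_bot hK0] at hc
  by_cases hS1 : idealClass S.asIdeal = 1
  · rw [mul_left_comm]
    refine (hprin S hSr hS1).mul (ih _ ?_ (mul_ne_zero P.ne_bot hK0) (hPr.mul_left hKr) ?_ rfl)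
    · rw [numPrimes_mul P.ne_bot hK0, numPrimes_self]; lia
    · rw [idealClass_mul P.ne_bot hK0]
      rwa [hS1, one_mul] at hc
  by_cases hPS : idealClass P.asIdeal * idealClass S.asIdeal = 1
  · rw [← mul_assoc]
    refine (generatedIn_mul_of_class_mul_eq_one hR hO hfin hθ hP hthird hPr hSr hP1 hPS).mul
      (ih _ (by lia) hK0 hKr ?_ rfl)
    rwa [← mul_assoc, hPS, one_mul] at hc
  obtain ⟨Q, hQ, hQc⟩ := hP (idealClass P.asIdeal * idealClass S.asIdeal)⁻¹ (inv_ne_one.2 hPS)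
  obtain ⟨Q', hQ', hQc'⟩ := hP (idealClass P.asIdeal * idealClass S.asIdeal) hPS
  have hQ1 : idealClass Q.asIdeal ≠ 1 := by rw [hQc, inv_ne_one]; exact hPS
  have hQQ := generatedIn_mul_of_class_mul_eq_one hR hO hfin hθ hP hthird hQ hQ' hQ1
    (by rw [hQc, hQc', inv_mul_cancel])
  obtain ⟨P', hp⟩ := exists_isOppositePair hR hO hfin hθ hP hPr hP1
  obtain ⟨S', hs⟩ := exists_isOppositePair hR hO hfin hθ hP hSr hS1
  obtain ⟨Q'', hq⟩ := exists_isOppositePair hR hO hfin hθ hP hQ hQ1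
  have hT := generatedIn_mul_mul hO hfin hθ hp hs hq (by rw [hQc, mul_inv_cancel])
  have hK := ih (numPrimes (Q'.asIdeal * K))
    (by rw [numPrimes_mul Q'.ne_bot hK0, numPrimes_self]; lia)
    (mul_ne_zero Q'.ne_bot hK0) (hQ'.mul_left hKr)
    (by rw [idealClass_mul Q'.ne_bot hK0, hQc', mul_assoc, hc]) rfl
  refine GeneratedIn.of_mul_left hfin (hQ.mul_left hQ') (mul_ne_zero Q.ne_bot Q'.ne_bot) hQQ ?_
  have := hT.mul hK
  convert this using 1
  ring

end RegularPrincipal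

/-! ### Powers that lie in the order -/

lemma WfDvdMonoid.of_measure {M : Type*} [CommMonoidWithZero M] (μ : M → ℕ)
    (h : ∀ a b : M, b ≠ 0 → DvdNotUnit a b → μ a < μ b) : WfDvdMonoid M := by
  classical
  refine ⟨?_⟩
  let ν : M → WithTop ℕ := fun a => if a = 0 then ⊤ else (μ a : WithTop ℕ)
  refine Subrelation.wf (r := InvImage (· < ·) ν) (fun {a b} hab => ?_)
    (InvImage.wf ν wellFounded_lt)
  change ν a < ν b
  have ha : ν a = (μ a : WithTop ℕ) := if_neg hab.1
  by_cases hb : b = 0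
  · rw [ha, show ν b = ⊤ from if_pos hb]
    exact WithTop.coe_lt_top _
  · rw [ha, show ν b = (μ b : WithTop ℕ) from if_neg hb]
    exact WithTop.coe_lt_coe.2 (h a b hb hab)

lemma exists_isIdempotentElem_pow {M : Type*} [Monoid M] [Finite M] (x : M) :
    ∃ k : ℕ, 0 < k ∧ IsIdempotentElem (x ^ k) := by
  obtain ⟨m, n, hmn, h⟩ : ∃ m n : ℕ, m < n ∧ x ^ m = x ^ n := by
    obtain ⟨m, n, hne, h⟩ := Finite.exists_ne_map_eq_of_infinite fun n : ℕ => x ^ n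
    rcases lt_or_gt_of_ne hne with h' | h'
    · exact ⟨m, n, h', h⟩
    · exact ⟨n, m, h', h.symm⟩
  obtain ⟨d, rfl⟩ := Nat.exists_eq_add_of_lt hmn
  have hper : ∀ j, x ^ (m + (d + 1) * j) = x ^ m := by
    intro j
    induction j with
    | zero => simp
    | succ j ih =>
      have h1 : m + (d + 1) * (j + 1) = (m + (d + 1) * j) + (d + 1) := by ring
      rw [h1, pow_add, ih, ← pow_add, ← add_assoc, ← h]
  refine ⟨(d + 1) * (m + 1), by positivity, ?_⟩
  have h2 : (d + 1) * (m + 1) = m + (d * (m + 1) + 1) := by ring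
  change x ^ _ * x ^ _ = x ^ _
  conv_lhs => arg 1; rw [h2]
  rw [← pow_add, add_right_comm, pow_add, hper, ← pow_add, ← h2]

section Powers

variable {R : Type u} [CommRing R] [IsDedekindDomain R] {O : Subring R}

lemma finite_setOf_le {I : Ideal R} (hI : I ≠ ⊥) :
    {P : HeightOneSpectrum R | I ≤ P.asIdeal}.Finite := by
  simpa only [Ideal.dvd_iff_le] using Ideal.finite_factors hI

/-- Two elements that lie in the same prime ideals containing `J` have powers congruent
modulo `J`: their idempotent powers in the finite ring `R ⧸ J` agree. -/
lemma exists_pow_sub_pow_mem {J : Ideal R} (hJ : J ≠ ⊥) (hfin : Finite (R ⧸ J)) {z y : R}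
    (h : ∀ P : HeightOneSpectrum R, J ≤ P.asIdeal → (z ∈ P.asIdeal ↔ y ∈ P.asIdeal)) :
    ∃ k : ℕ, 0 < k ∧ z ^ k - y ^ k ∈ J := by
  obtain ⟨k, hk, hid⟩ := exists_isIdempotentElem_pow
    ((Ideal.Quotient.mk J z, Ideal.Quotient.mk J y) : (R ⧸ J) × (R ⧸ J))
  have hz : IsIdempotentElem (Ideal.Quotient.mk J z ^ k) := congrArg Prod.fst hid
  have hy : IsIdempotentElem (Ideal.Quotient.mk J y ^ k) := congrArg Prod.snd hid
  refine ⟨k, hk, ?_⟩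
  rw [← Ideal.Quotient.eq, map_pow, map_pow]
  have key : ∀ z y : R, (∀ P : HeightOneSpectrum R, J ≤ P.asIdeal →
      (z ∈ P.asIdeal ↔ y ∈ P.asIdeal)) → IsIdempotentElem (Ideal.Quotient.mk J z ^ k) →
      IsIdempotentElem (Ideal.Quotient.mk J y ^ k) →
      Ideal.Quotient.mk J z ^ k * (1 - Ideal.Quotient.mk J y ^ k) = 0 := by
    intro z y h hz hy
    have hi : IsIdempotentElem (Ideal.Quotient.mk J z ^ k * (1 - Ideal.Quotient.mk J y ^ k)) :=
      hz.mul hy.one_sub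
    have hnil : IsNilpotent (Ideal.Quotient.mk J z ^ k * (1 - Ideal.Quotient.mk J y ^ k)) := by
      rw [nilpotent_iff_mem_prime]
      intro N hN
      have hNle : J ≤ N.comap (Ideal.Quotient.mk J) := by
        intro x hx
        rw [Ideal.mem_comap, Ideal.Quotient.eq_zero_iff_mem.2 hx]
        exact zero_mem _
      have hNp : (N.comap (Ideal.Quotient.mk J)).IsPrime := Ideal.comap_isPrime _ _
      have hNb : N.comap (Ideal.Quotient.mk J) ≠ ⊥ := fun h0 => hJ (le_bot_iff.1 (h0 ▸ hNle))
      have hzy := h ⟨_, hNp, hNb⟩ hNle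
      change Ideal.Quotient.mk J z ∈ N ↔ Ideal.Quotient.mk J y ∈ N at hzy
      by_cases hzN : Ideal.Quotient.mk J z ∈ N
      · exact N.mul_mem_right _ (N.pow_mem_of_mem hzN k hk)
      · refine N.mul_mem_left _ ((hN.mem_or_mem (x := Ideal.Quotient.mk J y ^ k) ?_).resolve_left
          fun h' => hzN (hzy.2 (hN.mem_of_pow_mem k h')))
        rw [mul_sub, mul_one, hy.eq, sub_self]
        exact zero_mem _
    obtain ⟨n, hn⟩ := hnil
    rw [← hi.pow_succ_eq n, pow_succ, hn, zero_mul]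
  have h1 := key z y h hz hy
  have h2 := key y z (fun P hP => (h P hP).symm) hy hz
  rw [mul_sub, mul_one, sub_eq_zero] at h1 h2
  exact h1.trans ((mul_comm _ _).trans h2.symm)

/-- An element of `R` has a power in `O` if the prime ideals above the same prime ideal of `O`
cannot be separated by it. -/
theorem exists_pow_mem_of_forall_mem_iff (hO : IsOrder O)
    (hfin : Finite (R ⧸ orderConductor O)) {z : R}
    (h : ∀ P Q : HeightOneSpectrum R, P.asIdeal.comap O.subtype = Q.asIdeal.comap O.subtype →
      z ∈ P.asIdeal → z ∈ Q.asIdeal) : ∃ k : ℕ, 0 < k ∧ z ^ k ∈ O := by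
  classical
  let T := (finite_setOf_le hO.orderConductor_ne_bot).toFinset.image
    fun P => P.asIdeal.comap O.subtype
  have hmax : ∀ p : T, p.1.IsMaximal := by
    intro p
    obtain ⟨P, -, hP⟩ := Finset.mem_image.1 p.2
    exact hP ▸ hO.isMaximal_comap P
  obtain ⟨y, hy⟩ := Ideal.exists_forall_sub_mem_ideal (I := fun p : T => p.1)
    (fun p q hpq => by
      have := hmax p
      have := hmax q
      exact Ideal.isCoprime_of_isMaximal fun h' => hpq (Subtype.ext h'))
    (fun p : T => if ∃ P : HeightOneSpectrum R, P.asIdeal.comap O.subtype = p.1 ∧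
      z ∈ P.asIdeal then 0 else 1)
  obtain ⟨k, hk, hky⟩ := exists_pow_sub_pow_mem hO.orderConductor_ne_bot hfin (z := z) (y := y)
    (fun P hP => by
      have hpT : P.asIdeal.comap O.subtype ∈ T :=
        Finset.mem_image.2 ⟨P, (Set.Finite.mem_toFinset _).2 hP, rfl⟩
      have hyP := hy ⟨_, hpT⟩
      by_cases hz : z ∈ P.asIdeal
      · rw [if_pos ⟨P, rfl, hz⟩, sub_zero] at hyP
        exact ⟨fun _ => hyP, fun _ => hz⟩
      · rw [if_neg (by rintro ⟨Q, hQ, hzQ⟩; exact hz (h Q P hQ hzQ))] at hyP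
        refine ⟨fun h' => absurd h' hz, fun h' => ?_⟩
        have h1 : (1 : O) ∈ P.asIdeal.comap O.subtype := by
          have := sub_mem (show y ∈ P.asIdeal.comap O.subtype from h') hyP
          simpa using this
        exact absurd ((Ideal.eq_top_iff_one _).2 h1) (hO.isMaximal_comap P).ne_top)
  exact ⟨k, hk, mem_of_sub_mem_orderConductor (O.pow_mem y.2 k) hky⟩

lemma IsOrder.wfDvdMonoid (hO : IsOrder O) : WfDvdMonoid O := by
  refine WfDvdMonoid.of_measure (fun x => numPrimes (Ideal.span {(x : R)})) ?_
  rintro a b hb ⟨ha, x, hx, rfl⟩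
  have hx0 := right_ne_zero_of_mul hb
  have hxb := span_singleton_ne_bot (coe_ne_zero_of_ne_zero hx0)
  rw [Subring.coe_mul, span_singleton_mul_eq,
    numPrimes_mul (span_singleton_ne_bot (coe_ne_zero_of_ne_zero ha)) hxb]
  have := (numPrimes_eq_zero_iff hxb).not.2 (hO.span_ne_top hx)
  lia

end Powers

/-! ### At most one prime ideal lies above a prime ideal of the order -/

section SingleFibers

variable {R : Type u} [CommRing R] [IsDedekindDomain R] {O : Subring R}

/-- If two prime ideals lie above one prime ideal of `O`, then the exponent at one of them is
unbounded on the irreducible elements of `O`. -/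
lemma exists_irreducible_mem_pow (hO : IsOrder O) {P Q : HeightOneSpectrum R} (hne : P ≠ Q)
    (hPQ : P.asIdeal.comap O.subtype = Q.asIdeal.comap O.subtype) (M : ℕ) :
    ∃ a : O, Irreducible a ∧ (a : R) ∈ Q.asIdeal ^ M := by
  by_contra! hcon
  have := hO.wfDvdMonoid
  have hf := hO.orderConductor_ne_bot
  have hbound : ∀ x : O, x ≠ 0 →
      ordAt Q (Ideal.span {(x : R)}) ≤ M * ordAt P (Ideal.span {(x : R)}) := by
    intro x
    induction x using WfDvdMonoid.induction_on_irreducible with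
    | zero => exact fun h => absurd rfl h
    | unit u hu =>
      intro _
      rw [Ideal.span_singleton_eq_top.2 ((hO.isUnit_coe_iff u).2 hu), ordAt_top, ordAt_top]
      exact Nat.zero_le _
    | mul a i ha hi ih =>
      intro _
      have hi' := coe_ne_zero_of_ne_zero hi.ne_zero
      have ha' := coe_ne_zero_of_ne_zero ha
      rw [Subring.coe_mul, ordAt_span_mul _ hi' ha', ordAt_span_mul _ hi' ha', mul_add]
      refine Nat.add_le_add ?_ (ih ha)
      have hM := hcon i hi
      rw [mem_pow_iff_le_ordAt Q hi', not_le] at hM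
      by_cases hiP : (i : R) ∈ P.asIdeal
      · have := (mem_iff_ordAt_pos P hi').1 hiP
        exact hM.le.trans (Nat.le_mul_of_pos_right M this)
      · have hiQ : (i : R) ∉ Q.asIdeal := by
          have : i ∉ P.asIdeal.comap O.subtype := hiP
          rwa [hPQ] at this
        rw [mem_iff_ordAt_pos Q hi', not_lt, Nat.le_zero] at hiQ
        rw [hiQ]
        exact Nat.zero_le _
  set e := ordAt P (orderConductor O) with he
  set N := M * e + 1
  have hI : orderConductor O * Q.asIdeal ^ N ≠ ⊥ := mul_ne_zero hf (pow_ne_zero _ Q.ne_bot)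
  have hle : ¬ orderConductor O * Q.asIdeal ^ N ≤ P.asIdeal ^ (e + 1) := by
    rw [← le_ordAt_iff P hI, ordAt_mul P hf (pow_ne_zero _ Q.ne_bot), ordAt_pow, ordAt_of_ne hne]
    lia
  obtain ⟨φ, hφ, hφP⟩ := SetLike.not_le_iff_exists.1 hle
  have hφ0 : φ ≠ 0 := by
    rintro rfl
    exact hφP (zero_mem _)
  have h1 := hbound ⟨φ, mem_of_mem_orderConductor (Ideal.mul_le_left hφ)⟩
    fun h => hφ0 (congrArg Subtype.val h)
  have h2 := (mem_pow_iff_le_ordAt Q hφ0 N).1 (Ideal.mul_le_right hφ)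
  rw [mem_pow_iff_le_ordAt P hφ0, not_le, Nat.lt_succ_iff] at hφP
  have h3 := Nat.mul_le_mul_left M hφP
  change ordAt Q (Ideal.span {φ}) ≤ M * ordAt P (Ideal.span {φ}) at h1
  lia

variable {B : Type u} [CancelCommMonoid B] {θ : R⁰ →* B}

/-- An irreducible element of `O` divisible by `π ^ 2` in `R` shows that `π` is mapped to a
unit. -/
lemma isUnit_map_of_ne (hO : IsOrder O) (hθ : IsTransferHom (θ.comp (orderInclusion O)))
    {P Q : HeightOneSpectrum R} (hne : P ≠ Q)
    (hPQ : P.asIdeal.comap O.subtype = Q.asIdeal.comap O.subtype) {π : R} (hπ0 : π ≠ 0) {n : ℕ}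
    (hπ : Q.asIdeal ^ n = Ideal.span {π}) : IsUnit (θ (toNonZero π hπ0)) := by
  obtain ⟨a, ha, haQ⟩ := exists_irreducible_mem_pow hO hne hPQ (n * 2)
  rw [pow_mul, hπ, Ideal.span_singleton_pow, Ideal.mem_span_singleton] at haQ
  obtain ⟨d, hd⟩ := haQ
  have ha0 := coe_ne_zero_of_ne_zero ha.ne_zero
  have hd0 : d ≠ 0 := by
    rintro rfl
    exact ha0 (by rw [hd, mul_zero])
  have hfac : θ (orderInclusion O ⟨a, mem_nonZeroDivisors_of_ne_zero ha.ne_zero⟩) =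
      θ (toNonZero π hπ0) * (θ (toNonZero π hπ0) * θ (toNonZero d hd0)) := by
    rw [← map_mul, ← map_mul]
    refine congrArg θ (Subtype.ext ?_)
    change (a : R) = π * (π * d)
    rw [hd]
    ring
  obtain ⟨v, w, hvw, hv, hw⟩ := hθ.transfer _ _ _ hfac
  rcases ha.isUnit_or_isUnit (congrArg Subtype.val hvw) with h | h
  · exact hv.isUnit ((hθ.isUnit_iff v).2 ((isUnit_nonZeroDivisors_iff v).2 h))
  · exact isUnit_of_mul_isUnit_left
      (hw.isUnit ((hθ.isUnit_iff w).2 ((isUnit_nonZeroDivisors_iff w).2 h)))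

/-- Otherwise all generators of powers of the prime ideals above `P ∩ O` would be mapped to
units, but some power of their product is a non-unit of `O`. -/
theorem eq_of_comap_eq (hR : IsMulTorsion (ClassGroup R)) (hO : IsOrder O)
    (hfin : Finite (R ⧸ orderConductor O)) (hθ : IsTransferHom (θ.comp (orderInclusion O)))
    {P Q : HeightOneSpectrum R}
    (hPQ : P.asIdeal.comap O.subtype = Q.asIdeal.comap O.subtype) : P = Q := by
  classical
  by_contra hne
  have hex : ∀ S : HeightOneSpectrum R, ∃ (π : R) (n : ℕ), 0 < n ∧ π ≠ 0 ∧
      S.asIdeal ^ n = Ideal.span {π} := by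
    intro S
    have hS := pow_ne_zero (orderOf (idealClass S.asIdeal)) S.ne_bot
    obtain ⟨π, hπ⟩ := (idealClass_eq_one_iff hS).1
      (by rw [idealClass_pow S.ne_bot, pow_orderOf_eq_one])
    refine ⟨π, _, (hR _).orderOf_pos, ?_, hπ⟩
    rintro rfl
    exact hS (by rw [hπ]; simp)
  choose π n hn hπ0 hπ using hex
  have hmem : ∀ S T : HeightOneSpectrum R, π S ∈ T.asIdeal ↔ S = T := by
    intro S T
    rw [mem_iff_span_le, ← hπ, T.isPrime.pow_le_iff (hn S).ne']
    exact ⟨heightOneSpectrum_eq_of_le, fun h => h ▸ le_rfl⟩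
  have hfinS : {S : HeightOneSpectrum R |
      S.asIdeal.comap O.subtype = P.asIdeal.comap O.subtype}.Finite := by
    obtain ⟨f, hf, hf0⟩ := Submodule.exists_mem_ne_zero_of_ne_bot
      (mul_ne_zero hO.orderConductor_ne_bot P.ne_bot)
    refine (finite_setOf_le (span_singleton_ne_bot hf0)).subset fun S hS => ?_
    have h1 : (⟨f, mem_of_mem_orderConductor (Ideal.mul_le_left hf)⟩ : O) ∈
        P.asIdeal.comap O.subtype := (Ideal.mul_le_right : orderConductor O * P.asIdeal ≤ _) hf
    rw [← show S.asIdeal.comap O.subtype = _ from hS] at h1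
    exact mem_iff_span_le.1 h1
  let z : R⁰ := ∏ S ∈ hfinS.toFinset, toNonZero (π S) (hπ0 S)
  have hz : (z : R) = ∏ S ∈ hfinS.toFinset, π S := by
    change R⁰.subtype z = _
    rw [map_prod]
    rfl
  have hzmem : ∀ T : HeightOneSpectrum R, (z : R) ∈ T.asIdeal ↔
      T.asIdeal.comap O.subtype = P.asIdeal.comap O.subtype := by
    intro T
    rw [hz, T.isPrime.prod_mem_iff]
    constructor
    · rintro ⟨S, hS, hST⟩
      rw [← (hmem S T).1 hST]
      exact hfinS.mem_toFinset.1 hS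
    · intro hT
      exact ⟨T, hfinS.mem_toFinset.2 hT, (hmem T T).2 rfl⟩
  obtain ⟨k, hk, hkO⟩ := exists_pow_mem_of_forall_mem_iff hO hfin (z := (z : R))
    fun S T hST hS => (hzmem T).2 (hST ▸ (hzmem S).1 hS)
  refine not_isUnit_map_of_pow_mem hO hθ (nonZeroDivisors.coe_ne_zero z) ?_ hkO hk ?_
  · intro hu
    exact P.isPrime.ne_top (Ideal.eq_top_of_isUnit_mem _ ((hzmem P).2 rfl) hu)
  · change IsUnit (θ z)
    rw [map_prod, IsUnit.prod_iff]
    intro S hS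
    have hS' := hfinS.mem_toFinset.1 hS
    by_cases hSP : P = S
    · exact isUnit_map_of_ne hO hθ (fun h => hne (hSP.trans h.symm)) (hPQ.symm.trans hS'.symm)
        (hπ0 S) (hπ S)
    · exact isUnit_map_of_ne hO hθ hSP hS'.symm (hπ0 S) (hπ S)

end SingleFibers

/-! ### Adjusting an element by a global unit -/

section GlobalUnit

variable {R : Type u} [CommRing R] [IsDedekindDomain R] {O : Subring R}

lemma exists_eq_pow_ordAt_mul (P : HeightOneSpectrum R) {J : Ideal R} (hJ : J ≠ ⊥) :
    ∃ J' : Ideal R, J = P.asIdeal ^ ordAt P J * J' ∧ ¬ J' ≤ P.asIdeal := by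
  obtain ⟨J', hJ'⟩ := Ideal.dvd_iff_le.2 ((le_ordAt_iff P hJ _).1 le_rfl)
  refine ⟨J', hJ', fun hle => ?_⟩
  have h0 : J' ≠ ⊥ := by
    rintro rfl
    exact hJ (by rw [hJ', Ideal.mul_bot])
  have h1 := congrArg (ordAt P) hJ'
  rw [ordAt_mul P (pow_ne_zero _ P.ne_bot) h0, ordAt_pow, ordAt_self] at h1
  have := (ordAt_pos_iff P h0).2 hle
  lia

/-- Let `T` be a finite set of prime ideals containing all those above the conductor, and for each
of them let `y P` be an element of `O` with the same exponent at `P` as `b`. Then a single unit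
`η` of `R` makes `b * η` associated to `y P` in all localizations of `O` at `P ∩ O`. -/
theorem exists_unit_forall_mul_eq (hO : IsOrder O)
    (hSF : ∀ P Q : HeightOneSpectrum R,
      P.asIdeal.comap O.subtype = Q.asIdeal.comap O.subtype → P = Q)
    (hgen : ∀ r : R, IsCoprime (Ideal.span {r}) (orderConductor O) →
      GeneratedIn O (Ideal.span {r}))
    (T : Finset (HeightOneSpectrum R))
    (hT : ∀ P : HeightOneSpectrum R, orderConductor O ≤ P.asIdeal → P ∈ T)
    {b : R} (hb : b ≠ 0) (y : HeightOneSpectrum R → R)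
    (hy0 : ∀ P ∈ T, y P ≠ 0)
    (hy : ∀ P ∈ T, ordAt P (Ideal.span {y P}) = ordAt P (Ideal.span {b})) :
    ∃ η : Rˣ, ∀ P ∈ T, ∃ s ∈ O, ∃ w ∈ O, s ∉ P.asIdeal ∧ w ∉ P.asIdeal ∧
      s * (b * η) = w * y P := by
  have hf := hO.orderConductor_ne_bot
  have hloc : ∀ P : T, ∃ r : R, y P * r - b ∈
      P.1.asIdeal ^ (ordAt P.1 (Ideal.span {b}) + (ordAt P.1 (orderConductor O) + 1)) :=
    fun P => exists_mul_sub_mem_pow P.1 (hy0 P P.2) hb (hy P P.2) _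
  choose r₀ hr₀ using hloc
  obtain ⟨r, hr⟩ := IsDedekindDomain.exists_forall_sub_mem_ideal (s := T)
    (fun P : HeightOneSpectrum R => P.asIdeal)
    (fun P => ordAt P (Ideal.span {b}) + (ordAt P (orderConductor O) + 1))
    (fun P _ => P.prime) (fun P _ Q _ hPQ h => hPQ (HeightOneSpectrum.ext h)) r₀
  have hyr : ∀ P ∈ T, b - y P * r ∈
      P.asIdeal ^ (ordAt P (Ideal.span {b}) + (ordAt P (orderConductor O) + 1)) := by
    intro P hP
    have h1 := add_mem (Ideal.mul_mem_left _ (y P) (hr P hP)) (hr₀ ⟨P, hP⟩)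
    rw [← neg_mem_iff]
    convert h1 using 1
    ring
  have hrP : ∀ P ∈ T, r ∉ P.asIdeal := by
    intro P hP hrP
    have h1 : b ∈ P.asIdeal ^ (ordAt P (Ideal.span {b}) + 1) := by
      have h2 : y P * r ∈ P.asIdeal ^ (ordAt P (Ideal.span {b}) + 1) := by
        rw [pow_succ]
        exact Ideal.mul_mem_mul ((mem_pow_iff_le_ordAt P (hy0 P hP) _).2 (hy P hP).ge) hrP
      have h3 := Ideal.pow_le_pow_right (I := P.asIdeal) (show ordAt P (Ideal.span {b}) + 1 ≤
        ordAt P (Ideal.span {b}) + (ordAt P (orderConductor O) + 1) by lia) (hyr P hP)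
      simpa using add_mem h3 h2
    rw [mem_pow_iff_le_ordAt P hb] at h1
    lia
  obtain ⟨o, ho, hro⟩ := hgen r ((isCoprime_span_orderConductor_iff hO).2
    fun P hP => hrP P (hT P hP))
  obtain ⟨η, hη⟩ := Ideal.span_singleton_eq_span_singleton.1 hro
  refine ⟨η, fun P hP => ?_⟩
  have hyP := span_singleton_ne_bot (hy0 P hP)
  have hJ : Ideal.span {y P} * (orderConductor O * P.asIdeal) ≠ ⊥ :=
    mul_ne_zero hyP (mul_ne_zero hf P.ne_bot)
  have hJord : ordAt P (Ideal.span {y P} * (orderConductor O * P.asIdeal)) =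
      ordAt P (Ideal.span {b}) + (ordAt P (orderConductor O) + 1) := by
    rw [ordAt_mul P hyP (mul_ne_zero hf P.ne_bot), ordAt_mul P hf P.ne_bot, ordAt_self, hy P hP]
  obtain ⟨J', hJ', hJP⟩ := exists_eq_pow_ordAt_mul P hJ
  obtain ⟨s, hsO, hsJ, hsP⟩ := hO.exists_mem_notMem (fun Q hQ => hSF Q P hQ) hJP
  have hsc : (b - y P * r) * s ∈ Ideal.span {y P} * (orderConductor O * P.asIdeal) := by
    rw [hJ', hJord]
    exact Ideal.mul_mem_mul (hyr P hP) hsJ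
  obtain ⟨φ, hφ, hφe⟩ := Ideal.mem_span_singleton_mul.1 hsc
  refine ⟨s, hsO, φ * η + s * o, O.add_mem
    (mem_of_mem_orderConductor (Ideal.mul_mem_right _ _ (Ideal.mul_le_left hφ)))
    (O.mul_mem hsO ho), hsP, fun hmem => ?_, ?_⟩
  · have h1 : s * o ∈ P.asIdeal := by
      have := sub_mem hmem (P.asIdeal.mul_mem_right (η : R) (Ideal.mul_le_right hφ))
      rwa [add_sub_cancel_left] at this
    refine (P.isPrime.mem_or_mem h1).elim hsP fun h2 => hrP P hP ?_
    rw [← hη] at h2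
    exact (P.isPrime.mem_or_mem h2).resolve_right fun h3 =>
      P.isPrime.ne_top (Ideal.eq_top_of_isUnit_mem _ h3 η.isUnit)
  · rw [← hη]
    linear_combination (-(η : R)) * hφe

end GlobalUnit

/-! ### Localizations of the order -/

section Local

variable {R : Type u} [CommRing R] [IsDedekindDomain R] {O : Subring R}

lemma isUnit_algebraMap_atPrime_iff (p : Ideal O) [p.IsPrime] (a : O) :
    IsUnit (algebraMap O (Localization.AtPrime p) a) ↔ a ∉ p :=
  IsLocalization.AtPrime.isUnit_to_map_iff _ p a

lemma algebraMap_atPrime_injective (p : Ideal O) [p.IsPrime] :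
    Function.Injective (algebraMap O (Localization.AtPrime p)) :=
  IsLocalization.injective _ p.primeCompl_le_nonZeroDivisors

lemma exists_associated_algebraMap (p : Ideal O) [p.IsPrime] (x : Localization.AtPrime p) :
    ∃ y : O, Associated (algebraMap O (Localization.AtPrime p) y) x := by
  obtain ⟨y, s, rfl⟩ := IsLocalization.exists_mk'_eq p.primeCompl x
  refine ⟨y, ?_⟩
  rw [← IsLocalization.mk'_spec (Localization.AtPrime p) y s]
  exact associated_mul_unit_left _ _ ((isUnit_algebraMap_atPrime_iff p s).2 s.2)

/-- Elements of `O` are associated in the localization if they agree up to factors outside of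
the prime ideal. -/
lemma associated_algebraMap_iff (p : Ideal O) [p.IsPrime] {a b : O} :
    Associated (algebraMap O (Localization.AtPrime p) a) (algebraMap O _ b) ↔
      ∃ s t : O, s ∉ p ∧ t ∉ p ∧ s * a = t * b := by
  constructor
  · rintro ⟨e, he⟩
    obtain ⟨t, s, hts⟩ := IsLocalization.exists_mk'_eq p.primeCompl (e : Localization.AtPrime p)
    have h1 : (e : Localization.AtPrime p) * algebraMap O _ s = algebraMap O _ t := by
      rw [← hts, IsLocalization.mk'_spec]
    have ht : t ∉ p := by
      rw [← isUnit_algebraMap_atPrime_iff, ← h1]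
      exact e.isUnit.mul ((isUnit_algebraMap_atPrime_iff p s).2 s.2)
    refine ⟨t, s, ht, s.2, algebraMap_atPrime_injective p ?_⟩
    rw [map_mul, map_mul, ← h1, ← he]
    ring
  · rintro ⟨s, t, hs, ht, h⟩
    have h1 := congrArg (algebraMap O (Localization.AtPrime p)) h
    rw [map_mul, map_mul] at h1
    have hs' := (isUnit_algebraMap_atPrime_iff p s).2 hs
    have ht' := (isUnit_algebraMap_atPrime_iff p t).2 ht
    exact (associated_unit_mul_right _ _ hs').trans
      ((Associated.of_eq h1).trans (associated_unit_mul_left _ _ ht'))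

/-- The element `a` of `O` is irreducible in the localization of `O` at the prime ideal below
`P`. -/
def IsLocallyIrreducible (O : Subring R) (P : HeightOneSpectrum R) (a : O) : Prop :=
  haveI := P.isPrime
  Irreducible (algebraMap O (Localization.AtPrime (P.asIdeal.comap O.subtype)) a)

lemma IsLocallyIrreducible.of_mul_eq {P : HeightOneSpectrum R} {a b s t : O}
    (ha : IsLocallyIrreducible O P a) (hs : (s : R) ∉ P.asIdeal) (ht : (t : R) ∉ P.asIdeal)
    (h : s * a = t * b) : IsLocallyIrreducible O P b := by
  have := P.isPrime
  exact ((associated_algebraMap_iff (P.asIdeal.comap O.subtype)).2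
    ⟨s, t, hs, ht, h⟩).irreducible ha

lemma IsLocallyIrreducible.notMem_or_notMem {P : HeightOneSpectrum R} {a v w : O}
    (ha : IsLocallyIrreducible O P a) (h : a = v * w) :
    (v : R) ∉ P.asIdeal ∨ (w : R) ∉ P.asIdeal := by
  have := P.isPrime
  rw [h, IsLocallyIrreducible, map_mul] at ha
  have := ha.isUnit_or_isUnit rfl
  rwa [isUnit_algebraMap_atPrime_iff, isUnit_algebraMap_atPrime_iff] at this

lemma IsLocallyIrreducible.mem {P : HeightOneSpectrum R} {a : O}
    (ha : IsLocallyIrreducible O P a) : (a : R) ∈ P.asIdeal := by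
  have := P.isPrime
  by_contra h
  exact ha.not_isUnit ((isUnit_algebraMap_atPrime_iff (P.asIdeal.comap O.subtype) a).2 h)

lemma IsLocallyIrreducible.ne_zero {P : HeightOneSpectrum R} {a : O}
    (ha : IsLocallyIrreducible O P a) : a ≠ 0 := by
  have := P.isPrime
  rintro rfl
  exact Irreducible.ne_zero ha (map_zero _)

lemma ordAt_eq_zero_of_notMem {P : HeightOneSpectrum R} {x : R} (hx : x ∉ P.asIdeal) :
    ordAt P (Ideal.span {x}) = 0 := by
  have hx0 : x ≠ 0 := by
    rintro rfl
    exact hx (zero_mem _)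
  rw [mem_iff_ordAt_pos P hx0, not_lt, Nat.le_zero] at hx
  exact hx

lemma ordAt_eq_of_mul_eq {P : HeightOneSpectrum R} {a b s t : R} (ha : a ≠ 0) (hb : b ≠ 0)
    (hs : s ∉ P.asIdeal) (ht : t ∉ P.asIdeal) (h : s * a = t * b) :
    ordAt P (Ideal.span {a}) = ordAt P (Ideal.span {b}) := by
  have hs0 : s ≠ 0 := by
    rintro rfl
    exact hs (zero_mem _)
  have ht0 : t ≠ 0 := by
    rintro rfl
    exact ht (zero_mem _)
  have h1 := congrArg (fun x => ordAt P (Ideal.span {x})) h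
  simp only [ordAt_span_mul P hs0 ha, ordAt_span_mul P ht0 hb, ordAt_eq_zero_of_notMem hs,
    ordAt_eq_zero_of_notMem ht, zero_add] at h1
  exact h1

/-- Up to a factor outside of `P`, every non-zero element of `O ∩ P` is divisible by a locally
irreducible one. -/
lemma exists_isLocallyIrreducible_dvd (P : HeightOneSpectrum R) {y : O} (hy0 : y ≠ 0)
    (hyP : (y : R) ∈ P.asIdeal) :
    ∃ u z s : O, IsLocallyIrreducible O P u ∧ (s : R) ∉ P.asIdeal ∧ s * y = u * z := by
  induction hn : ordAt P (Ideal.span {(y : R)}) using Nat.strong_induction_on generalizing y with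
  | _ n ih =>
  subst hn
  have hpr := P.isPrime
  have hone : ((1 : O) : R) ∉ P.asIdeal := fun h => hpr.ne_top ((Ideal.eq_top_iff_one _).2 h)
  by_cases hirr : IsLocallyIrreducible O P y
  · exact ⟨y, 1, 1, hirr, hone, mul_comm _ _⟩
  have hnu : ¬ IsUnit (algebraMap O (Localization.AtPrime (P.asIdeal.comap O.subtype)) y) := by
    rw [isUnit_algebraMap_atPrime_iff]
    exact fun h => h hyP
  rw [IsLocallyIrreducible, irreducible_iff] at hirr
  push Not at hirr
  obtain ⟨a', b', hab, ha', hb'⟩ := hirr hnu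
  obtain ⟨a, ha⟩ := exists_associated_algebraMap _ a'
  obtain ⟨b, hb⟩ := exists_associated_algebraMap _ b'
  have haP : (a : R) ∈ P.asIdeal := by
    by_contra h
    exact ha' (ha.isUnit ((isUnit_algebraMap_atPrime_iff (P.asIdeal.comap O.subtype) a).2 h))
  have hbP : (b : R) ∈ P.asIdeal := by
    by_contra h
    exact hb' (hb.isUnit ((isUnit_algebraMap_atPrime_iff (P.asIdeal.comap O.subtype) b).2 h))
  obtain ⟨s, t, hs, ht, hst⟩ := (associated_algebraMap_iff (P.asIdeal.comap O.subtype)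
    (a := y) (b := a * b)).1 (by
      rw [hab, map_mul]
      exact (ha.mul_mul hb).symm)
  have hs0 : s ≠ 0 := by
    rintro rfl
    exact hs (zero_mem _)
  have hab0 : a * b ≠ 0 := by
    intro h
    rw [h, mul_zero] at hst
    exact mul_ne_zero hs0 hy0 hst
  have ha0 := left_ne_zero_of_mul hab0
  have hb0 := right_ne_zero_of_mul hab0
  have hord := ordAt_eq_of_mul_eq (coe_ne_zero_of_ne_zero hy0) (coe_ne_zero_of_ne_zero hab0) hs ht
    (congrArg Subtype.val hst)
  rw [Subring.coe_mul, ordAt_span_mul P (coe_ne_zero_of_ne_zero ha0)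
    (coe_ne_zero_of_ne_zero hb0)] at hord
  have hbpos := (mem_iff_ordAt_pos P (coe_ne_zero_of_ne_zero hb0)).1 hbP
  obtain ⟨u, z, r, hu, hr, hruz⟩ := ih _ (by lia) ha0 haP rfl
  refine ⟨u, z * t * b, r * s, hu, fun h => ?_, ?_⟩
  · exact (hpr.mem_or_mem h).elim hr hs
  · linear_combination r * hst + t * b * hruz

lemma valuation_locToFrac_algebraMap (p : Ideal O) [p.IsPrime] (P : HeightOneSpectrum R)
    {y : O} (hy : y ≠ 0) :
    P.valuation (FractionRing R) (locToFrac O p (algebraMap O _ y)) =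
      WithZero.exp (-(ordAt P (Ideal.span {(y : R)}) : ℤ)) := by
  rw [locToFrac, IsLocalization.lift_eq]
  change P.valuation (FractionRing R) (algebraMap R (FractionRing R) (y : R)) = _
  rw [P.valuation_of_algebraMap, intValuation_eq_exp_neg_ordAt P (coe_ne_zero_of_ne_zero hy)]

/-- The value of an element of the localization is the exponent of any associated element
of `O`. -/
lemma hasLocalValue_iff (p : Ideal O) [p.IsPrime] {P : HeightOneSpectrum R}
    (hP : ∀ Q : HeightOneSpectrum R, PrimeOver O Q p ↔ Q = P) {x : Localization.AtPrime p}
    {y : O} (hy : y ≠ 0) (hxy : Associated (algebraMap O (Localization.AtPrime p) y) x) (n : ℕ) :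
    HasLocalValue O p x n ↔ ordAt P (Ideal.span {(y : R)}) = n := by
  have hval : P.valuation (FractionRing R) (locToFrac O p x) =
      WithZero.exp (-(ordAt P (Ideal.span {(y : R)}) : ℤ)) := by
    obtain ⟨e, rfl⟩ := hxy
    have hPp : P.asIdeal.comap O.subtype = p := (hP P).2 rfl
    -- the unit `e` is a quotient of two elements of `O` outside of `p`
    obtain ⟨t, s, hts⟩ := IsLocalization.exists_mk'_eq p.primeCompl (e : Localization.AtPrime p)
    have h1 : (e : Localization.AtPrime p) * algebraMap O _ (s : O) = algebraMap O _ t := by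
      rw [← hts, IsLocalization.mk'_spec]
    have ht : t ∉ p := by
      rw [← isUnit_algebraMap_atPrime_iff, ← h1]
      exact e.isUnit.mul ((isUnit_algebraMap_atPrime_iff p s).2 s.2)
    have hnot : ∀ r : O, r ∉ p → (r : R) ∉ P.asIdeal := by
      intro r hr h
      rw [← hPp] at hr
      exact hr h
    have hz : ∀ r : O, r ∉ p → r ≠ 0 := by
      rintro r hr rfl
      exact hr (zero_mem _)
    have hv : ∀ r : O, r ∉ p →
        P.valuation (FractionRing R) (locToFrac O p (algebraMap O _ r)) = 1 := by
      intro r hr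
      rw [valuation_locToFrac_algebraMap p P (hz r hr), ordAt_eq_zero_of_notMem (hnot r hr)]
      simp
    have h2 := congrArg (fun z => P.valuation (FractionRing R) (locToFrac O p z)) h1
    simp only [map_mul] at h2
    rw [hv s s.2, hv t ht, mul_one] at h2
    rw [map_mul, map_mul, h2, mul_one, valuation_locToFrac_algebraMap p P hy]
  constructor
  · rintro ⟨P', hP', h⟩
    have hPP : P = P' := (hP' P).1 ((hP P).2 rfl)
    rw [← hPP, hval, WithZero.exp_inj] at h
    lia
  · intro h
    exact ⟨P, hP, by rw [hval, h]⟩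

end Local

/-! ### Exponents of locally irreducible elements -/

section Exponents

variable {R : Type u} [CommRing R] [IsDedekindDomain R] {O : Subring R}

/-- At a prime ideal that does not contain the conductor, the localizations of `O` and of `R`
coincide. -/
lemma ordAt_eq_one_of_not_le {P : HeightOneSpectrum R} (hf : ¬ orderConductor O ≤ P.asIdeal)
    {y : O} (hy : IsLocallyIrreducible O P y) : ordAt P (Ideal.span {(y : R)}) = 1 := by
  have hpr := P.isPrime
  have hy0 := coe_ne_zero_of_ne_zero hy.ne_zero
  have hpos := (mem_iff_ordAt_pos P hy0).1 hy.mem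
  by_contra hne
  obtain ⟨φ, hφ, hφP⟩ := SetLike.not_le_iff_exists.1 hf
  have hnle : ¬ P.asIdeal ≤ P.asIdeal ^ 2 := by
    rw [← le_ordAt_iff P P.ne_bot, ordAt_self]
    lia
  obtain ⟨t, ht, ht2⟩ := SetLike.not_le_iff_exists.1 hnle
  have ht0 : t ≠ 0 := by
    rintro rfl
    exact ht2 (zero_mem _)
  have htord : ordAt P (Ideal.span {t}) = 1 := by
    have := (mem_iff_ordAt_pos P ht0).1 ht
    rw [mem_pow_iff_le_ordAt P ht0] at ht2
    lia
  obtain ⟨J, hJ, hJP⟩ := exists_eq_pow_ordAt_mul P (span_singleton_ne_bot ht0)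
  obtain ⟨j, hj, hjP⟩ := SetLike.not_le_iff_exists.1 hJP
  have hyj : (y : R) * j ∈ Ideal.span {t} := by
    rw [hJ, htord, pow_one]
    exact Ideal.mul_mem_mul hy.mem hj
  obtain ⟨r, hr⟩ := Ideal.mem_span_singleton'.1 hyj
  have hj0 : j ≠ 0 := by
    rintro rfl
    exact hjP (zero_mem _)
  have hr0 : r ≠ 0 := by
    rintro rfl
    rw [zero_mul] at hr
    exact mul_ne_zero hy0 hj0 hr.symm
  have hrP : r ∈ P.asIdeal := by
    rw [mem_iff_ordAt_pos P hr0]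
    have h1 := congrArg (fun x => ordAt P (Ideal.span {x})) hr
    simp only [ordAt_span_mul P hr0 ht0, ordAt_span_mul P hy0 hj0, htord,
      ordAt_eq_zero_of_notMem hjP] at h1
    lia
  have hmemO : ∀ x : R, φ * x ∈ O := hφ
  have h1 : IsLocallyIrreducible O P (⟨φ * r, hmemO r⟩ * ⟨φ * t, hmemO t⟩) := by
    refine hy.of_mul_eq (s := ⟨φ * (φ * j), hmemO _⟩) (t := 1) ?_ ?_ (Subtype.ext ?_)
    · exact fun h => (hpr.mem_or_mem h).elim hφP fun h' => (hpr.mem_or_mem h').elim hφP hjP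
    · exact fun h => hpr.ne_top ((Ideal.eq_top_iff_one _).2 h)
    · change φ * (φ * j) * (y : R) = 1 * (φ * r * (φ * t))
      linear_combination (-(φ * φ)) * hr
  rcases h1.notMem_or_notMem rfl with h | h
  · exact h (P.asIdeal.mul_mem_left _ hrP)
  · exact h (P.asIdeal.mul_mem_left _ ht)

section Lift

variable (hO : IsOrder O)
  (hSF : ∀ P Q : HeightOneSpectrum R,
    P.asIdeal.comap O.subtype = Q.asIdeal.comap O.subtype → P = Q)
  (hgen : ∀ r : R, IsCoprime (Ideal.span {r}) (orderConductor O) → GeneratedIn O (Ideal.span {r}))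
include hO hSF hgen

/-- If `b` has the same exponents as elements of `O` at all prime ideals containing the
conductor, then `b` is associated in `R` to an element of `O`, which is moreover associated
to any given element of `O` at these prime ideals. -/
theorem exists_unit_mul_mem {b : R} (hb : b ≠ 0) (y : HeightOneSpectrum R → O)
    (hy0 : ∀ P, orderConductor O ≤ P.asIdeal → y P ≠ 0)
    (hy : ∀ P, orderConductor O ≤ P.asIdeal →
      ordAt P (Ideal.span {(y P : R)}) = ordAt P (Ideal.span {b})) :
    ∃ (η : Rˣ) (hη : b * η ∈ O), ∀ P : HeightOneSpectrum R, orderConductor O ≤ P.asIdeal →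
      ∃ s w : O, (s : R) ∉ P.asIdeal ∧ (w : R) ∉ P.asIdeal ∧ s * ⟨b * η, hη⟩ = w * y P := by
  have hT : ∀ P, P ∈ (finite_setOf_le hO.orderConductor_ne_bot).toFinset ↔
    orderConductor O ≤ P.asIdeal := fun P => Set.Finite.mem_toFinset _
  obtain ⟨η, hη⟩ := exists_unit_forall_mul_eq hO hSF hgen _ (fun P hP => (hT P).2 hP) hb
    (fun P => (y P : R))
    (fun P hP => coe_ne_zero_of_ne_zero (hy0 P ((hT P).1 hP))) (fun P hP => hy P ((hT P).1 hP))
  have hmem : b * η ∈ O := by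
    refine hO.mem_of_forall_exists_mul_mem fun P hP => ?_
    obtain ⟨s, hs, w, hw, hsP, -, h⟩ := hη P ((hT P).2 hP)
    exact ⟨s, hs, hsP, h ▸ O.mul_mem hw (y P).2⟩
  refine ⟨η, hmem, fun P hP => ?_⟩
  obtain ⟨s, hs, w, hw, hsP, hwP, h⟩ := hη P ((hT P).2 hP)
  exact ⟨⟨s, hs⟩, ⟨w, hw⟩, hsP, hwP, Subtype.ext h⟩

/-- A locally irreducible element with exponent `n` at `P` can be chosen to generate `P ^ n * J`,
for each ideal `J` coprime to the conductor with `P ^ n * J` principal. -/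
theorem exists_isLocallyIrreducible_span_eq {P : HeightOneSpectrum R}
    (hP : orderConductor O ≤ P.asIdeal) {y : O} (hy : IsLocallyIrreducible O P y) {J : Ideal R}
    (hJ0 : J ≠ ⊥) (hJ : IsCoprime J (orderConductor O))
    (hcl : idealClass (P.asIdeal ^ ordAt P (Ideal.span {(y : R)}) * J) = 1) :
    ∃ a : O, IsLocallyIrreducible O P a ∧
      Ideal.span {(a : R)} = P.asIdeal ^ ordAt P (Ideal.span {(y : R)}) * J := by
  classical
  set n := ordAt P (Ideal.span {(y : R)})
  have hPn := pow_ne_zero n P.ne_bot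
  obtain ⟨r, hr⟩ := (idealClass_eq_one_iff (mul_ne_zero hPn hJ0)).1 hcl
  have hr0 : r ≠ 0 := by
    rintro rfl
    refine mul_ne_zero hPn hJ0 ?_
    rw [hr]
    simp
  have hJord : ∀ Q : HeightOneSpectrum R, orderConductor O ≤ Q.asIdeal → ordAt Q J = 0 := by
    intro Q hQ
    by_contra h
    exact (isCoprime_orderConductor_iff hO).1 hJ Q hQ
      ((ordAt_pos_iff Q hJ0).1 (Nat.pos_of_ne_zero h))
  obtain ⟨η, hη, h⟩ := exists_unit_mul_mem hO hSF hgen hr0 (fun Q => if Q = P then y else 1)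
    (fun Q _ => by
      split_ifs
      · exact hy.ne_zero
      · exact one_ne_zero)
    (fun Q hQ => by
      rw [← hr, ordAt_mul Q hPn hJ0, ordAt_pow, hJord Q hQ]
      split_ifs with h
      · rw [h, ordAt_self]
        simp [n]
      · rw [ordAt_of_ne h, Subring.coe_one, Ideal.span_singleton_one, ordAt_top,
          mul_zero])
  obtain ⟨s, w, hs, hw, hsw⟩ := h P hP
  rw [if_pos rfl] at hsw
  refine ⟨⟨r * η, hη⟩, hy.of_mul_eq hw hs hsw.symm, ?_⟩
  rw [hr]
  exact Ideal.span_singleton_mul_right_unit η.isUnit r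

end Lift

end Exponents

/-! ### Exponents of locally irreducible elements under a transfer homomorphism -/

section Values

variable {R : Type u} [CommRing R] [IsDedekindDomain R] {O : Subring R}

lemma dvd_of_dvd_pow_mul {P : HeightOneSpectrum R} {D J : Ideal R} {n : ℕ}
    (h : D ∣ P.asIdeal ^ n * J) (hD : ¬ D ≤ P.asIdeal) : D ∣ J := by
  refine IsCoprime.dvd_of_dvd_mul_left (IsCoprime.pow_right ?_) h
  rw [Ideal.isCoprime_iff_sup_eq, sup_comm]
  exact P.isMaximal.out.2 _ (left_lt_sup.2 hD)

lemma eq_of_dvd_heightOneSpectrum {Q : HeightOneSpectrum R} {D : Ideal R} (h : D ∣ Q.asIdeal)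
    (hD : D ≠ ⊤) : D = Q.asIdeal :=
  (Q.isMaximal.eq_of_le hD (Ideal.le_of_dvd h)).symm

lemma eq_or_eq_or_eq_of_dvd_mul {Q₁ Q₂ : HeightOneSpectrum R} {D : Ideal R}
    (h : D ∣ Q₁.asIdeal * Q₂.asIdeal) (hD : D ≠ ⊤) :
    D = Q₁.asIdeal ∨ D = Q₂.asIdeal ∨ D = Q₁.asIdeal * Q₂.asIdeal := by
  obtain ⟨E, hE⟩ := h
  rcases eq_mul_or_eq_mul_of_mul_eq hE.symm with ⟨D', rfl, h'⟩ | ⟨E', -, h'⟩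
  · by_cases hD' : D' = ⊤
    · left
      rw [hD', Ideal.mul_top]
    · right; right
      rw [eq_of_dvd_heightOneSpectrum ⟨E, h'.symm⟩ hD']
  · exact Or.inr (Or.inl (eq_of_dvd_heightOneSpectrum ⟨E', h'.symm⟩ hD))

variable (hO : IsOrder O) (hfin : Finite (R ⧸ orderConductor O))
  (hSF : ∀ P Q : HeightOneSpectrum R,
    P.asIdeal.comap O.subtype = Q.asIdeal.comap O.subtype → P = Q)

include hO hfin hSF in
lemma exists_pow_mem (z : R) : ∃ k : ℕ, 0 < k ∧ z ^ k ∈ O :=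
  exists_pow_mem_of_forall_mem_iff hO hfin fun P Q h hz => hSF P Q h ▸ hz

lemma IsLocallyIrreducible.of_associated {P : HeightOneSpectrum R} {a b : O}
    (ha : IsLocallyIrreducible O P a) (h : Associated b a) : IsLocallyIrreducible O P b := by
  have hpr := P.isPrime
  obtain ⟨e, he⟩ := h
  have hone : ((1 : O) : R) ∉ P.asIdeal := fun h => hpr.ne_top ((Ideal.eq_top_iff_one _).2 h)
  refine ha.of_mul_eq hone (t := e) (fun h => ?_) (by rw [← he]; ring)
  exact hpr.ne_top (Ideal.eq_top_of_isUnit_mem _ h (e.isUnit.map O.subtype))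

variable (hgen : ∀ r : R, IsCoprime (Ideal.span {r}) (orderConductor O) →
    GeneratedIn O (Ideal.span {r}))
variable {B : Type u} [CancelCommMonoid B] {θ : R⁰ →* B}
variable (hθ : IsTransferHom (θ.comp (orderInclusion O)))

include hO hfin hSF hgen hθ

/-- If `P ^ n * J` is a product of two principal ideals, then an element of `O` generating
`P ^ n * J` is a product of two non-units of `O`. If it is locally irreducible, one of these is
not in `P`, and therefore divides `J`. -/
lemma exists_dvd_of_pow_mul_eq {P : HeightOneSpectrum R} (hP : orderConductor O ≤ P.asIdeal)
    {y : O} (hy : IsLocallyIrreducible O P y) {J I₁ I₂ : Ideal R} (hJ0 : J ≠ ⊥)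
    (hJ : IsCoprime J (orderConductor O))
    (h : P.asIdeal ^ ordAt P (Ideal.span {(y : R)}) * J = I₁ * I₂) (h₁ : I₁ ≠ ⊤) (h₂ : I₂ ≠ ⊤)
    (hc₁ : idealClass I₁ = 1) (hc₂ : idealClass I₂ = 1) :
    ∃ D : Ideal R, D ∣ J ∧ D ≠ ⊤ ∧ idealClass D = 1 := by
  have h0 : I₁ * I₂ ≠ ⊥ := h ▸ mul_ne_zero (pow_ne_zero _ P.ne_bot) hJ0
  have h10 : I₁ ≠ ⊥ := left_ne_zero_of_mul h0
  have h20 : I₂ ≠ ⊥ := right_ne_zero_of_mul h0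
  obtain ⟨a, haP, ha⟩ := exists_isLocallyIrreducible_span_eq hO hSF hgen hP hy hJ0 hJ
    (by rw [h, idealClass_mul h10 h20, hc₁, hc₂, one_mul])
  obtain ⟨d₁, rfl⟩ := (idealClass_eq_one_iff h10).1 hc₁
  obtain ⟨d₂, rfl⟩ := (idealClass_eq_one_iff h20).1 hc₂
  rw [ne_eq, Ideal.span_singleton_eq_top] at h₁ h₂
  obtain ⟨l', hl', hlen, hnu⟩ := exists_list_not_isUnit hO hθ haP.ne_zero [d₁, d₂]
    (by
      intro d hd
      refine ⟨?_, exists_pow_mem hO hfin hSF d⟩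
      rcases List.mem_pair.1 hd with rfl | rfl
      · exact h₁
      · exact h₂)
    (by
      rw [← Ideal.span_singleton_eq_span_singleton, ha, h]
      simp [span_singleton_mul_eq])
  obtain ⟨v, w, rfl⟩ := List.length_eq_two.1 hlen
  rw [List.prod_pair] at hl'
  have key : ∀ v : O, v ∣ a → ¬ IsUnit v → (v : R) ∉ P.asIdeal →
      ∃ D : Ideal R, D ∣ J ∧ D ≠ ⊤ ∧ idealClass D = 1 := by
    intro v hva hv hvP
    refine ⟨_, dvd_of_dvd_pow_mul (ha ▸ span_coe_dvd hva) ?_, hO.span_ne_top hv,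
      idealClass_span ?_⟩
    · rwa [← mem_iff_span_le]
    · rintro h
      exact hvP (h ▸ zero_mem _)
  rcases (haP.of_associated hl').notMem_or_notMem rfl with hv | hw
  · exact key v ((Dvd.intro _ rfl).trans hl'.dvd) (hnu v (by simp)) hv
  · exact key w ((Dvd.intro_left _ rfl).trans hl'.dvd) (hnu w (by simp)) hw

/-- If the class `c` of `P` did not satisfy `c ^ n = 1`, then `J` could be chosen as a product of one
or two prime ideals, in the classes of `c⁻¹` and `(c ^ (n - 1))⁻¹`, so that `P ^ n * J` is a product
of two principal ideals although `J` has no principal divisor. -/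
lemma idealClass_pow_ordAt_eq_one (hNP : NontrivialClassesContainPrimes O)
    {P : HeightOneSpectrum R} (hP : orderConductor O ≤ P.asIdeal) {y : O}
    (hy : IsLocallyIrreducible O P y) (hn : 2 ≤ ordAt P (Ideal.span {(y : R)})) :
    idealClass P.asIdeal ^ ordAt P (Ideal.span {(y : R)}) = 1 := by
  set n := ordAt P (Ideal.span {(y : R)}) with hn_def
  set c := idealClass P.asIdeal with hc_def
  have hPtop : P.asIdeal ≠ ⊤ := P.isPrime.ne_top
  have hpowtop : ∀ j, 0 < j → P.asIdeal ^ j ≠ ⊤ := fun j hj h =>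
    hPtop (top_le_iff.1 (h ▸ Ideal.pow_le_self hj.ne'))
  by_contra hcn
  have hc1 : c ≠ 1 := fun h => hcn (by rw [h, one_pow])
  obtain ⟨Q, hQ, hQc⟩ := hNP c⁻¹ (inv_ne_one.2 hc1)
  have hPQ : idealClass (P.asIdeal * Q.asIdeal) = 1 := by
    rw [idealClass_mul P.ne_bot Q.ne_bot, hQc, ← hc_def, mul_inv_cancel]
  have hsucc : P.asIdeal ^ n = P.asIdeal ^ (n - 1) * P.asIdeal := by
    rw [← pow_succ]
    congr 1
    lia
  by_cases hcn1 : c ^ (n - 1) = 1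
  · obtain ⟨D, hD, hDtop, hDc⟩ := exists_dvd_of_pow_mul_eq hO hfin hSF hgen hθ hP hy Q.ne_bot hQ
      (I₁ := P.asIdeal ^ (n - 1)) (I₂ := P.asIdeal * Q.asIdeal)
      (by rw [← hn_def, hsucc, mul_assoc]) (hpowtop _ (by lia))
      (mul_ne_top_of_heightOneSpectrum _ _)
      (by rw [idealClass_pow P.ne_bot, ← hc_def, hcn1]) hPQ
    rw [eq_of_dvd_heightOneSpectrum hD hDtop, hQc, inv_eq_one] at hDc
    exact hc1 hDc
  · obtain ⟨Q₂, hQ₂, hQc₂⟩ := hNP (c ^ (n - 1))⁻¹ (inv_ne_one.2 hcn1)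
    obtain ⟨D, hD, hDtop, hDc⟩ := exists_dvd_of_pow_mul_eq hO hfin hSF hgen hθ hP hy
      (mul_ne_zero Q.ne_bot Q₂.ne_bot) (hQ.mul_left hQ₂)
      (I₁ := P.asIdeal * Q.asIdeal) (I₂ := P.asIdeal ^ (n - 1) * Q₂.asIdeal)
      (by rw [← hn_def, hsucc]; ring) (mul_ne_top_of_heightOneSpectrum _ _)
      (mul_comm Q₂.asIdeal _ ▸ mul_ne_top_of_heightOneSpectrum _ _) hPQ
      (by rw [idealClass_mul (pow_ne_zero _ P.ne_bot) Q₂.ne_bot, idealClass_pow P.ne_bot,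
        hQc₂, ← hc_def, mul_inv_cancel])
    rcases eq_or_eq_or_eq_of_dvd_mul hD hDtop with rfl | rfl | rfl
    · rw [hQc, inv_eq_one] at hDc
      exact hc1 hDc
    · rw [hQc₂, inv_eq_one] at hDc
      exact hcn1 hDc
    · rw [idealClass_mul Q.ne_bot Q₂.ne_bot, hQc, hQc₂, ← mul_inv, inv_eq_one, ← pow_succ',
        Nat.sub_add_cancel (by lia)] at hDc
      exact hcn hDc

/-- A locally irreducible element of exponent `n ≥ 2` forces the class of `P` to have
order `n`. -/
lemma orderOf_idealClass_eq_ordAt (hNP : NontrivialClassesContainPrimes O)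
    {P : HeightOneSpectrum R} (hP : orderConductor O ≤ P.asIdeal) {y : O}
    (hy : IsLocallyIrreducible O P y) (hn : 2 ≤ ordAt P (Ideal.span {(y : R)})) :
    orderOf (idealClass P.asIdeal) = ordAt P (Ideal.span {(y : R)}) := by
  set n := ordAt P (Ideal.span {(y : R)}) with hn_def
  set c := idealClass P.asIdeal with hc_def
  have hPtop : P.asIdeal ≠ ⊤ := P.isPrime.ne_top
  have hpowtop : ∀ j, 0 < j → P.asIdeal ^ j ≠ ⊤ := fun j hj h =>
    hPtop (top_le_iff.1 (h ▸ Ideal.pow_le_self hj.ne'))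
  have hcn : c ^ n = 1 := idealClass_pow_ordAt_eq_one hO hfin hSF hgen hθ hNP hP hy hn
  refine le_antisymm (orderOf_le_of_pow_eq_one (by lia) hcn) ?_
  by_contra! hlt
  have hpos : 0 < orderOf c :=
    orderOf_pos_iff.2 (isOfFinOrder_iff_pow_eq_one.2 ⟨n, by lia, hcn⟩)
  obtain ⟨D, hD, hDtop, -⟩ := exists_dvd_of_pow_mul_eq hO hfin hSF hgen hθ hP hy
    (J := ⊤) top_ne_bot (by rw [← Ideal.one_eq_top]; exact isCoprime_one_left)
    (I₁ := P.asIdeal ^ orderOf c) (I₂ := P.asIdeal ^ (n - orderOf c))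
    (by
      rw [Ideal.mul_top, ← pow_add]
      congr 1
      lia) (hpowtop _ hpos) (hpowtop _ (by lia))
    (by rw [idealClass_pow P.ne_bot, ← hc_def, pow_orderOf_eq_one])
    (by
      rw [idealClass_pow P.ne_bot, ← hc_def, pow_sub c hlt.le, hcn, pow_orderOf_eq_one, inv_one,
        one_mul])
  exact hDtop (top_le_iff.1 (Ideal.le_of_dvd hD))

/-- Exponents `n ≥ 3` are impossible: for a prime ideal `Q` in the class opposite to that of `P`,
`P ^ n * Q ^ n = (P * Q) ^ n` would be generated by a product of three non-units of `O`. Two of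
these are not in `P`, but no proper divisor of `Q ^ n` is principal. -/
lemma ordAt_le_two (hNP : NontrivialClassesContainPrimes O)
    {P : HeightOneSpectrum R} (hP : orderConductor O ≤ P.asIdeal) {y : O}
    (hy : IsLocallyIrreducible O P y) : ordAt P (Ideal.span {(y : R)}) ≤ 2 := by
  by_contra! hn
  have hord := orderOf_idealClass_eq_ordAt hO hfin hSF hgen hθ hNP hP hy (by lia)
  set n := ordAt P (Ideal.span {(y : R)}) with hn_def
  set c := idealClass P.asIdeal with hc_def
  have hc1 : c ≠ 1 := by
    rw [ne_eq, ← orderOf_eq_one_iff]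
    lia
  obtain ⟨Q, hQ, hQc⟩ := hNP c⁻¹ (inv_ne_one.2 hc1)
  have hPQ0 : P.asIdeal * Q.asIdeal ≠ ⊥ := mul_ne_zero P.ne_bot Q.ne_bot
  obtain ⟨d, hd⟩ := (idealClass_eq_one_iff hPQ0).1
    (by rw [idealClass_mul P.ne_bot Q.ne_bot, hQc, ← hc_def, mul_inv_cancel])
  have hdu : ¬ IsUnit d := by
    rw [← Ideal.span_singleton_eq_top, ← hd]
    exact mul_ne_top_of_heightOneSpectrum _ _
  have hQn : Q.asIdeal ^ n ≠ ⊥ := pow_ne_zero n Q.ne_bot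
  obtain ⟨a, haP, ha⟩ := exists_isLocallyIrreducible_span_eq hO hSF hgen hP hy hQn hQ.pow_left
    (by rw [← hn_def, ← mul_pow, idealClass_pow hPQ0, idealClass_mul P.ne_bot Q.ne_bot, hQc,
      ← hc_def, mul_inv_cancel, one_pow])
  rw [← hn_def] at ha
  obtain ⟨l', hl', hlen, hnu⟩ := exists_list_not_isUnit hO hθ haP.ne_zero [d, d, d ^ (n - 2)]
    (by
      intro x hx
      refine ⟨?_, exists_pow_mem hO hfin hSF x⟩
      simp only [List.mem_cons, List.not_mem_nil, or_false] at hx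
      rcases hx with rfl | rfl | rfl
      · exact hdu
      · exact hdu
      · rwa [isUnit_pow_iff (by lia)])
    (by
      rw [← Ideal.span_singleton_eq_span_singleton, ha, ← mul_pow, hd, Ideal.span_singleton_pow]
      simp only [List.prod_cons, List.prod_nil, mul_one, ← pow_succ']
      congr 3
      lia)
  obtain ⟨x, y', z, rfl⟩ := List.length_eq_three.1 hlen
  simp only [List.prod_cons, List.prod_nil, mul_one] at hl'
  -- an element of `O` outside of `P` that divides `a` generates a power of `Q`
  have hpow : ∀ v : R, v ∉ P.asIdeal → ¬ IsUnit v → Ideal.span {v} ∣ Ideal.span {(a : R)} →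
      n ≤ ordAt Q (Ideal.span {v}) := by
    intro v hvP hv hva
    have hv0 : v ≠ 0 := by
      rintro rfl
      exact hvP (zero_mem _)
    have h1 : Ideal.span {v} ∣ Q.asIdeal ^ n :=
      dvd_of_dvd_pow_mul (ha ▸ hva) (by rwa [← mem_iff_span_le])
    obtain ⟨i, -, hi⟩ := (dvd_prime_pow Q.prime n).1 h1
    rw [associated_iff_eq] at hi
    rw [hi, ordAt_pow, ordAt_self, mul_one]
    have hi0 : i ≠ 0 := by
      rintro rfl
      rw [pow_zero, Ideal.one_eq_top, Ideal.span_singleton_eq_top] at hi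
      exact hv hi
    have h2 := idealClass_span hv0
    rw [hi, idealClass_pow Q.ne_bot, hQc, inv_pow, inv_eq_one] at h2
    rw [← hord]
    exact orderOf_le_of_pow_eq_one (Nat.pos_of_ne_zero hi0) h2
  have key : ∀ v w u : O, Associated (v * (w * u)) a → ¬ IsUnit v → ¬ IsUnit w →
      (v : R) ∉ P.asIdeal → (w : R) ∉ P.asIdeal → False := by
    intro v w u h hv hw hvP hwP
    have hv0 : (v : R) ≠ 0 := fun h => hvP (h ▸ zero_mem _)
    have hw0 : (w : R) ≠ 0 := fun h => hwP (h ▸ zero_mem _)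
    have hdvd : v * w ∣ a := by
      rw [← mul_assoc] at h
      exact (Dvd.intro _ rfl).trans h.dvd
    have hvwP : ¬ Ideal.span {((v * w : O) : R)} ≤ P.asIdeal := by
      rw [← mem_iff_span_le]
      exact fun h => (P.isPrime.mem_or_mem h).elim hvP hwP
    have h1 := ordAt_mono Q hQn (dvd_of_dvd_pow_mul (ha ▸ span_coe_dvd hdvd) hvwP)
    rw [Subring.coe_mul, ordAt_span_mul Q hv0 hw0, ordAt_pow, ordAt_self, mul_one] at h1
    have h2 := hpow v hvP (by rwa [hO.isUnit_coe_iff])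
      (span_coe_dvd ((Dvd.intro _ rfl).trans hdvd))
    have h3 := hpow w hwP (by rwa [hO.isUnit_coe_iff])
      (span_coe_dvd ((Dvd.intro_left _ rfl).trans hdvd))
    lia
  have hx := hnu x (by simp)
  have hy' := hnu y' (by simp)
  have hz := hnu z (by simp)
  have hpr := P.isPrime
  rcases (haP.of_associated hl').notMem_or_notMem rfl with h | h
  · rcases (haP.of_associated hl').notMem_or_notMem (v := y') (w := x * z) (by ring) with h' | h'
    · exact key x y' z hl' hx hy' h h'
    · refine key x z y' (by rwa [mul_comm z]) hx hz h fun h'' => h' ?_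
      exact P.asIdeal.mul_mem_left _ h''
  · refine key y' z x (by convert hl' using 1; ring) hy' hz (fun h' => h ?_) fun h' => h ?_
    · exact P.asIdeal.mul_mem_right _ h'
    · exact P.asIdeal.mul_mem_left _ h'

/-- An exponent is `1`, or it is `2` and `P` is not principal. -/
theorem ordAt_eq_one_or_eq_two (hNP : NontrivialClassesContainPrimes O)
    {P : HeightOneSpectrum R} {y : O} (hy : IsLocallyIrreducible O P y) :
    ordAt P (Ideal.span {(y : R)}) = 1 ∨
      (ordAt P (Ideal.span {(y : R)}) = 2 ∧ idealClass P.asIdeal ≠ 1) := by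
  by_cases hP : orderConductor O ≤ P.asIdeal
  · have h1 := ordAt_le_two hO hfin hSF hgen hθ hNP hP hy
    have h2 := (mem_iff_ordAt_pos P (coe_ne_zero_of_ne_zero hy.ne_zero)).1 hy.mem
    by_cases h3 : ordAt P (Ideal.span {(y : R)}) = 1
    · exact Or.inl h3
    · have h4 : ordAt P (Ideal.span {(y : R)}) = 2 := by lia
      refine Or.inr ⟨h4, ?_⟩
      have := orderOf_idealClass_eq_ordAt hO hfin hSF hgen hθ hNP hP hy h4.ge
      rw [ne_eq, ← orderOf_eq_one_iff]
      lia
  · exact Or.inl (ordAt_eq_one_of_not_le hP hy)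

/-- If there are at least three classes, then all exponents are `1`: otherwise, with `c` the class
of `P` and `h` a third class, `P ^ 2` times two opposite pairs of prime ideals of classes `h` and
`(c * h)⁻¹` is a product of two ideals `P * Q₁ * Q₂`, and thus generated by a product of two
irreducible elements of `O`. The one outside of `P` generates the product of both pairs, hence
is reducible. -/
theorem ordAt_eq_one (hR : IsMulTorsion (ClassGroup R)) (hNP : NontrivialClassesContainPrimes O)
    (hthird : ∀ g : ClassGroup R, g ≠ 1 → ∃ h, h ≠ 1 ∧ h ≠ g)
    {P : HeightOneSpectrum R} {y : O} (hy : IsLocallyIrreducible O P y) :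
    ordAt P (Ideal.span {(y : R)}) = 1 := by
  by_cases hP : orderConductor O ≤ P.asIdeal
  swap
  · exact ordAt_eq_one_of_not_le hP hy
  rcases ordAt_eq_one_or_eq_two hO hfin hSF hgen hθ hNP hy with h1 | ⟨h2, hc1⟩
  · exact h1
  exfalso
  have hord := orderOf_idealClass_eq_ordAt hO hfin hSF hgen hθ hNP hP hy h2.ge
  rw [h2] at hord
  set c := idealClass P.asIdeal with hc_def
  have hcc : c * c = 1 := by
    rw [← pow_two, ← hord, pow_orderOf_eq_one]
  obtain ⟨h, hh1, hhc⟩ := hthird c hc1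
  have hch : c * h ≠ 1 := by
    intro h'
    exact hhc (mul_left_cancel (h'.trans hcc.symm))
  obtain ⟨Q₁, hQ₁, hQc₁⟩ := hNP h hh1
  obtain ⟨Q₂, hQ₂, hQc₂⟩ := hNP (c * h)⁻¹ (inv_ne_one.2 hch)
  obtain ⟨Q₁', hp₁⟩ := exists_isOppositePair hR hO hfin hθ hNP hQ₁ (hQc₁ ▸ hh1)
  obtain ⟨Q₂', hp₂⟩ := exists_isOppositePair hR hO hfin hθ hNP hQ₂ (hQc₂ ▸ inv_ne_one.2 hch)
  have hne : ∀ P Q S : HeightOneSpectrum R, P.asIdeal * Q.asIdeal * S.asIdeal ≠ ⊥ :=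
    fun P Q S => mul_ne_zero (mul_ne_zero P.ne_bot Q.ne_bot) S.ne_bot
  have hcl3 : ∀ P Q S : HeightOneSpectrum R, idealClass (P.asIdeal * Q.asIdeal * S.asIdeal) =
      idealClass P.asIdeal * idealClass Q.asIdeal * idealClass S.asIdeal := fun P Q S => by
    rw [idealClass_mul (mul_ne_zero P.ne_bot Q.ne_bot) S.ne_bot, idealClass_mul P.ne_bot Q.ne_bot]
  have hk₁ : idealClass (P.asIdeal * Q₁.asIdeal * Q₂.asIdeal) = 1 := by
    rw [hcl3, ← hc_def, hQc₁, hQc₂, mul_inv_cancel]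
  have hk₂ : idealClass (P.asIdeal * Q₁'.asIdeal * Q₂'.asIdeal) = 1 := by
    rw [hcl3, ← hc_def, hp₁.class_eq, hp₂.class_eq, hQc₁, hQc₂, inv_inv]
    calc c * h⁻¹ * (c * h) = c * c * (h⁻¹ * h) := by ac_rfl
      _ = 1 := by rw [hcc, inv_mul_cancel, one_mul]
  obtain ⟨d₁, hd₁⟩ := (idealClass_eq_one_iff (hne _ _ _)).1 hk₁
  obtain ⟨d₂, hd₂⟩ := (idealClass_eq_one_iff (hne _ _ _)).1 hk₂
  obtain ⟨e₁, he₁, hpe₁⟩ := hp₁.generatedIn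
  obtain ⟨e₂, he₂, hpe₂⟩ := hp₂.generatedIn
  set J := Q₁.asIdeal * Q₁'.asIdeal * (Q₂.asIdeal * Q₂'.asIdeal) with hJ_def
  have hJ0 : J ≠ ⊥ := mul_ne_zero (mul_ne_zero Q₁.ne_bot Q₁'.ne_bot)
    (mul_ne_zero Q₂.ne_bot Q₂'.ne_bot)
  have hJ : IsCoprime J (orderConductor O) :=
    (hp₁.left.mul_left hp₁.right).mul_left (hp₂.left.mul_left hp₂.right)
  have hJe : J = Ideal.span {e₁ * e₂} := by rw [hJ_def, hpe₁, hpe₂, span_singleton_mul_eq]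
  have hsplit : P.asIdeal ^ 2 * J =
      P.asIdeal * Q₁.asIdeal * Q₂.asIdeal * (P.asIdeal * Q₁'.asIdeal * Q₂'.asIdeal) := by
    rw [hJ_def]
    ring
  obtain ⟨a, haP, ha⟩ := exists_isLocallyIrreducible_span_eq hO hSF hgen hP hy hJ0 hJ
    (by rw [h2, hsplit, idealClass_mul (hne _ _ _) (hne _ _ _), hk₁, hk₂, one_mul])
  rw [h2] at ha
  obtain ⟨v, w, hvw, hv, hw⟩ := exists_eq_mul_irreducible hO hθ (a := a) (d₁ := d₁) (d₂ := d₂)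
    (isShort_of_span_eq (exists_pow_mem hO hfin hSF d₁) hc1 hp₁.class_ne hp₂.class_ne hd₁)
    (isShort_of_span_eq (exists_pow_mem hO hfin hSF d₂) hc1 hp₁.class_ne' hp₂.class_ne' hd₂)
    (by rw [← Ideal.span_singleton_eq_span_singleton, ha, hsplit, hd₁, hd₂,
      span_singleton_mul_eq])
  have key : ∀ v w : O, a = v * w → Irreducible v → Irreducible w → (v : R) ∉ P.asIdeal →
      False := by
    intro v w hvw hv hw hvP
    have hvJ : Ideal.span {(v : R)} ∣ J := dvd_of_dvd_pow_mul (n := 2)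
      (ha ▸ span_coe_dvd ⟨w, hvw⟩) (by rwa [← mem_iff_span_le])
    have hvreg : IsCoprime (Ideal.span {(v : R)}) (orderConductor O) :=
      hJ.of_isCoprime_of_dvd_left hvJ
    rw [hJe, Ideal.dvd_span_singleton, Ideal.mem_span_singleton'] at hvJ
    obtain ⟨t, ht⟩ := hvJ
    have htO : t ∈ O := mem_of_mul_mem hfin v.2 hvreg
      (by rw [mul_comm, ht]; exact O.mul_mem he₁ he₂)
    have htJ : Ideal.span {t} ∣ J := by
      rw [hJe, ← ht, span_singleton_mul_eq]
      exact Dvd.intro _ rfl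
    have htreg : IsCoprime (Ideal.span {t}) (orderConductor O) :=
      hJ.of_isCoprime_of_dvd_left htJ
    have hv0 : Ideal.span {(v : R)} ≠ 0 :=
      span_singleton_ne_bot (coe_ne_zero_of_ne_zero hv.ne_zero)
    have hwt : Ideal.span {(w : R)} = P.asIdeal ^ 2 * Ideal.span {t} := by
      refine mul_left_cancel₀ hv0 ?_
      rw [← span_singleton_mul_eq, ← Subring.coe_mul, ← hvw, ha, hJe, ← ht, span_singleton_mul_eq]
      ring
    have hwmem : (w : R) ∈ Ideal.span {t} := by
      rw [mem_iff_span_le, hwt]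
      exact Ideal.mul_le_right
    obtain ⟨u, hu⟩ := Ideal.mem_span_singleton'.1 hwmem
    have huO : u ∈ O := mem_of_mul_mem hfin htO htreg (by rw [mul_comm, hu]; exact w.2)
    have hwtu : w = ⟨t, htO⟩ * ⟨u, huO⟩ := Subtype.ext (by
      rw [← hu, mul_comm]
      rfl)
    rcases hw.isUnit_or_isUnit hwtu with h' | h'
    · have hb : (⟨e₁, he₁⟩ * ⟨e₂, he₂⟩ : O) = v * ⟨t, htO⟩ := Subtype.ext (by
        change e₁ * e₂ = v * t
        rw [← ht, mul_comm])
      have hirr : Irreducible (⟨e₁, he₁⟩ * ⟨e₂, he₂⟩ : O) := by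
        rw [hb]
        exact (associated_mul_unit_right v _ h').irreducible hv
      rcases hirr.isUnit_or_isUnit rfl with h'' | h'' <;> rw [← hO.isUnit_coe_iff] at h''
      · refine mul_ne_top_of_heightOneSpectrum Q₁ Q₁'.asIdeal ?_
        rw [hpe₁, Ideal.span_singleton_eq_top]
        exact h''
      · refine mul_ne_top_of_heightOneSpectrum Q₂ Q₂'.asIdeal ?_
        rw [hpe₂, Ideal.span_singleton_eq_top]
        exact h''
    · rw [← hO.isUnit_coe_iff] at h'
      have ht0 : Ideal.span {t} ≠ 0 := by
        intro h0
        rw [h0, mul_zero] at hwt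
        exact span_singleton_ne_bot (coe_ne_zero_of_ne_zero hw.ne_zero) hwt
      have hPP : P.asIdeal * P.asIdeal = ⊤ := by
        refine mul_right_cancel₀ ht0 ?_
        rw [← pow_two, ← hwt, ← hu, Ideal.top_mul, Ideal.span_singleton_mul_left_unit h']
      exact mul_ne_top_of_heightOneSpectrum _ _ hPP
  rcases haP.notMem_or_notMem hvw with h' | h'
  · exact key v w hvw hv hw h'
  · exact key w v (by rw [hvw, mul_comm]) hw hv h'

end Values

/-! ### Atoms of the localizations and exponents of locally irreducible elements -/

section Translate

variable {R : Type u} [CommRing R] [IsDedekindDomain R] {O : Subring R}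

lemma one_notMem (P : HeightOneSpectrum R) : ((1 : O) : R) ∉ P.asIdeal := fun h =>
  P.isPrime.ne_top ((Ideal.eq_top_iff_one _).2 h)

/-- Every atom of a localization `O_𝔭` is associated to a locally irreducible element of `O`. -/
lemma exists_isLocallyIrreducible_hasLocalValue_iff (hO : IsOrder O)
    (hSF : ∀ P Q : HeightOneSpectrum R,
      P.asIdeal.comap O.subtype = Q.asIdeal.comap O.subtype → P = Q)
    (p : Ideal O) [hp : p.IsPrime] {x : Localization.AtPrime p} (hx : Irreducible x) :
    ∃ (P : HeightOneSpectrum R) (y : O), (∀ Q, PrimeOver O Q p ↔ Q = P) ∧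
      IsLocallyIrreducible O P y ∧
      ∀ n, HasLocalValue O p x n ↔ ordAt P (Ideal.span {(y : R)}) = n := by
  obtain ⟨y, hyx⟩ := exists_associated_algebraMap p x
  have hirr := hyx.symm.irreducible hx
  have hy0 : y ≠ 0 := by
    rintro rfl
    exact hirr.ne_zero (map_zero _)
  have hyp : y ∈ p := by
    by_contra h
    exact hirr.not_isUnit ((isUnit_algebraMap_atPrime_iff p y).2 h)
  obtain ⟨P, hP⟩ := hO.exists_primeOver p fun h => hy0 (by rwa [h, Ideal.mem_bot] at hyp)
  have hPQ : ∀ Q, PrimeOver O Q p ↔ Q = P := fun Q =>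
    ⟨fun h => hSF Q P (h.trans hP.symm), fun h => h ▸ hP⟩
  refine ⟨P, y, hPQ, ?_, hasLocalValue_iff p hPQ hy0 hyx⟩
  subst hP
  exact hirr

lemma IsOrder.exists_mem_asIdeal (hO : IsOrder O) (P : HeightOneSpectrum R) :
    ∃ y : O, y ≠ 0 ∧ (y : R) ∈ P.asIdeal := by
  obtain ⟨f, hf, hf0⟩ := Submodule.exists_mem_ne_zero_of_ne_bot hO.orderConductor_ne_bot
  obtain ⟨π, hπ, hπ0⟩ := Submodule.exists_mem_ne_zero_of_ne_bot P.ne_bot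
  exact ⟨⟨f * π, hf π⟩, fun h => mul_ne_zero hf0 hπ0 (congrArg Subtype.val h),
    P.asIdeal.mul_mem_left _ hπ⟩

lemma eq_of_comap_eq_of_hasLocalValue (hO : IsOrder O)
    (h : ∀ (p : Ideal O) [p.IsPrime] (x : Localization.AtPrime p), Irreducible x →
      ∃ n, HasLocalValue O p x n) (P Q : HeightOneSpectrum R)
    (hPQ : P.asIdeal.comap O.subtype = Q.asIdeal.comap O.subtype) : P = Q := by
  obtain ⟨y, hy0, hyP⟩ := hO.exists_mem_asIdeal P
  obtain ⟨u, -, -, hu, -⟩ := exists_isLocallyIrreducible_dvd P hy0 hyP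
  have := P.isPrime
  obtain ⟨n, P', hP', -⟩ := h _ _ hu
  exact ((hP' P).1 rfl).trans ((hP' Q).1 hPQ.symm).symm

lemma IsLocallyIrreducible.hasLocalValue_iff
    (hSF : ∀ P Q : HeightOneSpectrum R,
      P.asIdeal.comap O.subtype = Q.asIdeal.comap O.subtype → P = Q)
    {P : HeightOneSpectrum R} {y : O} (hy : IsLocallyIrreducible O P y) (n : ℕ) :
    haveI := P.isPrime
    HasLocalValue O (P.asIdeal.comap O.subtype) (algebraMap O _ y) n ↔
      ordAt P (Ideal.span {(y : R)}) = n :=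
  haveI := P.isPrime
  _root_.hasLocalValue_iff _ (fun Q => ⟨fun h => hSF Q P h, fun h => h ▸ rfl⟩) hy.ne_zero
    (Associated.refl _) n

/-- If all locally irreducible elements had exponent `2`, then `O ∩ P` would only contain elements
of even exponent, which is not true for the conductor. -/
lemma exists_ordAt_eq_one (hO : IsOrder O)
    (hval : ∀ (P : HeightOneSpectrum R) (y : O), IsLocallyIrreducible O P y →
      ordAt P (Ideal.span {(y : R)}) = 1 ∨ ordAt P (Ideal.span {(y : R)}) = 2)
    (P : HeightOneSpectrum R) :
    ∃ t : O, t ≠ 0 ∧ ordAt P (Ideal.span {(t : R)}) = 1 := by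
  by_contra! hcon
  have heven : ∀ (n : ℕ) (y : O), y ≠ 0 → ordAt P (Ideal.span {(y : R)}) = n → Even n := by
    intro n
    induction n using Nat.strong_induction_on with
    | _ n ih =>
    intro y hy0 hn
    by_cases hyP : (y : R) ∈ P.asIdeal
    · obtain ⟨u, z, s, hu, hs, h⟩ := exists_isLocallyIrreducible_dvd P hy0 hyP
      have hu2 : ordAt P (Ideal.span {(u : R)}) = 2 :=
        (hval P u hu).resolve_left (hcon u hu.ne_zero)
      have hs0 : s ≠ 0 := fun h => hs (h ▸ zero_mem _)
      have hz0 : z ≠ 0 := by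
        rintro rfl
        rw [mul_zero] at h
        exact mul_ne_zero hs0 hy0 h
      have h1 := ordAt_eq_of_mul_eq (P := P) (coe_ne_zero_of_ne_zero hy0)
        (coe_ne_zero_of_ne_zero (mul_ne_zero hu.ne_zero hz0)) hs (one_notMem (O := O) P)
        (by rw [← Subring.coe_mul, h, ← Subring.coe_mul, one_mul])
      rw [Subring.coe_mul, ordAt_span_mul P (coe_ne_zero_of_ne_zero hu.ne_zero)
        (coe_ne_zero_of_ne_zero hz0), hu2, hn] at h1
      rw [h1]
      exact even_two.add (ih _ (by lia) z hz0 rfl)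
    · rw [← hn, ordAt_eq_zero_of_notMem hyP]
      exact Even.zero
  obtain ⟨f, hf, hf0⟩ := Submodule.exists_mem_ne_zero_of_ne_bot hO.orderConductor_ne_bot
  have hnle : ¬ P.asIdeal ≤ P.asIdeal ^ 2 := by
    rw [← le_ordAt_iff P P.ne_bot, ordAt_self]
    lia
  obtain ⟨t, ht, ht2⟩ := SetLike.not_le_iff_exists.1 hnle
  have ht0 : t ≠ 0 := fun h => ht2 (h ▸ zero_mem _)
  have htord : ordAt P (Ideal.span {t}) = 1 := by
    have := (mem_iff_ordAt_pos P ht0).1 ht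
    rw [mem_pow_iff_le_ordAt P ht0] at ht2
    lia
  have h1 := heven _ ⟨f, mem_of_mem_orderConductor hf⟩ (fun h => hf0 (congrArg Subtype.val h)) rfl
  have h2 := heven _ ⟨f * t, hf t⟩ (fun h => mul_ne_zero hf0 ht0 (congrArg Subtype.val h)) rfl
  change Even (ordAt P (Ideal.span {f})) at h1
  change Even (ordAt P (Ideal.span {f * t})) at h2
  rw [ordAt_span_mul P hf0 ht0, htord, Nat.even_add_one] at h2
  exact h2 h1

theorem mulUnitsEqAll (hO : IsOrder O)
    (hSF : ∀ P Q : HeightOneSpectrum R,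
      P.asIdeal.comap O.subtype = Q.asIdeal.comap O.subtype → P = Q)
    (hgen : ∀ r : R, IsCoprime (Ideal.span {r}) (orderConductor O) →
      GeneratedIn O (Ideal.span {r}))
    (hval : ∀ (P : HeightOneSpectrum R) (y : O), IsLocallyIrreducible O P y →
      ordAt P (Ideal.span {(y : R)}) = 1 ∨ ordAt P (Ideal.span {(y : R)}) = 2) :
    MulUnitsEqAll O := by
  intro r
  by_cases hr : r = 0
  · exact ⟨0, 1, by simp [hr]⟩
  choose t ht0 ht using exists_ordAt_eq_one hO hval
  obtain ⟨η, hη, -⟩ := exists_unit_mul_mem hO hSF hgen hr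
    (fun P => t P ^ ordAt P (Ideal.span {r})) (fun P _ => pow_ne_zero _ (ht0 P))
    (fun P _ => by rw [Subring.coe_pow, ← Ideal.span_singleton_pow, ordAt_pow, ht, mul_one])
  exact ⟨⟨r * η, hη⟩, η⁻¹, by simp⟩

lemma generatedIn_of_mulUnitsEqAll (h : MulUnitsEqAll O) (r : R) :
    GeneratedIn O (Ideal.span {r}) := by
  obtain ⟨a, e, rfl⟩ := h r
  exact ⟨a, a.2, Ideal.span_singleton_mul_right_unit e.isUnit _⟩

end Translate

/-! ### Factorizations in `O` from local factorizations -/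

section Splitting

variable {R : Type u} [CommRing R] [IsDedekindDomain R] {O : Subring R}

/-- The element `a` of `O` has, in the localization of `O` at `P ∩ O`, a divisor of
exponent `k`. -/
def SplitsAt (P : HeightOneSpectrum R) (a : O) (k : ℕ) : Prop :=
  ∃ y z s : O, (s : R) ∉ P.asIdeal ∧ s * a = y * z ∧ ordAt P (Ideal.span {(y : R)}) = k

lemma splitsAt_zero (P : HeightOneSpectrum R) (a : O) : SplitsAt P a 0 :=
  ⟨1, a, 1, one_notMem P, rfl, ordAt_eq_zero_of_notMem (one_notMem P)⟩

lemma SplitsAt.of_mul_eq {P : HeightOneSpectrum R} {a y z s : O} (ha : a ≠ 0)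
    (hs : (s : R) ∉ P.asIdeal) (h : s * a = y * z) {k : ℕ} (hz : SplitsAt P z k) :
    SplitsAt P a (ordAt P (Ideal.span {(y : R)}) + k) := by
  have hs0 : s ≠ 0 := fun h => hs (h ▸ zero_mem _)
  have hyz : y * z ≠ 0 := h ▸ mul_ne_zero hs0 ha
  obtain ⟨y', z', s', hs', h', rfl⟩ := hz
  have hs0' : s' ≠ 0 := fun h => hs' (h ▸ zero_mem _)
  have hyz' : y' * z' ≠ 0 := h' ▸ mul_ne_zero hs0' (right_ne_zero_of_mul hyz)
  refine ⟨y * y', z', s' * s, fun hm => ?_, by linear_combination s' * h + y * h', ?_⟩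
  · exact (P.isPrime.mem_or_mem hm).elim hs' hs
  · rw [Subring.coe_mul, ordAt_span_mul P (coe_ne_zero_of_ne_zero (left_ne_zero_of_mul hyz))
      (coe_ne_zero_of_ne_zero (left_ne_zero_of_mul hyz'))]

lemma ordAt_eq_add_of_mul_eq {P : HeightOneSpectrum R} {a y z s : O} (ha : a ≠ 0)
    (hs : (s : R) ∉ P.asIdeal) (h : s * a = y * z) :
    z ≠ 0 ∧ ordAt P (Ideal.span {(a : R)}) =
      ordAt P (Ideal.span {(y : R)}) + ordAt P (Ideal.span {(z : R)}) := by
  have hs0 : s ≠ 0 := fun h => hs (h ▸ zero_mem _)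
  have hyz : y * z ≠ 0 := h ▸ mul_ne_zero hs0 ha
  have h1 := ordAt_eq_of_mul_eq (P := P) (coe_ne_zero_of_ne_zero ha)
    (coe_ne_zero_of_ne_zero hyz) hs (one_notMem (O := O) P)
    (by rw [← Subring.coe_mul, h, ← Subring.coe_mul, one_mul])
  rw [h1, Subring.coe_mul, ordAt_span_mul P (coe_ne_zero_of_ne_zero (left_ne_zero_of_mul hyz))
    (coe_ne_zero_of_ne_zero (right_ne_zero_of_mul hyz))]
  exact ⟨right_ne_zero_of_mul hyz, rfl⟩

lemma splitsAt_of_le {P : HeightOneSpectrum R}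
    (hval : ∀ y : O, IsLocallyIrreducible O P y → ordAt P (Ideal.span {(y : R)}) = 1) (k : ℕ)
    {a : O} (ha : a ≠ 0) (hk : k ≤ ordAt P (Ideal.span {(a : R)})) : SplitsAt P a k := by
  induction k generalizing a with
  | zero => exact splitsAt_zero P a
  | succ k ih =>
    obtain ⟨u, z, s, hu, hs, h⟩ := exists_isLocallyIrreducible_dvd P ha
      ((mem_iff_ordAt_pos P (coe_ne_zero_of_ne_zero ha)).2 (by lia))
    obtain ⟨hz0, hord⟩ := ordAt_eq_add_of_mul_eq ha hs h
    rw [hval u hu] at hord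
    have := SplitsAt.of_mul_eq ha hs h (ih hz0 (by lia))
    rwa [hval u hu, add_comm] at this

variable (hO : IsOrder O)
  (hSF : ∀ P Q : HeightOneSpectrum R,
    P.asIdeal.comap O.subtype = Q.asIdeal.comap O.subtype → P = Q)
  (hU : MulUnitsEqAll O)
include hO hSF hU

/-- A factorization of `a ∈ O` in `R` can be moved by a unit of `R` into `O`, provided this is
possible locally. -/
theorem exists_unit_mul_mem_and_mul_mem {a : O} {b c : R} (ha : a ≠ 0) (h : (a : R) = b * c)
    (hs : ∀ P : HeightOneSpectrum R, SplitsAt P a (ordAt P (Ideal.span {b}))) :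
    ∃ η : Rˣ, b * η ∈ O ∧ c * (η⁻¹ : Rˣ) ∈ O := by
  have hb : b ≠ 0 := by
    rintro rfl
    rw [zero_mul] at h
    exact coe_ne_zero_of_ne_zero ha h
  choose y z s hsP hsy hy using hs
  have hy0 : ∀ P, y P ≠ 0 := by
    intro P h0
    have h1 := hsy P
    rw [h0, zero_mul] at h1
    exact mul_ne_zero (fun h => hsP P (by rw [h]; exact P.asIdeal.zero_mem)) ha h1
  obtain ⟨η, hη, hloc⟩ := exists_unit_mul_mem hO hSF
    (fun r _ => generatedIn_of_mulUnitsEqAll hU r) hb y (fun P _ => hy0 P) (fun P _ => hy P)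
  refine ⟨η, hη, hO.mem_of_forall_exists_mul_mem fun P hP => ?_⟩
  obtain ⟨s', w, hs', hw, hsw⟩ := hloc P hP
  refine ⟨w * s P, O.mul_mem w.2 (s P).2, fun hm => ?_, ?_⟩
  · exact (P.isPrime.mem_or_mem hm).elim hw (hsP P)
  have h1 : (w : R) * s P * (c * (η⁻¹ : Rˣ)) = s' * z P := by
    have h2 : (s P : R) * a = y P * z P := congrArg Subtype.val (hsy P)
    have h3 : (s' : R) * (b * η) = w * y P := congrArg Subtype.val hsw
    refine mul_left_cancel₀ (mul_ne_zero hb η.ne_zero) ?_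
    calc b * η * ((w : R) * s P * (c * (η⁻¹ : Rˣ)))
        = w * (s P * (b * c)) * (η * (η⁻¹ : Rˣ)) := by ring
      _ = w * (s P * a) := by rw [Units.mul_inv, mul_one, h]
      _ = b * η * (s' * z P) := by linear_combination (w : R) * h2 - (z P : R) * h3
  rw [h1]
  exact O.mul_mem s'.2 (z P).2

/-- If all locally irreducible elements have exponent `1`, then factorizations in `R` lift
to `O`. -/
theorem isTransferHom_orderInclusion
    (hval : ∀ (P : HeightOneSpectrum R) (y : O), IsLocallyIrreducible O P y →
      ordAt P (Ideal.span {(y : R)}) = 1) : IsTransferHom (orderInclusion O) where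
  surj b := by
    obtain ⟨a, e, h⟩ := hU b
    have ha : a ≠ 0 := by
      rintro rfl
      rw [Subring.coe_zero, zero_mul] at h
      exact nonZeroDivisors.coe_ne_zero b h
    have he : IsUnit (toNonZero (e : R) e.ne_zero) :=
      (isUnit_nonZeroDivisors_iff _).2 e.isUnit
    exact ⟨⟨a, mem_nonZeroDivisors_of_ne_zero ha⟩, he.unit, Subtype.ext h⟩
  isUnit_iff a := by
    rw [isUnit_nonZeroDivisors_iff, isUnit_nonZeroDivisors_iff, coe_orderInclusion,
      hO.isUnit_coe_iff]
  transfer a b c habc := by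
    have ha := nonZeroDivisors.coe_ne_zero a
    have hbc : (((a : O) : R)) = (b : R) * c := congrArg Subtype.val habc
    have hb0 := nonZeroDivisors.coe_ne_zero b
    have hc0 := nonZeroDivisors.coe_ne_zero c
    obtain ⟨η, hb, hc⟩ := exists_unit_mul_mem_and_mul_mem hO hSF hU ha hbc fun P =>
      splitsAt_of_le (hval P) _ ha (by
        rw [hbc, ordAt_span_mul P hb0 hc0]
        exact Nat.le_add_right _ _)
    have hne : ∀ (x : R) (e : Rˣ) (h : x * e ∈ O), x ≠ 0 → (⟨x * e, h⟩ : O) ≠ 0 :=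
      fun x e h hx h0 => mul_ne_zero hx e.ne_zero (congrArg Subtype.val h0)
    have hη : ∀ e : Rˣ, IsUnit (toNonZero (e : R) e.ne_zero) :=
      fun e => (isUnit_nonZeroDivisors_iff _).2 e.isUnit
    refine ⟨⟨_, mem_nonZeroDivisors_of_ne_zero (hne b η hb hb0)⟩,
      ⟨_, mem_nonZeroDivisors_of_ne_zero (hne c η⁻¹ hc hc0)⟩, ?_, ?_, ?_⟩
    · refine Subtype.ext (Subtype.ext ?_)
      change (a : R) = b * η * (c * (η⁻¹ : Rˣ))
      rw [hbc, mul_mul_mul_comm, Units.mul_inv, mul_one]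
    · exact associated_mul_unit_left b _ (hη η)
    · exact associated_mul_unit_left c _ (hη η⁻¹)

end Splitting

/-! ### The block homomorphism of a Dedekind domain -/

section Block

variable {R : Type u} [CommRing R] [IsDedekindDomain R]

lemma Multiset.exists_add_of_map_eq_add {α β : Type*} {f : α → β} {s : Multiset α}
    {t₁ t₂ : Multiset β} (h : s.map f = t₁ + t₂) :
    ∃ s₁ s₂, s = s₁ + s₂ ∧ s₁.map f = t₁ ∧ s₂.map f = t₂ := by
  classical
  induction t₁ using Multiset.induction_on generalizing s with
  | empty => exact ⟨0, s, by simp, rfl, by simpa using h⟩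
  | cons a t₁ ih =>
    rw [Multiset.cons_add, ← Multiset.map_eq_cons] at h
    obtain ⟨x, hx, rfl, h⟩ := h
    obtain ⟨s₁, s₂, h', h₁, h₂⟩ := ih h
    refine ⟨x ::ₘ s₁, s₂, ?_, by rw [Multiset.map_cons, h₁], h₂⟩
    rw [Multiset.cons_add, ← h', Multiset.cons_erase hx]

/-- The multiset of the classes of the prime ideals in the factorization of `I`. -/
noncomputable def classMultiset (I : Ideal R) : Multiset (Additive (ClassGroup R)) :=
  (normalizedFactors I).map fun Q => Additive.ofMul (idealClass Q)

lemma classMultiset_mul {I J : Ideal R} (hI : I ≠ ⊥) (hJ : J ≠ ⊥) :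
    classMultiset (I * J) = classMultiset I + classMultiset J := by
  rw [classMultiset, normalizedFactors_mul hI hJ, Multiset.map_add]
  rfl

lemma sum_map_idealClass (s : Multiset (Ideal R)) (h : ∀ Q ∈ s, Q ≠ ⊥) :
    (s.map fun Q => Additive.ofMul (idealClass Q)).sum = Additive.ofMul (idealClass s.prod) := by
  induction s using Multiset.induction_on with
  | empty =>
    simp only [Multiset.map_zero, Multiset.sum_zero, Multiset.prod_zero, Ideal.one_eq_top,
      idealClass_top]
    rfl
  | cons Q s ih =>
    have hs : ∀ Q ∈ s, Q ≠ ⊥ := fun Q' hQ' => h Q' (Multiset.mem_cons_of_mem hQ')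
    rw [Multiset.map_cons, Multiset.sum_cons, ih hs, Multiset.prod_cons,
      idealClass_mul (h Q (Multiset.mem_cons_self Q s))
        (Multiset.prod_ne_zero fun h0 => hs _ h0 rfl)]
    rfl

lemma prod_normalizedFactors_ideal {I : Ideal R} (hI : I ≠ ⊥) : (normalizedFactors I).prod = I :=
  associated_iff_eq.1 (prod_normalizedFactors hI)

lemma sum_classMultiset {I : Ideal R} (hI : I ≠ ⊥) :
    (classMultiset I).sum = Additive.ofMul (idealClass I) := by
  rw [classMultiset, sum_map_idealClass, prod_normalizedFactors_ideal hI]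
  intro Q hQ
  exact (prime_of_normalized_factor Q hQ).ne_zero

lemma classMultiset_prod {s : Multiset (Ideal R)} (h : ∀ Q ∈ s, Prime Q) :
    classMultiset s.prod = s.map fun Q => Additive.ofMul (idealClass Q) := by
  rw [classMultiset, normalizedFactors_prod_of_prime h]

variable (R) in
/-- The homomorphism that maps an element of a Dedekind domain to the zero-sum sequence of the
classes of its prime ideals. -/
noncomputable def blockHom : R⁰ →* zeroSumMonoid (Additive (ClassGroup R)) where
  toFun r := ⟨Multiplicative.ofAdd (classMultiset (Ideal.span {(r : R)})), by
    have hr := nonZeroDivisors.coe_ne_zero r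
    change (classMultiset (Ideal.span {(r : R)})).sum = 0
    rw [sum_classMultiset (span_singleton_ne_bot hr), idealClass_span hr]
    rfl⟩
  map_one' := by
    refine Subtype.ext ?_
    change Multiplicative.ofAdd (classMultiset (Ideal.span {(1 : R)})) = _
    rw [Ideal.span_singleton_one, ← Ideal.one_eq_top, classMultiset, normalizedFactors_one]
    rfl
  map_mul' r s := by
    refine Subtype.ext ?_
    change Multiplicative.ofAdd (classMultiset (Ideal.span {(r : R) * s})) = _
    rw [span_singleton_mul_eq, classMultiset_mul
      (span_singleton_ne_bot (nonZeroDivisors.coe_ne_zero r))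
      (span_singleton_ne_bot (nonZeroDivisors.coe_ne_zero s))]
    rfl

lemma blockHom_eq_iff {r : R⁰} {b : zeroSumMonoid (Additive (ClassGroup R))} :
    blockHom R r = b ↔ classMultiset (Ideal.span {(r : R)}) = b.1.toAdd :=
  ⟨fun h => h ▸ rfl, fun h => Subtype.ext h⟩

/-- A multiset of prime ideals whose classes form a zero-sum sequence is the factorization of an
element of `R`. -/
lemma exists_span_eq_prod {s : Multiset (Ideal R)} (hs : ∀ Q ∈ s, Prime Q)
    (h : (s.map fun Q => Additive.ofMul (idealClass Q)).sum = 0) :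
    ∃ r : R⁰, s.prod = Ideal.span {(r : R)} := by
  have hs0 : s.prod ≠ ⊥ := Multiset.prod_ne_zero fun h0 => (hs _ h0).ne_zero rfl
  rw [sum_map_idealClass s fun Q hQ => (hs Q hQ).ne_zero] at h
  obtain ⟨r, hr⟩ := (idealClass_eq_one_iff hs0).1 h
  refine ⟨toNonZero r ?_, hr⟩
  rintro rfl
  rw [hr] at hs0
  simp at hs0

/-- If every class contains a prime ideal, then the block homomorphism is a transfer
homomorphism. -/
theorem isTransferHom_blockHom
    (h : ∀ c : ClassGroup R, ∃ P : HeightOneSpectrum R, idealClass P.asIdeal = c) :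
    IsTransferHom (blockHom R) where
  surj b := by
    choose P hP using h
    let s : Multiset (Ideal R) := b.1.toAdd.map fun g => (P g.toMul).asIdeal
    have hs : ∀ Q ∈ s, Prime Q := by
      intro Q hQ
      obtain ⟨g, -, rfl⟩ := Multiset.mem_map.1 hQ
      exact (P _).prime
    have hmap : (s.map fun Q => Additive.ofMul (idealClass Q)) = b.1.toAdd := by
      simp only [s, Multiset.map_map, Function.comp_def, hP]
      simp
    obtain ⟨r, hr⟩ := exists_span_eq_prod hs (hmap ▸ b.2)
    refine ⟨r, 1, ?_⟩
    rw [Units.val_one, mul_one, eq_comm, blockHom_eq_iff, ← hr, classMultiset_prod hs, hmap]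
  isUnit_iff r := by
    refine ⟨fun hu => ?_, fun hu => hu.map _⟩
    obtain ⟨b, hb⟩ := hu.exists_right_inv
    have hr := span_singleton_ne_bot (nonZeroDivisors.coe_ne_zero r)
    have h1 : classMultiset (Ideal.span {(r : R)}) + b.1.toAdd = 0 :=
      congrArg (fun z => z.1.toAdd) hb
    have h2 := congrArg Multiset.card h1
    rw [Multiset.card_add, Multiset.card_zero, Nat.add_eq_zero_iff, classMultiset,
      Multiset.card_map] at h2
    rw [isUnit_nonZeroDivisors_iff, ← Ideal.span_singleton_eq_top, ← numPrimes_eq_zero_iff hr]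
    exact h2.1
  transfer r b c hbc := by
    have hr := span_singleton_ne_bot (nonZeroDivisors.coe_ne_zero r)
    rw [blockHom_eq_iff] at hbc
    obtain ⟨s₁, s₂, hs, h₁, h₂⟩ := Multiset.exists_add_of_map_eq_add hbc
    have hp : ∀ Q ∈ s₁ + s₂, Prime Q := fun Q hQ => prime_of_normalized_factor Q (hs ▸ hQ)
    have hp₁ : ∀ Q ∈ s₁, Prime Q := fun Q hQ => hp Q (Multiset.mem_add.2 (Or.inl hQ))
    have hp₂ : ∀ Q ∈ s₂, Prime Q := fun Q hQ => hp Q (Multiset.mem_add.2 (Or.inr hQ))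
    obtain ⟨v, hv⟩ := exists_span_eq_prod hp₁ (h₁ ▸ b.2)
    obtain ⟨w, hw⟩ := exists_span_eq_prod hp₂ (h₂ ▸ c.2)
    have hvw : Associated ((v : R) * w) r := by
      rw [← Ideal.span_singleton_eq_span_singleton, span_singleton_mul_eq, ← hv, ← hw,
        ← Multiset.prod_add, ← hs, prod_normalizedFactors_ideal hr]
    obtain ⟨e, he⟩ := hvw
    have hspan : Ideal.span {(w : R) * e} = Ideal.span {(w : R)} :=
      Ideal.span_singleton_mul_right_unit e.isUnit _
    refine ⟨v, w * toNonZero (e : R) e.ne_zero, Subtype.ext ?_, Associated.of_eq ?_,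
      Associated.of_eq ?_⟩
    · rw [← he, mul_assoc]
      rfl
    · rw [blockHom_eq_iff, ← hv, classMultiset_prod hp₁, h₁]
    · rw [blockHom_eq_iff]
      change classMultiset (Ideal.span {(w : R) * e}) = _
      rw [hspan, ← hw, classMultiset_prod hp₂, h₂]

end Block

/-! ### Class groups with two elements -/

section TwoClasses

variable {R : Type u} [CommRing R] [IsDedekindDomain R]

open Classical in
/-- The number of prime ideals in the factorization of `I`, where principal ones are counted
twice. -/
noncomputable def weight (I : Ideal R) : ℕ :=
  ((normalizedFactors I).map fun Q => if idealClass Q = 1 then 2 else 1).sum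

lemma weight_mul {I J : Ideal R} (hI : I ≠ ⊥) (hJ : J ≠ ⊥) :
    weight (I * J) = weight I + weight J := by
  rw [weight, normalizedFactors_mul hI hJ, Multiset.map_add, Multiset.sum_add]
  rfl

lemma weight_top : weight (⊤ : Ideal R) = 0 := by
  rw [weight, ← Ideal.one_eq_top, normalizedFactors_one]
  rfl

open Classical in
lemma weight_self (P : HeightOneSpectrum R) :
    weight P.asIdeal = if idealClass P.asIdeal = 1 then 2 else 1 := by
  rw [weight, normalizedFactors_irreducible P.irreducible, normalize_eq, Multiset.map_singleton,
    Multiset.sum_singleton]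

lemma weight_eq_zero_iff {I : Ideal R} (hI : I ≠ ⊥) : weight I = 0 ↔ I = ⊤ := by
  refine ⟨fun h => ?_, fun h => h ▸ weight_top⟩
  by_contra hne
  obtain ⟨P, J, rfl⟩ := exists_eq_mul_of_ne_top hI hne
  rw [weight_mul P.ne_bot (right_ne_zero_of_mul hI), weight_self] at h
  split_ifs at h <;> lia

/-- For class groups with two elements, the weight determines the class. -/
lemma even_weight_iff (htwo : ∀ c d : ClassGroup R, c ≠ 1 → d ≠ 1 → c * d = 1) {I : Ideal R}
    (hI : I ≠ ⊥) : Even (weight I) ↔ idealClass I = 1 := by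
  induction hn : numPrimes I using Nat.strong_induction_on generalizing I with
  | _ n ih =>
  subst hn
  by_cases hI1 : I = ⊤
  · rw [hI1, weight_top, idealClass_top]
    simp
  obtain ⟨P, J, rfl⟩ := exists_eq_mul_of_ne_top hI hI1
  have hJ : J ≠ ⊥ := right_ne_zero_of_mul hI
  have h1 := ih (numPrimes J)
    (by rw [numPrimes_mul P.ne_bot hJ, numPrimes_self]; lia) hJ rfl
  rw [weight_mul P.ne_bot hJ, weight_self, idealClass_mul P.ne_bot hJ, Nat.even_add, h1]
  split_ifs with hP
  · simp [hP]
  · by_cases hc : idealClass J = 1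
    · simp [hP, hc]
    · simp [hc, htwo _ _ hP hc]

variable {O : Subring R}

/-- Let `l` be an additive function on `H` that vanishes only on units. If every non-unit is
divisible by an element of value `1`, then mapping `a` to `X ^ l a` is a transfer homomorphism to
the Krull monoid of non-zero power series over any field. -/
theorem isTransferKrull_of_length {H K : Type u} [CommMonoid H] [Field K] (l : H → ℕ)
    (hl1 : l 1 = 0) (hmul : ∀ a b, l (a * b) = l a + l b) (hunit : ∀ a, l a = 0 → IsUnit a)
    (hne : ∃ a, l a = 1) (hdvd : ∀ a, l a ≠ 0 → ∃ v w, a = v * w ∧ l v = 1) :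
    IsTransferKrull H := by
  have hX : (PowerSeries.X : PowerSeries K) ≠ 0 := PowerSeries.X_ne_zero
  have hXirr : Irreducible (PowerSeries.X : PowerSeries K) := PowerSeries.X_prime.irreducible
  let θ : H →* (PowerSeries K)⁰ :=
    { toFun a := toNonZero PowerSeries.X hX ^ l a
      map_one' := by rw [hl1, pow_zero]
      map_mul' a b := by rw [hmul, pow_add] }
  have hassoc : ∀ b : (PowerSeries K)⁰, ∃ n : ℕ, Associated (toNonZero PowerSeries.X hX ^ n) b := by
    intro b
    obtain ⟨n, e, he⟩ := IsDiscreteValuationRing.associated_pow_irreducible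
      (nonZeroDivisors.coe_ne_zero b) hXirr
    have hu : IsUnit (toNonZero (e : PowerSeries K) e.ne_zero) :=
      (isUnit_nonZeroDivisors_iff _).2 e.isUnit
    refine ⟨n, Associated.symm ⟨hu.unit, Subtype.ext he⟩⟩
  have hXnu : ¬ IsUnit (toNonZero (PowerSeries.X : PowerSeries K) hX) := by
    rw [isUnit_nonZeroDivisors_iff]
    exact hXirr.not_isUnit
  have hinj : ∀ m n : ℕ, Associated (toNonZero (PowerSeries.X : PowerSeries K) hX ^ m)
      (toNonZero PowerSeries.X hX ^ n) → m = n := by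
    rintro m n ⟨e, he⟩
    have h1 : Associated ((PowerSeries.X : PowerSeries K) ^ m) (PowerSeries.X ^ n) :=
      ⟨e.map (PowerSeries K)⁰.subtype, congrArg Subtype.val he⟩
    exact le_antisymm ((pow_dvd_pow_iff hX hXirr.not_isUnit).1 h1.dvd)
      ((pow_dvd_pow_iff hX hXirr.not_isUnit).1 h1.symm.dvd)
  have hsplit : ∀ (m : ℕ) (a : H), m ≤ l a → ∃ v w, a = v * w ∧ l v = m := by
    intro m
    induction m with
    | zero => exact fun a _ => ⟨1, a, (one_mul a).symm, hl1⟩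
    | succ m ih =>
      intro a ha
      obtain ⟨v, w, rfl, hv⟩ := hdvd a (by lia)
      rw [hmul, hv] at ha
      obtain ⟨v', w', rfl, hv'⟩ := ih w (by lia)
      exact ⟨v * v', w', (mul_assoc _ _ _).symm, by rw [hmul, hv, hv', add_comm]⟩
  refine ⟨(PowerSeries K)⁰, nonZeroDivisorsCancelCommMonoid _, θ,
    isKrullMonoid_nonZeroDivisors _, ?_, ?_, ?_⟩
  · intro b
    obtain ⟨n, e, he⟩ := hassoc b
    obtain ⟨a, ha⟩ := hne
    refine ⟨a ^ n, e, ?_⟩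
    rw [map_pow]
    change b = (toNonZero PowerSeries.X hX ^ l a) ^ n * e
    rw [ha, pow_one, he]
  · intro a
    refine ⟨fun h => ?_, fun h => h.map θ⟩
    by_contra hna
    exact hXnu ((isUnit_pow_iff (fun h0 => hna (hunit a h0))).1 h)
  · intro a b c habc
    obtain ⟨m, hm⟩ := hassoc b
    obtain ⟨n, hn⟩ := hassoc c
    have h1 : l a = m + n := hinj _ _ (by
      rw [pow_add]
      exact (Associated.of_eq habc).trans (hm.mul_mul hn).symm)
    obtain ⟨v, w, rfl, hv⟩ := hsplit m a (by lia)
    rw [hmul, hv] at h1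
    refine ⟨v, w, rfl, ?_, ?_⟩
    · change Associated (toNonZero PowerSeries.X hX ^ l v) b
      rwa [hv]
    · change Associated (toNonZero PowerSeries.X hX ^ l w) c
      rwa [Nat.add_left_cancel h1]

lemma weight_mul_eq_two (htwo : ∀ c d : ClassGroup R, c ≠ 1 → d ≠ 1 → c * d = 1)
    {P Q : HeightOneSpectrum R} (hP : idealClass P.asIdeal ≠ 1) (hQ : idealClass Q.asIdeal ≠ 1) :
    weight (P.asIdeal * Q.asIdeal) = 2 ∧ ∃ b, P.asIdeal * Q.asIdeal = Ideal.span {b} := by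
  refine ⟨?_, (idealClass_eq_one_iff (mul_ne_zero P.ne_bot Q.ne_bot)).1 ?_⟩
  · rw [weight_mul P.ne_bot Q.ne_bot, weight_self, weight_self, if_neg hP, if_neg hQ]
  · rw [idealClass_mul P.ne_bot Q.ne_bot, htwo _ _ hP hQ]

/-- If the class group has two elements, and exponents of locally irreducible elements are `1` or
`2`, then each non-unit of `O` is divisible by an element of `O` of weight `2`. It generates a
principal prime ideal, the square of a prime ideal or a product of two prime ideals. -/
lemma exists_eq_mul_weight_eq_two (hO : IsOrder O)
    (hSF : ∀ P Q : HeightOneSpectrum R,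
      P.asIdeal.comap O.subtype = Q.asIdeal.comap O.subtype → P = Q)
    (hU : MulUnitsEqAll O) (htwo : ∀ c d : ClassGroup R, c ≠ 1 → d ≠ 1 → c * d = 1)
    (hval : ∀ (P : HeightOneSpectrum R) (y : O), IsLocallyIrreducible O P y →
      ordAt P (Ideal.span {(y : R)}) = 1 ∨ ordAt P (Ideal.span {(y : R)}) = 2)
    (hval1 : ∀ (P : HeightOneSpectrum R) (y : O), idealClass P.asIdeal = 1 →
      IsLocallyIrreducible O P y → ordAt P (Ideal.span {(y : R)}) = 1)
    {a : O} (ha : a ≠ 0) (hau : ¬ IsUnit a) :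
    ∃ v w : O, a = v * w ∧ weight (Ideal.span {(v : R)}) = 2 := by
  have ha0 := coe_ne_zero_of_ne_zero ha
  have hspan := span_singleton_ne_bot ha0
  -- it suffices to find a principal divisor of weight `2` that splits off locally
  have key : ∀ I : Ideal R, I ∣ Ideal.span {(a : R)} → (∃ b, I = Ideal.span {b}) →
      weight I = 2 → (∀ P : HeightOneSpectrum R, SplitsAt P a (ordAt P I)) →
      ∃ v w : O, a = v * w ∧ weight (Ideal.span {(v : R)}) = 2 := by
    rintro I hI ⟨b, rfl⟩ hw hs
    rw [Ideal.dvd_span_singleton, Ideal.mem_span_singleton'] at hI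
    obtain ⟨c, hc⟩ := hI
    obtain ⟨η, hb, hc'⟩ := exists_unit_mul_mem_and_mul_mem hO hSF hU ha
      (by rw [← hc, mul_comm] : (a : R) = b * c) hs
    refine ⟨⟨_, hb⟩, ⟨_, hc'⟩, Subtype.ext ?_, ?_⟩
    · change (a : R) = b * η * (c * (η⁻¹ : Rˣ))
      rw [mul_mul_mul_comm, Units.mul_inv, mul_one, ← hc, mul_comm]
    · rwa [Ideal.span_singleton_mul_right_unit η.isUnit]
  have hane : Ideal.span {(a : R)} ≠ ⊤ := hO.span_ne_top hau
  by_cases hpr : ∃ P : HeightOneSpectrum R, (a : R) ∈ P.asIdeal ∧ idealClass P.asIdeal = 1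
  · obtain ⟨P, haP, hP⟩ := hpr
    refine key P.asIdeal (Ideal.dvd_span_singleton.2 haP) ((idealClass_eq_one_iff P.ne_bot).1 hP)
      (by rw [weight_self, if_pos hP]) fun Q => ?_
    by_cases hQ : Q = P
    · rw [hQ]
      refine splitsAt_of_le (fun y => hval1 P y hP) _ ha ?_
      rw [ordAt_self]
      exact (mem_iff_ordAt_pos P ha0).1 haP
    · rw [ordAt_of_ne hQ]
      exact splitsAt_zero Q a
  push Not at hpr
  obtain ⟨P, J, hPJ⟩ := exists_eq_mul_of_ne_top hspan hane
  have hJ0 : J ≠ ⊥ := right_ne_zero_of_mul (hPJ ▸ hspan)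
  have haP : (a : R) ∈ P.asIdeal := by
    rw [mem_iff_span_le, hPJ]
    exact Ideal.mul_le_left
  have hP := hpr P haP
  have hJ1 : J ≠ ⊤ := by
    rintro rfl
    rw [Ideal.mul_top] at hPJ
    exact hP (hPJ ▸ idealClass_span ha0)
  obtain ⟨Q, J', rfl⟩ := exists_eq_mul_of_ne_top hJ0 hJ1
  have haQ : (a : R) ∈ Q.asIdeal := by
    rw [mem_iff_span_le, hPJ, mul_left_comm]
    exact Ideal.mul_le_left
  have hQ := hpr Q haQ
  have hPQ : P.asIdeal * Q.asIdeal ∣ Ideal.span {(a : R)} := by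
    rw [hPJ, ← mul_assoc]
    exact Dvd.intro _ rfl
  have hloc : ∀ S : HeightOneSpectrum R, (a : R) ∈ S.asIdeal → SplitsAt S a 2 ∨
      (SplitsAt S a 1 ∧ ordAt S (Ideal.span {(a : R)}) = 1) := by
    intro S haS
    obtain ⟨u, z, s, hu, hs, h⟩ := exists_isLocallyIrreducible_dvd S ha haS
    rcases hval S u hu with hu1 | hu2
    swap
    · exact Or.inl ⟨u, z, s, hs, h, hu2⟩
    obtain ⟨hz0, hord⟩ := ordAt_eq_add_of_mul_eq ha hs h
    by_cases hzS : (z : R) ∈ S.asIdeal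
    · left
      obtain ⟨u', z', s', hu', hs', h'⟩ := exists_isLocallyIrreducible_dvd S hz0 hzS
      rcases hval S u' hu' with hu1' | hu2'
      · have := SplitsAt.of_mul_eq ha hs h ⟨u', z', s', hs', h', hu1'⟩
        rwa [hu1] at this
      · refine ⟨u', u * z', s' * s, fun hm => ?_, by linear_combination s' * h + u * h', hu2'⟩
        exact (S.isPrime.mem_or_mem hm).elim hs' hs
    · right
      rw [hord, ordAt_eq_zero_of_notMem hzS, hu1]
      exact ⟨⟨u, z, s, hs, h, hu1⟩, rfl⟩
  by_cases hsq : ∃ S : HeightOneSpectrum R, (a : R) ∈ S.asIdeal ∧ SplitsAt S a 2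
  · obtain ⟨S, haS, hS⟩ := hsq
    obtain ⟨hw, hb⟩ := weight_mul_eq_two htwo (hpr S haS) (hpr S haS)
    refine key _ ?_ hb hw fun T => ?_
    · obtain ⟨y, z, s, hs, h, hy⟩ := hS
      have := ordAt_eq_add_of_mul_eq ha hs h
      rw [Ideal.dvd_span_singleton, ← pow_two, mem_pow_iff_le_ordAt S ha0]
      lia
    · by_cases hT : T = S
      · rw [hT, ordAt_mul S S.ne_bot S.ne_bot, ordAt_self]
        exact hS
      · rw [ordAt_mul T S.ne_bot S.ne_bot, ordAt_of_ne hT]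
        exact splitsAt_zero T a
  · push Not at hsq
    obtain ⟨hsP, hordP⟩ := (hloc P haP).resolve_left (hsq P haP)
    obtain ⟨hsQ, -⟩ := (hloc Q haQ).resolve_left (hsq Q haQ)
    have hne : P ≠ Q := by
      rintro rfl
      have := (mem_pow_iff_le_ordAt P ha0 2).1 (by rwa [pow_two, ← Ideal.dvd_span_singleton])
      lia
    obtain ⟨hw, hb⟩ := weight_mul_eq_two htwo hP hQ
    refine key _ hPQ hb hw fun T => ?_
    rw [ordAt_mul T P.ne_bot Q.ne_bot]
    by_cases hTP : T = P
    · rw [hTP, ordAt_self, ordAt_of_ne hne]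
      exact hsP
    by_cases hTQ : T = Q
    · rw [hTQ, ordAt_self, ordAt_of_ne hne.symm]
      exact hsQ
    · rw [ordAt_of_ne hTP, ordAt_of_ne hTQ]
      exact splitsAt_zero T a

/-- If the class group has two elements, then half of the weight is a length function on `O⁰`. -/
theorem isTransferKrull_of_two_classes (hO : IsOrder O)
    (hSF : ∀ P Q : HeightOneSpectrum R,
      P.asIdeal.comap O.subtype = Q.asIdeal.comap O.subtype → P = Q)
    (hU : MulUnitsEqAll O) (htwo : ∀ c d : ClassGroup R, c ≠ 1 → d ≠ 1 → c * d = 1)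
    (hP : Nonempty (HeightOneSpectrum R))
    (hval : ∀ (P : HeightOneSpectrum R) (y : O), IsLocallyIrreducible O P y →
      ordAt P (Ideal.span {(y : R)}) = 1 ∨ ordAt P (Ideal.span {(y : R)}) = 2)
    (hval1 : ∀ (P : HeightOneSpectrum R) (y : O), idealClass P.asIdeal = 1 →
      IsLocallyIrreducible O P y → ordAt P (Ideal.span {(y : R)}) = 1) :
    IsTransferKrull O⁰ := by
  have hspan : ∀ a : O⁰, Ideal.span {((a : O) : R)} ≠ ⊥ := fun a =>
    span_singleton_ne_bot (coe_ne_zero_of_ne_zero (nonZeroDivisors.coe_ne_zero a))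
  have heven : ∀ a : O⁰, Even (weight (Ideal.span {((a : O) : R)})) := fun a =>
    (even_weight_iff htwo (hspan a)).2
      (idealClass_span (coe_ne_zero_of_ne_zero (nonZeroDivisors.coe_ne_zero a)))
  have hdvd : ∀ a : O⁰, ¬ IsUnit (a : O) → ∃ v w : O⁰, a = v * w ∧
      weight (Ideal.span {((v : O) : R)}) = 2 := by
    intro a ha
    have ha0 := nonZeroDivisors.coe_ne_zero a
    obtain ⟨v, w, h, hv⟩ := exists_eq_mul_weight_eq_two hO hSF hU htwo hval hval1 ha0 ha
    rw [h] at ha0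
    exact ⟨⟨v, mem_nonZeroDivisors_of_ne_zero (left_ne_zero_of_mul ha0)⟩,
      ⟨w, mem_nonZeroDivisors_of_ne_zero (right_ne_zero_of_mul ha0)⟩, Subtype.ext h, hv⟩
  refine isTransferKrull_of_length (K := FractionRing R)
    (fun a : O⁰ => weight (Ideal.span {((a : O) : R)}) / 2) ?_ ?_ ?_ ?_ ?_
  · change weight (Ideal.span {(1 : R)}) / 2 = 0
    rw [Ideal.span_singleton_one, weight_top]
  · intro a b
    change weight (Ideal.span {((a : O) : R) * (b : O)}) / 2 = _
    rw [span_singleton_mul_eq, weight_mul (hspan a) (hspan b),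
      Nat.add_div_of_dvd_right (heven a).two_dvd]
  · intro a ha
    have h0 : weight (Ideal.span {((a : O) : R)}) = 0 := by
      have := heven a
      grind
    rwa [weight_eq_zero_iff (hspan a), Ideal.span_singleton_eq_top, hO.isUnit_coe_iff,
      ← isUnit_nonZeroDivisors_iff] at h0
  · obtain ⟨P⟩ := hP
    obtain ⟨y, hy0, hyP⟩ := hO.exists_mem_asIdeal P
    obtain ⟨v, -, -, hv⟩ := hdvd ⟨y, mem_nonZeroDivisors_of_ne_zero hy0⟩ fun hu =>
      P.isPrime.ne_top (Ideal.eq_top_of_isUnit_mem _ hyP ((hO.isUnit_coe_iff y).2 hu))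
    exact ⟨v, by rw [hv]⟩
  · intro a ha
    obtain ⟨v, w, h, hv⟩ := hdvd a fun hu => ha (by
      rw [Ideal.span_singleton_eq_top.2 ((hO.isUnit_coe_iff _).2 hu), weight_top])
    exact ⟨v, w, h, by rw [hv]⟩

end TwoClasses

/-! ### Prime ideals in the classes -/

section Classes

lemma mul_eq_one_of_card_eq_two {G : Type*} [CommGroup G] (h : Nat.card G = 2) (c d : G)
    (hc : c ≠ 1) (hd : d ≠ 1) : c * d = 1 := by
  have hcd : c = d := ((Nat.card_eq_two_iff' (1 : G)).1 h).unique hc hd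
  rw [hcd, ← pow_two, ← h, pow_card_eq_one']

lemma exists_ne_of_card_ne_two {G : Type*} [Group G] (h : Nat.card G ≠ 2) (g : G) (hg : g ≠ 1) :
    ∃ x : G, x ≠ 1 ∧ x ≠ g := by
  by_contra! hcon
  exact h ((Nat.card_eq_two_iff' (1 : G)).2 ⟨g, hg, hcon⟩)

variable {R : Type u} [CommRing R] [IsDedekindDomain R] {O : Subring R}

lemma ClassesContainPrimes.exists_idealClass_eq (h : ClassesContainPrimes O) (c : ClassGroup R) :
    ∃ P : HeightOneSpectrum R, IsCoprime P.asIdeal (orderConductor O) ∧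
      idealClass P.asIdeal = c := by
  obtain ⟨P, hP, hc⟩ := h c
  exact ⟨P, hP, (idealClass_eq_mk0 P.ne_bot).trans hc⟩

lemma idealClass_eq_one_of_forall {p : Ideal R → Prop} (hp : ∀ I J, p (I * J) → p I ∧ p J)
    (h : ∀ P : HeightOneSpectrum R, p P.asIdeal → idealClass P.asIdeal = 1) {I : Ideal R}
    (hI0 : I ≠ ⊥) (hI : p I) : idealClass I = 1 := by
  induction hn : numPrimes I using Nat.strong_induction_on generalizing I with
  | _ n ih =>
  subst hn
  by_cases hI1 : I = ⊤
  · rw [hI1, idealClass_top]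
  obtain ⟨P, J, rfl⟩ := exists_eq_mul_of_ne_top hI0 hI1
  have hJ : J ≠ ⊥ := right_ne_zero_of_mul hI0
  rw [idealClass_mul P.ne_bot hJ, h P (hp _ _ hI).1, one_mul]
  exact ih (numPrimes J) (by rw [numPrimes_mul P.ne_bot hJ, numPrimes_self]; lia) hJ
    (hp _ _ hI).2 rfl

lemma exists_idealClass_ne_one [Nontrivial (ClassGroup R)] :
    ∃ P : HeightOneSpectrum R, idealClass P.asIdeal ≠ 1 := by
  by_contra! hcon
  obtain ⟨c, hc⟩ := exists_ne (1 : ClassGroup R)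
  obtain ⟨I, rfl⟩ := ClassGroup.mk0_surjective c
  have hI0 : (I : Ideal R) ≠ ⊥ := nonZeroDivisors.coe_ne_zero I
  refine hc ((idealClass_eq_mk0 hI0).symm.trans ?_)
  exact idealClass_eq_one_of_forall (p := fun _ => True) (fun _ _ _ => ⟨trivial, trivial⟩)
    (fun P _ => hcon P) hI0 trivial

/-- If all prime ideals coprime to the conductor are principal, then so are all other prime
ideals `P`: there is an element of `P \ P ^ 2` that is in no other prime ideal above the
conductor. -/
lemma exists_isCoprime_idealClass_ne_one (hO : IsOrder O) [Nontrivial (ClassGroup R)] :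
    ∃ P : HeightOneSpectrum R, IsCoprime P.asIdeal (orderConductor O) ∧
      idealClass P.asIdeal ≠ 1 := by
  classical
  by_contra! hcon
  obtain ⟨P, hP⟩ := exists_idealClass_ne_one (R := R)
  let T := insert P (finite_setOf_le hO.orderConductor_ne_bot).toFinset
  have hnle : ¬ P.asIdeal ≤ P.asIdeal ^ 2 := by
    rw [← le_ordAt_iff P P.ne_bot, ordAt_self]
    lia
  obtain ⟨t, ht, ht2⟩ := SetLike.not_le_iff_exists.1 hnle
  obtain ⟨x, hx⟩ := IsDedekindDomain.exists_forall_sub_mem_ideal (s := T)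
    (fun Q : HeightOneSpectrum R => Q.asIdeal) (fun _ => 2)
    (fun Q _ => Q.prime) (fun Q _ S _ hne h => hne (HeightOneSpectrum.ext h))
    (fun Q => if Q.1 = P then t else 1)
  have hxP : x - t ∈ P.asIdeal ^ 2 := by
    have := hx P (Finset.mem_insert_self _ _)
    rwa [if_pos rfl] at this
  have hx2 : x ∉ P.asIdeal ^ 2 := fun h => ht2 (by
    have := sub_mem h hxP
    rwa [sub_sub_cancel] at this)
  have hx1 : x ∈ P.asIdeal := by
    have := add_mem (Ideal.pow_le_self two_ne_zero hxP) ht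
    rwa [sub_add_cancel] at this
  have hx0 : x ≠ 0 := fun h => hx2 (h ▸ zero_mem _)
  obtain ⟨J, hJ⟩ := exists_mul_of_le (mem_iff_span_le.1 hx1)
  have hJ0 : J ≠ ⊥ := right_ne_zero_of_mul (hJ ▸ span_singleton_ne_bot hx0)
  have hJreg : IsCoprime J (orderConductor O) := by
    rw [isCoprime_orderConductor_iff hO]
    intro Q hQ hJQ
    by_cases hQP : Q = P
    · rw [hQP] at hJQ
      refine hx2 ?_
      rw [mem_iff_span_le, hJ, pow_two]
      exact Ideal.mul_mono_right hJQ
    · have h1 := hx Q (Finset.mem_insert_of_mem ((Set.Finite.mem_toFinset _).2 hQ))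
      rw [if_neg hQP] at h1
      have h2 : x ∈ Q.asIdeal := by
        rw [mem_iff_span_le, hJ]
        exact Ideal.mul_le_right.trans hJQ
      have h3 := sub_mem h2 (Ideal.pow_le_self two_ne_zero h1)
      rw [sub_sub_cancel] at h3
      exact Q.isPrime.ne_top ((Ideal.eq_top_iff_one _).2 h3)
  have hJ1 : idealClass J = 1 := idealClass_eq_one_of_forall
    (p := fun I => IsCoprime I (orderConductor O))
    (fun I J h => ⟨h.of_mul_left_left, h.of_mul_left_right⟩) hcon hJ0 hJreg
  have h1 := idealClass_span hx0
  rw [hJ, idealClass_mul P.ne_bot hJ0, hJ1, mul_one] at h1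
  exact hP h1

lemma nontrivialClassesContainPrimes_of_card_eq_two (hO : IsOrder O)
    (h : Nat.card (ClassGroup R) = 2) : NontrivialClassesContainPrimes O := by
  have : Nontrivial (ClassGroup R) := by
    have := Nat.finite_of_card_ne_zero (α := ClassGroup R) (by lia)
    exact Finite.one_lt_card_iff_nontrivial.1 (by lia)
  obtain ⟨P, hP, hc⟩ := exists_isCoprime_idealClass_ne_one hO
  exact fun c hc' => ⟨P, hP, ((Nat.card_eq_two_iff' (1 : ClassGroup R)).1 h).unique hc hc'⟩

end Classes

/-! ### The Picard group of the order -/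

section Picard

variable {R : Type u} [CommRing R] [IsDedekindDomain R] {O : Subring R}

/-- If `r * s` is congruent to `1` modulo the conductor, then `r R ∩ O` and `s R ∩ O` are
invertible ideals, inverse to each other up to the factor `r * s`. -/
lemma comap_span_mul_comap_span {r s : R} (h : r * s - 1 ∈ orderConductor O) :
    (Ideal.span {r}).comap O.subtype * (Ideal.span {s}).comap O.subtype =
      Ideal.span {⟨r * s, mem_of_sub_mem_orderConductor O.one_mem h⟩} := by
  have hrs : r * s ∈ O := mem_of_sub_mem_orderConductor O.one_mem h
  refine le_antisymm (Ideal.mul_le.2 ?_) ?_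
  · rintro x hx y hy
    obtain ⟨a, ha⟩ := Ideal.mem_span_singleton'.1 (Ideal.mem_comap.1 hx)
    obtain ⟨b, hb⟩ := Ideal.mem_span_singleton'.1 (Ideal.mem_comap.1 hy)
    have ha' : a * r = x := ha
    have hb' : b * s = y := hb
    have hab : a * b ∈ O := by
      have h1 : (x : R) * y - (r * s - 1) * (a * b) ∈ O :=
        O.sub_mem (O.mul_mem x.2 y.2) (h _)
      convert h1 using 1
      rw [← ha', ← hb']
      ring
    refine Ideal.mem_span_singleton'.2 ⟨⟨a * b, hab⟩, Subtype.ext ?_⟩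
    change a * b * (r * s) = x * y
    rw [← ha', ← hb']
    ring
  · rw [Ideal.span_singleton_le_iff_mem]
    have hφ : r * s - 1 ∈ O := mem_of_mem_orderConductor h
    have hmem : ∀ (u v : R) (huv : v * u ∈ O), (⟨v * u, huv⟩ : O) ∈
        (Ideal.span {u}).comap O.subtype := fun u v huv =>
      Ideal.mem_span_singleton'.2 ⟨v, rfl⟩
    have h1 := Ideal.mul_mem_mul (hmem r s (by rwa [mul_comm])) (hmem s r hrs)
    have h2 := Ideal.mul_mem_mul (hmem r _ (h r)) (hmem s _ (h s))
    -- with `φ = r * s - 1`, this is `r * s` times `1 = (1 + φ) * (1 - φ) + φ * φ`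
    convert add_mem (Ideal.mul_mem_left _ (1 - ⟨_, hφ⟩) h1) h2 using 1
    refine Subtype.ext ?_
    change r * s = (1 - (r * s - 1)) * (s * r * (r * s)) + (r * s - 1) * r * ((r * s - 1) * s)
    ring

lemma map_comap_span {r s : R} (h : r * s - 1 ∈ orderConductor O) :
    ((Ideal.span {r}).comap O.subtype).map O.subtype = Ideal.span {r} := by
  have hrs : r * s ∈ O := mem_of_sub_mem_orderConductor O.one_mem h
  refine le_antisymm Ideal.map_comap_le ?_
  rw [Ideal.span_singleton_le_iff_mem]
  have hmem : ∀ (v : R) (hv : v * r ∈ O),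
      v * r ∈ ((Ideal.span {r}).comap O.subtype).map O.subtype := by
    intro v hv
    have h1 : (⟨v * r, hv⟩ : O) ∈ (Ideal.span {r}).comap O.subtype :=
      Ideal.mem_comap.2 (Ideal.mem_span_singleton'.2 ⟨v, rfl⟩)
    exact Ideal.mem_map_of_mem O.subtype h1
  have h1 := hmem s (by rwa [mul_comm])
  have h2 := hmem _ (h r)
  convert sub_mem (Ideal.mul_mem_left _ r h1) h2 using 1
  ring

/-- A prime ideal of `O` coprime to the conductor generates a prime ideal of `R`. -/
lemma map_eq_of_isCoprime {q : Ideal O}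
    (h : IsCoprime q ((orderConductor O).comap O.subtype)) {P : HeightOneSpectrum R}
    (hP : PrimeOver O P q) : q.map O.subtype = P.asIdeal := by
  refine le_antisymm (Ideal.map_le_iff_le_comap.2 (le_of_eq hP.symm)) fun x hx => ?_
  obtain ⟨u, hu, φ, hφ, huφ⟩ := Ideal.isCoprime_iff_exists.1 h
  have hφ' : (φ : R) ∈ orderConductor O := hφ
  have h1 : (⟨φ * x, hφ' x⟩ : O) ∈ q := by
    rw [← hP]
    exact P.asIdeal.mul_mem_left _ hx
  have h2 := add_mem (Ideal.mul_mem_left _ x (Ideal.mem_map_of_mem O.subtype hu))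
    (Ideal.mem_map_of_mem O.subtype h1)
  convert h2 using 1
  have h3 : (u : R) + φ = 1 := congrArg Subtype.val huφ
  change x = x * u + φ * x
  linear_combination (-x) * h3

/-- If an element `r` is coprime to the conductor, then `r R ∩ O` is an invertible ideal of `O`.
A prime ideal in the inverse class becomes principal in `R`. -/
lemma exists_mul_span_eq (hO : IsOrder O) (hfin : Finite (R ⧸ orderConductor O))
    (hPic : PicClassesContainPrimes O) {r : R} (hr0 : r ≠ 0)
    (hr : IsCoprime (Ideal.span {r}) (orderConductor O)) :
    ∃ (P : HeightOneSpectrum R) (a : O), IsCoprime P.asIdeal (orderConductor O) ∧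
      P.asIdeal * Ideal.span {r} = Ideal.span {(a : R)} := by
  obtain ⟨k, hk, hk1⟩ := exists_pow_sub_one_mem hfin hr
  have hrs : r * r ^ (k - 1) - 1 ∈ orderConductor O := by
    rwa [mul_pow_sub_one hk.ne']
  set s := r ^ (k - 1) with hs
  have hs0 : s ≠ 0 := pow_ne_zero _ hr0
  set Ir := (Ideal.span {r}).comap O.subtype with hIr
  have hunit : IsUnit (Ir : FractionalIdeal O⁰ (FractionRing O)) := by
    have h1 := congrArg (fun I : Ideal O => (I : FractionalIdeal O⁰ (FractionRing O)))
      (comap_span_mul_comap_span hrs)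
    simp only [FractionalIdeal.coeIdeal_mul, FractionalIdeal.coeIdeal_span_singleton] at h1
    have hne : algebraMap O (FractionRing O)
        ⟨r * s, mem_of_sub_mem_orderConductor O.one_mem hrs⟩ ≠ 0 := by
      rw [ne_eq, FaithfulSMul.algebraMap_eq_zero_iff]
      exact fun h => mul_ne_zero hr0 hs0 (congrArg Subtype.val h)
    have h2 := (toPrincipalIdeal O (FractionRing O) (Units.mk0 _ hne)).isUnit
    rw [coe_toPrincipalIdeal, Units.val_mk0, ← h1] at h2
    exact isUnit_of_mul_isUnit_left h2
  obtain ⟨U, hU⟩ := hunit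
  obtain ⟨q, I, hq, hqf, hIq, hIc⟩ := hPic (ClassGroup.mk (K := FractionRing O) U)⁻¹
  have hIU : ClassGroup.mk (K := FractionRing O) (I * U) = 1 := by
    rw [map_mul, hIc, inv_mul_cancel]
  obtain ⟨a, -, ha⟩ := (ClassGroup.mk_eq_one_of_coe_ideal (I' := q * Ir)
    (by rw [Units.val_mul, hIq, hU, FractionalIdeal.coeIdeal_mul])).1 hIU
  have hq0 : q ≠ ⊥ := by
    rintro rfl
    refine I.ne_zero ?_
    rw [hIq, FractionalIdeal.coeIdeal_bot]
  obtain ⟨P, hP⟩ := hO.exists_primeOver q hq0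
  have hmap := map_eq_of_isCoprime hqf hP
  refine ⟨P, a, ?_, ?_⟩
  · have h1 := hqf.map (Ideal.mapHom O.subtype)
    change IsCoprime (q.map O.subtype) (((orderConductor O).comap O.subtype).map O.subtype) at h1
    rw [hmap] at h1
    exact h1.of_isCoprime_of_dvd_right (Ideal.dvd_iff_le.2 Ideal.map_comap_le)
  · have h1 := congrArg (Ideal.map O.subtype) ha
    rw [Ideal.map_mul, hmap, hIr, map_comap_span hrs] at h1
    rw [h1]
    rw [Ideal.map_span, Set.image_singleton]
    rfl

variable {B : Type u} [CancelCommMonoid B] {θ : R⁰ →* B}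

theorem generatedIn_of_picClassesContainPrimes (hR : IsMulTorsion (ClassGroup R)) (hO : IsOrder O)
    (hfin : Finite (R ⧸ orderConductor O)) (hθ : IsTransferHom (θ.comp (orderInclusion O)))
    (hPic : PicClassesContainPrimes O) {r : R}
    (hr : IsCoprime (Ideal.span {r}) (orderConductor O)) : GeneratedIn O (Ideal.span {r}) := by
  by_cases hr0 : r = 0
  · exact ⟨0, O.zero_mem, by rw [hr0]⟩
  obtain ⟨P, a, hP, ha⟩ := exists_mul_span_eq hO hfin hPic hr0 hr
  have hc : idealClass P.asIdeal = 1 := by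
    have h0 : Ideal.span {(a : R)} ≠ ⊥ := ha ▸ mul_ne_zero P.ne_bot (span_singleton_ne_bot hr0)
    have h1 : idealClass (P.asIdeal * Ideal.span {r}) = 1 := by
      rw [ha]
      exact (idealClass_eq_one_iff h0).2 ⟨_, rfl⟩
    rwa [idealClass_mul P.ne_bot (span_singleton_ne_bot hr0), idealClass_span hr0, mul_one] at h1
  have hgen := generatedIn_pow_of_idealClass_pow_eq_one hR hO hfin hθ hP (m := 1)
    (by rw [pow_one, hc])
  rw [pow_one] at hgen
  exact GeneratedIn.of_mul_left hfin hP P.ne_bot hgen ⟨a, a.2, ha⟩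

end Picard

/-! ### Transfer Krull orders -/

theorem theorem1 {R : Type u} [CommRing R] [IsDedekindDomain R]
    (hR : IsMulTorsion (ClassGroup R))
    (O : Subring R) (hO : IsOrder O) (hfin : Finite (R ⧸ orderConductor O)) :
    (Nat.card (ClassGroup R) ≠ 2 → ClassesContainPrimes O →
      ((IsTransferKrull O⁰ ↔
          (MulUnitsEqAll O ∧
            ∀ (p : Ideal O) [p.IsPrime] (x : Localization.AtPrime p),
              Irreducible x → HasLocalValue O p x 1)) ∧
        (IsTransferKrull O⁰ →
          IsTransferHom (orderInclusion O) ∧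
          ∃ θ : O⁰ →* zeroSumMonoid (Additive (ClassGroup R)), IsTransferHom θ))) ∧
    (Nat.card (ClassGroup R) = 2 → PicClassesContainPrimes O →
      (IsTransferKrull O⁰ ↔
        (MulUnitsEqAll O ∧
          ∀ (p : Ideal O) [p.IsPrime],
            (∀ x : Localization.AtPrime p, Irreducible x →
              HasLocalValue O p x 1 ∨ HasLocalValue O p x 2) ∧
            ((∃ P : IsDedekindDomain.HeightOneSpectrum R,
                PrimeOver O P p ∧ P.asIdeal.IsPrincipal) →
              ∀ x : Localization.AtPrime p, Irreducible x → HasLocalValue O p x 1)))) := by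
  refine ⟨fun hcard hC => ?_, fun hcard hPic => ?_⟩
  · have hNP : NontrivialClassesContainPrimes O := fun c _ => hC.exists_idealClass_eq c
    have hthird := exists_ne_of_card_ne_two hcard
    have hfwd : IsTransferKrull O⁰ → MulUnitsEqAll O ∧
        (∀ (p : Ideal O) [p.IsPrime] (x : Localization.AtPrime p),
          Irreducible x → HasLocalValue O p x 1) := by
      intro h
      obtain ⟨B, _, θ, hθ⟩ := exists_extension_of_isTransferKrull hO h
      have hSF : ∀ P Q : HeightOneSpectrum R, _ → P = Q :=
        fun P Q => eq_of_comap_eq hR hO hfin hθ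
      have hgen : ∀ r : R, IsCoprime (Ideal.span {r}) (orderConductor O) →
          GeneratedIn O (Ideal.span {r}) := by
        intro r hr
        by_cases hr0 : r = 0
        · exact ⟨0, O.zero_mem, by rw [hr0]⟩
        · exact generatedIn_of_idealClass_eq_one hR hO hfin hθ hNP hthird
            (span_singleton_ne_bot hr0) hr (idealClass_span hr0)
      have hval : ∀ (P : HeightOneSpectrum R) (y : O), IsLocallyIrreducible O P y →
          ordAt P (Ideal.span {(y : R)}) = 1 :=
        fun P y hy => ordAt_eq_one hO hfin hSF hgen hθ hR hNP hthird hy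
      refine ⟨mulUnitsEqAll hO hSF hgen fun P y hy => Or.inl (hval P y hy), ?_⟩
      intro p _ x hx
      obtain ⟨P, y, -, hy, hiff⟩ := exists_isLocallyIrreducible_hasLocalValue_iff hO hSF p hx
      exact (hiff 1).2 (hval P y hy)
    have hbwd : (MulUnitsEqAll O ∧
        (∀ (p : Ideal O) [p.IsPrime] (x : Localization.AtPrime p),
          Irreducible x → HasLocalValue O p x 1)) → IsTransferHom (orderInclusion O) := by
      rintro ⟨hU, hb⟩
      have hSF := eq_of_comap_eq_of_hasLocalValue hO fun p _ x hx => ⟨1, hb p x hx⟩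
      refine isTransferHom_orderInclusion hO hSF hU fun P y hy => ?_
      have := P.isPrime
      exact (hy.hasLocalValue_iff hSF 1).1 (hb _ _ hy)
    refine ⟨⟨hfwd, fun h => ⟨R⁰, nonZeroDivisorsCancelCommMonoid R, orderInclusion O,
      isKrullMonoid_nonZeroDivisors R, hbwd h⟩⟩, fun h => ⟨hbwd (hfwd h), ?_⟩⟩
    have hβ := isTransferHom_blockHom fun c : ClassGroup R =>
      (hC.exists_idealClass_eq c).imp fun _ => And.right
    exact ⟨_, hβ.comp (hbwd (hfwd h))⟩
  · have hNP := nontrivialClassesContainPrimes_of_card_eq_two hO hcard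
    constructor
    · intro h
      obtain ⟨B, _, θ, hθ⟩ := exists_extension_of_isTransferKrull hO h
      have hSF : ∀ P Q : HeightOneSpectrum R, _ → P = Q :=
        fun P Q => eq_of_comap_eq hR hO hfin hθ
      have hgen : ∀ r : R, IsCoprime (Ideal.span {r}) (orderConductor O) →
          GeneratedIn O (Ideal.span {r}) :=
        fun r => generatedIn_of_picClassesContainPrimes hR hO hfin hθ hPic
      have hval : ∀ (P : HeightOneSpectrum R) (y : O), IsLocallyIrreducible O P y → _ :=
        fun P y hy => ordAt_eq_one_or_eq_two hO hfin hSF hgen hθ hNP hy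
      refine ⟨mulUnitsEqAll hO hSF hgen fun P y hy => (hval P y hy).imp_right And.left,
        fun p _ => ⟨fun x hx => ?_, ?_⟩⟩
      · obtain ⟨P, y, -, hy, hiff⟩ := exists_isLocallyIrreducible_hasLocalValue_iff hO hSF p hx
        rw [hiff, hiff]
        exact (hval P y hy).imp_right And.left
      · rintro ⟨P', hP', hprin⟩ x hx
        obtain ⟨P, y, hPQ, hy, hiff⟩ := exists_isLocallyIrreducible_hasLocalValue_iff hO hSF p hx
        obtain rfl := (hPQ P').1 hP'
        rw [hiff]
        refine (hval P' y hy).resolve_right fun h => h.2 ?_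
        obtain ⟨z, hz⟩ := hprin
        exact (idealClass_eq_one_iff P'.ne_bot).2 ⟨z, hz⟩
    · rintro ⟨hU, hb⟩
      have hSF := eq_of_comap_eq_of_hasLocalValue hO fun p _ x hx =>
        ((hb p).1 x hx).elim (fun h => ⟨1, h⟩) fun h => ⟨2, h⟩
      obtain ⟨P₀, -⟩ := hNP
        (Classical.choose ((Nat.card_eq_two_iff' (1 : ClassGroup R)).1 hcard))
        (Classical.choose_spec ((Nat.card_eq_two_iff' (1 : ClassGroup R)).1 hcard)).1
      refine isTransferKrull_of_two_classes hO hSF hU (mul_eq_one_of_card_eq_two hcard) ⟨P₀⟩ ?_ ?_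
      · intro P y hy
        have := P.isPrime
        rw [← hy.hasLocalValue_iff hSF, ← hy.hasLocalValue_iff hSF]
        exact (hb _).1 _ hy
      · intro P y hP hy
        have := P.isPrime
        rw [← hy.hasLocalValue_iff hSF]
        refine (hb _).2 ⟨P, rfl, ?_⟩ _ hy
        obtain ⟨z, hz⟩ := (idealClass_eq_one_iff P.ne_bot).1 hP
        exact ⟨z, hz⟩
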